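/- Let $M$ be a smooth four-dimensional manifold (Hausdorff, $\sigma$-compact, without boundary) with a smooth pseudo-Riemannian metric $g$ of signature $(1,3)$ (in either sign convention, i.e. $\det(g_{\mu\nu})<0$). Use the conventions $R^\alpha{}_{\mu\beta\nu}=\partial_\beta\Gamma^\alpha_{\mu\nu}-\partial_\nu\Gamma^\alpha_{\mu\beta}+\Gamma^\lambda_{\mu\nu}\Gamma^\alpha_{\beta\lambda}-\Gamma^\lambda_{\mu\beta}\Gamma^\alpha_{\nu\lambda}$, $R_{\mu\nu}=R^\alpha{}_{\mu\alpha\nu}$, $R=g^{\mu\nu}R_{\mu\nu}$, $\Box=g^{\mu\nu}\nabla_\mu\nabla_\nu$, $K_{\mu\nu}=\nabla_\mu\nabla_\nu-g_{\mu\nu}\Box$, and for scalars $A,B$ $$S_{\mu\nu}(A,B)=g_{\mu\nu}\nabla^\alpha A\,\nabla_\alpha B+g_{\mu\nu}A\,\Box B-2\nabla_\mu A\,\nabla_\nu B .$$ Let $g_\varepsilon$, $|\varepsilon|<r$, be a smooth one-parameter family of such metrics with $g_0=g$ and $g_\varepsilon=g$ outside a fixed compact subset of $M$, and write $\delta=\frac{d}{d\varepsilon}\big|_{\varepsilon=0}$.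 Let $P,Q$ be smooth real functions on an open subset of $\mathbb R$ that contains all values of the scalar curvature $R$ of $g$; on $M$ we write $P=P(R)$, $Q=Q(R)$, $Q'=Q'(R)$. Then $\delta g^{\mu\nu}$, $\delta\sqrt{-g}$ and $\delta R$ exist, the integrals below converge, and $$\int_M P\,\delta(\sqrt{-g})\,d^4x=-\tfrac12\int_M g_{\mu\nu}P\,\delta g^{\mu\nu}\sqrt{-g}\,d^4x,$$ $$\int_M P\,\delta R\,\sqrt{-g}\,d^4x=\int_M\left(R_{\mu\nu}P-K_{\mu\nu}P\right)\delta g^{\mu\nu}\sqrt{-g}\,d^4x.$$ Moreover, let $(f_n)_{n\ge0}$ be real numbers and $\mathcal F(\Box)=\sum_{n=0}^\infty f_n\Box^n$, where the following is assumed about convergence. The series $\mathcal F(\Box)P$ converges locally uniformly on $M$ and its sum is of class $C^2$. Writing $R_\varepsilon$ and $\Box_\varepsilon$ for the scalar curvature and the d'Alembertian of $g_\varepsilon$, the series $\mathcal F(\Box_\varepsilon)Q(R_\varepsilon)=\sum_n f_n\Box_\varepsilon^nQ(R_\varepsilon)$ converges pointwise on $M$ for every $|\varepsilon|<r$, and the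 partial sums, differentiated in $\varepsilon$, converge locally uniformly on $(-r,r)\times M$. Then $\delta(\mathcal F(\Box)Q)$ exists at every point, and $$\int_M P\,\delta(\mathcal F(\Box)Q)\sqrt{-g}\,d^4x=\int_M\Big(R_{\mu\nu}\,Q'\mathcal F(\Box)P-K_{\mu\nu}\big(Q'\mathcal F(\Box)P\big)\Big)\delta g^{\mu\nu}\sqrt{-g}\,d^4x+\frac12\sum_{n=1}^\infty f_n\sum_{l=0}^{n-1}\int_M S_{\mu\nu}\big(\Box^lP,\Box^{n-1-l}Q\big)\,\delta g^{\mu\nu}\sqrt{-g}\,d^4x,$$ where all integrals and the series over $n$ converge. -/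

import Mathlib

open Set Filter Topology MeasureTheory
open scoped Manifold ContDiff

noncomputable section

namespace NonlocalGravity

/-- The model space of a four-dimensional manifold. -/
abbrev E4 : Type := EuclideanSpace ℝ (Fin 4)

/-! ### Calculus in coordinates

Here `G : E4 → Matrix (Fin 4) (Fin 4) ℝ` is the matrix of components `g_{ij}` of a metric in a
coordinate system, and functions on a coordinate domain are functions on `E4` of which only the
values on an open set matter. -/

/-- The partial derivative `∂_i u`. -/
def pd (i : Fin 4) (u : E4 → ℝ) (y : E4) : ℝ :=
  fderiv ℝ u y (EuclideanSpace.single i 1)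

/-- The Christoffel symbol `Γ^k_{ij}` of the Levi-Civita connection. -/
def christoffel (G : E4 → Matrix (Fin 4) (Fin 4) ℝ) (k i j : Fin 4) (y : E4) : ℝ :=
  (1 / 2) * ∑ l, (G y)⁻¹ k l *
    (pd i (fun z => G z l j) y + pd j (fun z => G z i l) y - pd l (fun z => G z i j) y)

/-- The Riemann tensor
`R^α_{μβν} = ∂_β Γ^α_{μν} - ∂_ν Γ^α_{μβ} + Γ^λ_{μν} Γ^α_{βλ} - Γ^λ_{μβ} Γ^α_{νλ}`. -/
def riemann (G : E4 → Matrix (Fin 4) (Fin 4) ℝ) (α μ β ν : Fin 4) (y : E4) : ℝ :=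
  pd β (christoffel G α μ ν) y - pd ν (christoffel G α μ β) y
    + ∑ l, (christoffel G l μ ν y * christoffel G α β l y
        - christoffel G l μ β y * christoffel G α ν l y)

/-- The Ricci tensor `R_{μν} = R^α_{μαν}`. -/
def ricci (G : E4 → Matrix (Fin 4) (Fin 4) ℝ) (μ ν : Fin 4) (y : E4) : ℝ :=
  ∑ α, riemann G α μ α ν y

/-- The scalar curvature `g^{μν} R_{μν}` in coordinates. -/
def localScalar (G : E4 → Matrix (Fin 4) (Fin 4) ℝ) (y : E4) : ℝ :=
  ∑ μ, ∑ ν, (G y)⁻¹ μ ν * ricci G μ ν y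

/-- The second covariant derivative `∇_μ ∇_ν u = ∂_μ ∂_ν u - Γ^λ_{μν} ∂_λ u` of a scalar. -/
def hess (G : E4 → Matrix (Fin 4) (Fin 4) ℝ) (u : E4 → ℝ) (μ ν : Fin 4) (y : E4) : ℝ :=
  pd μ (pd ν u) y - ∑ l, christoffel G l μ ν y * pd l u y

/-- The d'Alembertian `g^{μν} ∇_μ ∇_ν u` in coordinates. -/
def localBox (G : E4 → Matrix (Fin 4) (Fin 4) ℝ) (u : E4 → ℝ) (y : E4) : ℝ :=
  ∑ μ, ∑ ν, (G y)⁻¹ μ ν * hess G u μ ν y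

/-- `K_{μν} u = ∇_μ ∇_ν u - g_{μν} □ u`. -/
def opK (G : E4 → Matrix (Fin 4) (Fin 4) ℝ) (u : E4 → ℝ) (μ ν : Fin 4) (y : E4) : ℝ :=
  hess G u μ ν y - G y μ ν * localBox G u y

/-- `S_{μν}(A, B) = g_{μν} ∇^α A ∇_α B + g_{μν} A □ B - 2 ∇_μ A ∇_ν B`. -/
def tensorS (G : E4 → Matrix (Fin 4) (Fin 4) ℝ) (A B : E4 → ℝ) (μ ν : Fin 4) (y : E4) : ℝ :=
  G y μ ν * (∑ α, ∑ β, (G y)⁻¹ α β * pd α A y * pd β B y)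
    + G y μ ν * (A y * localBox G B y) - 2 * (pd μ A y * pd ν B y)

/-! ### Metrics on a four-dimensional manifold -/

section Manifold

variable {M : Type*} [TopologicalSpace M] [ChartedSpace E4 M]

variable (M) in
/-- A field of bilinear forms on the tangent spaces of `M`. -/
abbrev BilinField : Type _ :=
  ∀ x : M, TangentSpace (𝓡 4) x →L[ℝ] TangentSpace (𝓡 4) x →L[ℝ] ℝ

/-- The coordinate vector field `∂_i` of the chart `φ` at `c`, at the point `φ⁻¹ y`. -/
def coordVector (c : M) (i : Fin 4) (y : E4) :
    TangentSpace (𝓡 4) ((extChartAt (𝓡 4) c).symm y) :=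
  mfderiv 𝓘(ℝ, E4) (𝓡 4) (extChartAt (𝓡 4) c).symm y (EuclideanSpace.single i (1 : ℝ) : E4)

/-- The components `g_{ij} = g(∂_i, ∂_j)` in the chart at `c`, as functions of the coordinates
(meaningful on the target of the chart). -/
def comp (g : BilinField M) (c : M) (y : E4) : Matrix (Fin 4) (Fin 4) ℝ :=
  Matrix.of fun i j =>
    g ((extChartAt (𝓡 4) c).symm y) (coordVector c i y) (coordVector c j y)

/-- A smooth metric tensor with negative determinant. In dimension four a symmetric matrix has
negative determinant exactly when it is nondegenerate of signature `(1,3)` or `(3,1)`, so this is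
a pseudo-Riemannian metric of Lorentzian signature, in either sign convention. -/
structure IsLorentzMetric (g : BilinField M) : Prop where
  symm : ∀ (x : M) (v w : TangentSpace (𝓡 4) x), g x v w = g x w v
  smooth : ∀ (c : M) (i j : Fin 4),
    ContDiffOn ℝ ∞ (fun y => comp g c y i j) (extChartAt (𝓡 4) c).target
  det_neg : ∀ c : M, ∀ y ∈ (extChartAt (𝓡 4) c).target, (comp g c y).det < 0

/-- `γ ε`, `|ε| < r`, is a smooth one-parameter family of metrics with `γ 0 = g` which differ
from `g` only on a fixed compact set: a compactly supported variation of the metric `g`. -/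
structure IsVariation (g : BilinField M) (γ : ℝ → BilinField M) (r : ℝ) : Prop where
  pos : 0 < r
  zero : γ 0 = g
  metric : ∀ ε ∈ Ioo (-r) r, IsLorentzMetric (γ ε)
  smooth : ∀ (c : M) (i j : Fin 4),
    ContDiffOn ℝ ∞ (fun p : ℝ × E4 => comp (γ p.1) c p.2 i j)
      (Ioo (-r) r ×ˢ (extChartAt (𝓡 4) c).target)
  compact_support : ∃ K : Set M, IsCompact K ∧ ∀ ε ∈ Ioo (-r) r, ∀ x ∉ K, γ ε x = g x

/-- The scalar curvature `R` (a scalar, so it can be computed at `x` in the chart at `x`). -/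
def scalarCurv (g : BilinField M) (x : M) : ℝ :=
  localScalar (comp g x) (extChartAt (𝓡 4) x x)

/-- The d'Alembertian `□ u` (a scalar, so it can be computed at `x` in the chart at `x`). -/
def box (g : BilinField M) (u : M → ℝ) (x : M) : ℝ :=
  localBox (comp g x) (u ∘ (extChartAt (𝓡 4) x).symm) (extChartAt (𝓡 4) x x)

/-- The partial sum `∑_{n < N} f_n □^n u`. -/
def partialF (g : BilinField M) (f : ℕ → ℝ) (u : M → ℝ) (N : ℕ) (x : M) : ℝ :=
  ∑ n ∈ Finset.range N, f n * ((box g)^[n] u) x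

/-- `𝓕(□) u = ∑_{n ≥ 0} f_n □^n u`, the pointwise limit of the partial sums. -/
def opF (g : BilinField M) (f : ℕ → ℝ) (u : M → ℝ) (x : M) : ℝ :=
  limUnder atTop fun N => partialF g f u N x

/-- The components of `R_{μν} u - K_{μν} u` in the chart at `c`, for a scalar `u`. -/
def ricciMinusK (g : BilinField M) (u : M → ℝ) (c : M) (μ ν : Fin 4) (y : E4) : ℝ :=
  ricci (comp g c) μ ν y * u ((extChartAt (𝓡 4) c).symm y)
    - opK (comp g c) (u ∘ (extChartAt (𝓡 4) c).symm) μ ν y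

/-- The components of `S_{μν}(A, B)` in the chart at `c`, for scalars `A` and `B`. -/
def fieldS (g : BilinField M) (A B : M → ℝ) (c : M) (μ ν : Fin 4) (y : E4) : ℝ :=
  tensorS (comp g c) (A ∘ (extChartAt (𝓡 4) c).symm) (B ∘ (extChartAt (𝓡 4) c).symm) μ ν y

/-! ### First variations -/

/-- `√(-g)` in the chart at `c`. -/
def sqrtNegDet (g : BilinField M) (c : M) (y : E4) : ℝ :=
  Real.sqrt (-(comp g c y).det)

/-- `δ√(-g)` in the chart at `c`. -/
def deltaSqrt (γ : ℝ → BilinField M) (c : M) (y : E4) : ℝ :=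
  deriv (fun ε => sqrtNegDet (γ ε) c y) 0

/-- `δg^{μν}` in the chart at `c`. -/
def deltaInv (γ : ℝ → BilinField M) (c : M) (μ ν : Fin 4) (y : E4) : ℝ :=
  deriv (fun ε => (comp (γ ε) c y)⁻¹ μ ν) 0

/-- `δR`. -/
def deltaR (γ : ℝ → BilinField M) (x : M) : ℝ :=
  deriv (fun ε => scalarCurv (γ ε) x) 0

/-- `δ(𝓕(□) Q(R))`. -/
def deltaF (γ : ℝ → BilinField M) (f : ℕ → ℝ) (Q : ℝ → ℝ) (x : M) : ℝ :=
  deriv (fun ε => opF (γ ε) f (fun z => Q (scalarCurv (γ ε) z)) x) 0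

/-! ### Integration of densities

A density on `M` is given by its coordinate expressions `D c`, one for each chart; only the values
of `D c` on the target of the chart at `c` matter. -/

/-- The density `u √(-g)` for a scalar `u`. -/
def scalarDensity (g : BilinField M) (u : M → ℝ) (c : M) (y : E4) : ℝ :=
  u ((extChartAt (𝓡 4) c).symm y) * sqrtNegDet g c y

/-- The density `T_{μν} δg^{μν} √(-g)`, where `T c μ ν` are the components of a tensor `T` in the
chart at `c`. -/
def pairingDensity (g : BilinField M) (γ : ℝ → BilinField M)
    (T : M → Fin 4 → Fin 4 → E4 → ℝ) (c : M) (y : E4) : ℝ :=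
  (∑ μ, ∑ ν, T c μ ν y * deltaInv γ c μ ν y) * sqrtNegDet g c y

variable [IsManifold (𝓡 4) ∞ M] [T2Space M] [SigmaCompactSpace M]

variable (M) in
/-- A smooth partition of unity subordinate to the atlas of the charts at the points of `M`. -/
def atlasPartition : SmoothPartitionOfUnity M (𝓡 4) M univ :=
  (SmoothPartitionOfUnity.exists_isSubordinate_chartAt_source (𝓡 4) M).choose

/-- The piece of the density `D` cut out by the `c`-th function of the partition of unity. -/
def densityPiece (D : M → E4 → ℝ) (c : M) (y : E4) : ℝ :=
  atlasPartition M c ((extChartAt (𝓡 4) c).symm y) * D c y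

/-- The integral of a density over `M`, by means of a partition of unity. -/
def densityIntegral (D : M → E4 → ℝ) : ℝ :=
  ∑ᶠ c, ∫ y in (extChartAt (𝓡 4) c).target, densityPiece D c y

/-- Only finitely many pieces of the density are nonzero, and each of them is integrable. -/
def DensityIntegrable (D : M → E4 → ℝ) : Prop :=
  {c : M | ∃ y ∈ (extChartAt (𝓡 4) c).target, densityPiece D c y ≠ 0}.Finite ∧
    ∀ c : M, IntegrableOn (densityPiece D c) (extChartAt (𝓡 4) c).target

end Manifold

end NonlocalGravity

end

open NonlocalGravity

/-!
The idea is that each of the identities holds pointwise up to the divergence of a compactly supported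
vector density, and the integral of such a divergence vanishes.

In coordinates, all three rest on the first variation of the volume factor,
`δ√(-g) = -½ √(-g) g_{μν} δg^{μν}` (`MetricFamily.dVol_eq`), which already gives the first identity.
For the scalar curvature, `δR = R_{μν} δg^{μν} + g^{μν} δR_{μν}`, and by the Palatini identity
(`MetricFamily.div_palatiniFlux`) `√(-g) g^{μν} δR_{μν}` is the divergence of an expression in
`δΓ`. Multiplying by a scalar `u` and moving two derivatives onto `u` turns the second term into
`-K_{μν} u δg^{μν}` plus a divergence (`MetricFamily.div_scalarFlux`); the contractions of `δΓ` that
occur are the variations of `∂_α √(-g) = √(-g) Γ^l_{αl}` and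
`∂_μ (√(-g) g^{μα}) = -√(-g) g^{μν} Γ^α_{μν}`. For the d'Alembertian, the variation of its divergence
form `√(-g) □v = ∂_μ (√(-g) g^{μν} ∂_ν v)` (`LocalMetric.vol_mul_localBox`) shows that `A δ(□v)` is
`½ S_{μν}(A, v) δg^{μν} + □A δv` up to a divergence (`MetricFamily.div_boxFlux`).

To integrate these over the manifold, one needs that all the terms are densities, that is, the
transformation laws of the Christoffel symbols and of the curvature (`Isometric.conn_law`,
`Isometric.curv_law`). Both identities are additive and local in the scalar `u` or `A`, so that a
partition of unity reduces them to scalars supported in the domain of one chart, where the integral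
over the manifold is an integral in that chart (`densityIntegral_eq_chart`,
`densityIntegral_eq_zero_of_local`). The results are `integral_mul_deltaR` and
`integral_mul_delta_box`.

Induction on `n` gives `∫ A δ(□ⁿv) = ∫ □ⁿA δv + ½ ∑_{l<n} ∫ S_{μν}(□^l A, □^{n-1-l} v) δg^{μν}`
(`integral_mul_delta_iterate_box`). Summing over `n < N` with the coefficients `f_n`, for `A = P(R)`
and `v = Q(R)`, both integrals without `S` converge as `N → ∞`, since everything lives on a fixed
compact set, on which the partial sums converge uniformly (`tendsto_densityIntegral`). Hence the sums
of the integrals of `S` converge too. In the limit, `δv = Q' δR` and the second identity for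
`u = Q' 𝓕(□)P` give the third one (`integral_mul_delta_opF`).
-/

noncomputable section

namespace NonlocalGravity

open Matrix

/-! ### Derivatives of determinants and inverse matrices -/

section MatrixCalculus

variable {X : Type*} [NormedAddCommGroup X] [NormedSpace ℝ X]

/-- The entrywise derivative of a matrix-valued function at `x` in the direction `v`. No norm on
matrices is needed. -/
def matDeriv (A : X → Matrix (Fin 4) (Fin 4) ℝ) (x v : X) :
    Matrix (Fin 4) (Fin 4) ℝ :=
  Matrix.of fun i j => fderiv ℝ (fun z => A z i j) x v

lemma matDeriv_congr {A B : X → Matrix (Fin 4) (Fin 4) ℝ} {x : X} (h : A =ᶠ[𝓝 x] B) (v : X) :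
    matDeriv A x v = matDeriv B x v := by
  ext i j
  have : (fun z => A z i j) =ᶠ[𝓝 x] fun z => B z i j := h.mono fun z hz => by simp only [hz]
  simp only [matDeriv, Matrix.of_apply, this.fderiv_eq]

lemma matDeriv_mul {A B : X → Matrix (Fin 4) (Fin 4) ℝ} {x : X}
    (hA : ∀ i j, DifferentiableAt ℝ (fun z => A z i j) x)
    (hB : ∀ i j, DifferentiableAt ℝ (fun z => B z i j) x) (v : X) :
    matDeriv (fun z => A z * B z) x v = matDeriv A x v * B x + A x * matDeriv B x v := by
  ext i j
  simp only [matDeriv, Matrix.of_apply, Matrix.mul_apply, Matrix.add_apply]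
  rw [fderiv_fun_sum fun k _ => (hA i k).fun_mul (hB k j), _root_.sum_apply,
    ← Finset.sum_add_distrib]
  refine Finset.sum_congr rfl fun k _ => ?_
  rw [fderiv_fun_mul (hA i k) (hB k j)]
  simp only [_root_.add_apply, _root_.smul_apply, smul_eq_mul]
  ring

lemma contDiff_det (n : WithTop ℕ∞) :
    ContDiff ℝ n (fun A : Fin 4 → Fin 4 → ℝ => (Matrix.of A).det) := by
  simp only [Matrix.det_apply, Matrix.of_apply]
  fun_prop

lemma contDiffOn_det {n : WithTop ℕ∞} {A : X → Matrix (Fin 4) (Fin 4) ℝ} {s : Set X}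
    (hA : ∀ i j, ContDiffOn ℝ n (fun z => A z i j) s) : ContDiffOn ℝ n (fun z => (A z).det) s :=
  (contDiff_det n).comp_contDiffOn
    (contDiffOn_pi.2 fun i => contDiffOn_pi.2 fun j => hA i j)

lemma contDiffAt_matrix_inv {n : WithTop ℕ∞} {B : Fin 4 → Fin 4 → ℝ}
    (hB : (Matrix.of B).det ≠ 0) (i j : Fin 4) :
    ContDiffAt ℝ n (fun B : Fin 4 → Fin 4 → ℝ => (Matrix.of B)⁻¹ i j) B := by
  have h : ∀ B : Fin 4 → Fin 4 → ℝ, (Matrix.of B)⁻¹ i j = ((Matrix.of B).det)⁻¹ *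
      (Matrix.of (Function.update B j (Pi.single i 1))).det := by
    intro B
    rw [Matrix.inv_def, Matrix.smul_apply, Matrix.adjugate_apply, Ring.inverse_eq_inv',
      smul_eq_mul]
    rfl
  simp only [h]
  refine ((contDiff_det n).contDiffAt.inv hB).mul
    ((contDiff_det n).contDiffAt.comp B (ContDiff.contDiffAt ?_))
  refine contDiff_pi.2 fun k => ?_
  by_cases hk : k = j
  · subst hk
    simpa only [Function.update_self] using contDiff_const
  · simpa only [Function.update_of_ne hk] using contDiff_apply ℝ (Fin 4 → ℝ) k

lemma contDiffOn_inv {n : WithTop ℕ∞} {A : X → Matrix (Fin 4) (Fin 4) ℝ} {s : Set X}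
    (hA : ∀ i j, ContDiffOn ℝ n (fun z => A z i j) s) (hdet : ∀ z ∈ s, (A z).det ≠ 0)
    (i j : Fin 4) : ContDiffOn ℝ n (fun z => (A z)⁻¹ i j) s := fun z hz =>
  (contDiffAt_matrix_inv (hdet z hz) i j).comp_contDiffWithinAt z
    (contDiffWithinAt_pi.2 fun k => contDiffWithinAt_pi.2 fun l => hA k l z hz)

lemma differentiableAt_matrix_inv {A : X → Matrix (Fin 4) (Fin 4) ℝ} {x : X}
    (hA : ∀ i j, DifferentiableAt ℝ (fun z => A z i j) x) (hdet : (A x).det ≠ 0)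
    (i j : Fin 4) : DifferentiableAt ℝ (fun z => (A z)⁻¹ i j) x := by
  have hA' : DifferentiableAt ℝ (fun z => (fun i j => A z i j : Fin 4 → Fin 4 → ℝ)) x :=
    differentiableAt_pi.2 fun i => differentiableAt_pi.2 fun j => hA i j
  have h := contDiffAt_matrix_inv (n := 1) (B := fun i j => A x i j) hdet i j
  exact (h.differentiableAt one_ne_zero).comp x hA'

/-- Jacobi's formula, read off from the expansion of `det (1 + t A⁻¹ H)` to first order in `t`. -/
lemma fderiv_det {A : X → Matrix (Fin 4) (Fin 4) ℝ} {x : X}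
    (hA : ∀ i j, DifferentiableAt ℝ (fun z => A z i j) x) (hdet : (A x).det ≠ 0) (v : X) :
    DifferentiableAt ℝ (fun z => (A z).det) x ∧
    fderiv ℝ (fun z => (A z).det) x v = (A x).det * ((A x)⁻¹ * matDeriv A x v).trace := by
  set D : (Fin 4 → Fin 4 → ℝ) → ℝ := fun B => (Matrix.of B).det with hD
  set a : X → Fin 4 → Fin 4 → ℝ := fun z i j => A z i j with ha
  have hA' : DifferentiableAt ℝ a x :=
    differentiableAt_pi.2 fun i => differentiableAt_pi.2 fun j => hA i j
  have hDd : DifferentiableAt ℝ D (a x) :=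
    ((contDiff_det 1).differentiable one_ne_zero).differentiableAt
  have hcomp : (fun z => (A z).det) = D ∘ a := rfl
  refine ⟨by rw [hcomp]; exact hDd.comp x hA', ?_⟩
  set H : Matrix (Fin 4) (Fin 4) ℝ := matDeriv A x v with hH
  have hv : fderiv ℝ a x v = fun i j => H i j := by
    ext i j
    rw [fderiv_pi fun i => differentiableAt_pi.2 fun j => hA i j]
    simp only [ContinuousLinearMap.pi_apply]
    rw [show (fun z => a z i) = fun z j => A z i j from rfl, fderiv_pi fun j => hA i j]
    rfl
  rw [hcomp, fderiv_comp x hDd hA', ContinuousLinearMap.comp_apply, hv]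
  have hline : HasDerivAt (fun t : ℝ => D (a x + t • fun i j => H i j))
      (fderiv ℝ D (a x) fun i j => H i j) 0 := by
    have h1 : HasDerivAt (fun t : ℝ => a x + t • fun i j => H i j) (fun i j => H i j) 0 := by
      simpa using ((hasDerivAt_id (0 : ℝ)).smul_const (fun i j => H i j)).const_add (a x)
    have h2 : HasFDerivAt D (fderiv ℝ D (a x)) (a x + (0 : ℝ) • fun i j => H i j) := by
      simpa using hDd.hasFDerivAt
    exact h2.comp_hasDerivAt 0 h1
  have hexp : (fun t : ℝ => D (a x + t • fun i j => H i j)) = fun t => (A x).det *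
      (1 + ((A x)⁻¹ * H).trace * t + (Matrix.det (1 + (Polynomial.X : Polynomial ℝ) •
        ((A x)⁻¹ * H).map Polynomial.C)).divX.divX.eval t * t ^ 2) := by
    ext t
    rw [← Matrix.det_one_add_smul, ← Matrix.det_mul, Matrix.mul_add, Matrix.mul_smul,
      ← Matrix.mul_assoc, Matrix.mul_nonsing_inv _ (isUnit_iff_ne_zero.2 hdet), Matrix.one_mul,
      Matrix.mul_one]
    rfl
  rw [hexp] at hline
  have h3 : HasDerivAt (fun t : ℝ => (A x).det *
      (1 + ((A x)⁻¹ * H).trace * t + (Matrix.det (1 + (Polynomial.X : Polynomial ℝ) •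
        ((A x)⁻¹ * H).map Polynomial.C)).divX.divX.eval t * t ^ 2))
      ((A x).det * ((A x)⁻¹ * H).trace) 0 := by
    have := ((((hasDerivAt_id (0 : ℝ)).const_mul ((A x)⁻¹ * H).trace).const_add 1).add
      ((Polynomial.hasDerivAt (Matrix.det (1 + (Polynomial.X : Polynomial ℝ) •
        ((A x)⁻¹ * H).map Polynomial.C)).divX.divX (0 : ℝ)).mul
        (hasDerivAt_pow 2 (0 : ℝ)))).const_mul (A x).det
    simpa using this
  exact hline.unique h3

lemma matDeriv_inv {A : X → Matrix (Fin 4) (Fin 4) ℝ} {x : X}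
    (hA : ∀ i j, DifferentiableAt ℝ (fun z => A z i j) x) (hdet : (A x).det ≠ 0) (v : X) :
    matDeriv (fun z => (A z)⁻¹) x v = -((A x)⁻¹ * matDeriv A x v * (A x)⁻¹) := by
  have hinv := differentiableAt_matrix_inv hA hdet
  have hcont : ContinuousAt (fun z => (A z).det) x := (fderiv_det hA hdet 0).1.continuousAt
  have hone : (fun z => A z * (A z)⁻¹) =ᶠ[𝓝 x] fun _ => 1 :=
    (hcont.eventually_ne hdet).mono fun z hz => Matrix.mul_nonsing_inv _ (isUnit_iff_ne_zero.2 hz)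
  have h0 : matDeriv (fun _ : X => (1 : Matrix (Fin 4) (Fin 4) ℝ)) x v = 0 := by
    ext i j
    simp [matDeriv]
  have h1 := matDeriv_congr hone v
  rw [matDeriv_mul hA hinv, h0] at h1
  have hu := isUnit_iff_ne_zero.2 hdet
  calc matDeriv (fun z => (A z)⁻¹) x v
      = (A x)⁻¹ * (A x * matDeriv (fun z => (A z)⁻¹) x v) := by
        rw [← Matrix.mul_assoc, Matrix.nonsing_inv_mul _ hu, Matrix.one_mul]
    _ = (A x)⁻¹ * (-(matDeriv A x v * (A x)⁻¹)) := by
        rw [eq_neg_of_add_eq_zero_right h1]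
    _ = _ := by rw [Matrix.mul_neg, Matrix.mul_assoc]

/-- The derivative of the volume factor `√(-det A)`. -/
lemma fderiv_sqrt_neg_det {A : X → Matrix (Fin 4) (Fin 4) ℝ} {x : X}
    (hA : ∀ i j, DifferentiableAt ℝ (fun z => A z i j) x) (hdet : (A x).det < 0) (v : X) :
    DifferentiableAt ℝ (fun z => Real.sqrt (-(A z).det)) x ∧
    fderiv ℝ (fun z => Real.sqrt (-(A z).det)) x v =
      (1 / 2) * ((A x)⁻¹ * matDeriv A x v).trace * Real.sqrt (-(A x).det) := by
  obtain ⟨hd, hval⟩ := fderiv_det hA hdet.ne v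
  have hne : -(A x).det ≠ 0 := by linarith
  refine ⟨hd.neg.sqrt hne, ?_⟩
  rw [fderiv_sqrt hd.fun_neg hne, fderiv_fun_neg, _root_.smul_apply,
    _root_.neg_apply, hval, smul_eq_mul]
  have hs : Real.sqrt (-(A x).det) ≠ 0 := (Real.sqrt_pos.2 (by linarith)).ne'
  have hsq : Real.sqrt (-(A x).det) * Real.sqrt (-(A x).det) = -(A x).det :=
    Real.mul_self_sqrt (by linarith)
  field_simp
  rw [pow_two, hsq]
  ring

end MatrixCalculus

lemma two_le_infty : (2 : WithTop ℕ∞) ≤ ∞ :=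
  WithTop.coe_le_coe.2 (le_top : (2 : ℕ∞) ≤ ⊤)

/-! ### Partial derivatives, also of families depending on a parameter -/

section Slices

variable {O : Set (ℝ × E4)} {F : ℝ × E4 → ℝ}

lemma pd_slice {p : ℝ × E4} (hF : DifferentiableAt ℝ F p) (i : Fin 4) :
    pd i (fun z => F (p.1, z)) p.2 = fderiv ℝ F p (0, EuclideanSpace.single i 1) := by
  have h : HasFDerivAt (fun z : E4 => F (p.1, z))
      ((fderiv ℝ F p).comp (ContinuousLinearMap.inr ℝ ℝ E4)) p.2 :=
    HasFDerivAt.comp p.2 (g := F) (f := fun z : E4 => (p.1, z)) hF.hasFDerivAt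
      (hasFDerivAt_prodMk_right p.1 p.2)
  rw [pd, h.fderiv]
  simp

lemma deriv_slice {p : ℝ × E4} (hF : DifferentiableAt ℝ F p) :
    HasDerivAt (fun ε => F (ε, p.2)) (fderiv ℝ F p (1, 0)) p.1 := by
  have h : HasFDerivAt (fun ε : ℝ => F (ε, p.2))
      ((fderiv ℝ F p).comp (ContinuousLinearMap.inl ℝ ℝ E4)) p.1 :=
    HasFDerivAt.comp p.1 (g := F) (f := fun ε : ℝ => (ε, p.2)) hF.hasFDerivAt
      (hasFDerivAt_prodMk_left p.1 p.2)
  simpa using h.hasDerivAt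

lemma contDiffOn_slice {s : Set ℝ} {Ω : Set E4} {n : WithTop ℕ∞}
    (hF : ContDiffOn ℝ n F (s ×ˢ Ω)) {ε : ℝ} (hε : ε ∈ s) :
    ContDiffOn ℝ n (fun z => F (ε, z)) Ω :=
  hF.comp (contDiff_prodMk_right ε).contDiffOn fun _ hz => ⟨hε, hz⟩

lemma contDiffOn_fderiv_dir {Y : Type*} [NormedAddCommGroup Y] [NormedSpace ℝ Y]
    {m n : WithTop ℕ∞} {f : Y → ℝ} {s : Set Y} (hs : IsOpen s) (hf : ContDiffOn ℝ n f s)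
    (hmn : m + 1 ≤ n) (v : Y) : ContDiffOn ℝ m (fun p => fderiv ℝ f p v) s :=
  (hf.fderiv_of_isOpen hs hmn).clm_apply contDiffOn_const

lemma contDiffOn_pd {m n : WithTop ℕ∞} {f : E4 → ℝ} {s : Set E4} (hs : IsOpen s)
    (hf : ContDiffOn ℝ n f s) (hmn : m + 1 ≤ n) (i : Fin 4) : ContDiffOn ℝ m (pd i f) s :=
  contDiffOn_fderiv_dir hs hf hmn _

lemma ContDiffOn.differentiableAt_of_isOpen {Y : Type*} [NormedAddCommGroup Y] [NormedSpace ℝ Y]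
    {n : WithTop ℕ∞} {f : Y → ℝ} {s : Set Y} (hs : IsOpen s) (hf : ContDiffOn ℝ n f s)
    (hn : n ≠ 0) {p : Y} (hp : p ∈ s) : DifferentiableAt ℝ f p :=
  (hf.contDiffAt (hs.mem_nhds hp)).differentiableAt hn

lemma contDiffOn_family_pd (hO : IsOpen O) (hF : ContDiffOn ℝ ∞ F O) (i : Fin 4) :
    ContDiffOn ℝ ∞ (fun p : ℝ × E4 => pd i (fun z => F (p.1, z)) p.2) O :=
  (contDiffOn_fderiv_dir hO hF le_rfl (0, EuclideanSpace.single i 1)).congr fun p hp =>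
    pd_slice (ContDiffOn.differentiableAt_of_isOpen hO hF (by simp) hp) i

lemma contDiffOn_family_deriv (hO : IsOpen O) (hF : ContDiffOn ℝ ∞ F O) :
    ContDiffOn ℝ ∞ (fun p : ℝ × E4 => deriv (fun ε => F (ε, p.2)) p.1) O :=
  (contDiffOn_fderiv_dir hO hF le_rfl (1, 0)).congr fun p hp =>
    (deriv_slice (ContDiffOn.differentiableAt_of_isOpen hO hF (by simp) hp)).deriv

/-- Differentiation with respect to the parameter commutes with partial derivatives. -/
lemma deriv_pd_comm (hO : IsOpen O) (hF : ContDiffOn ℝ ∞ F O) (i : Fin 4) {p : ℝ × E4}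
    (hp : p ∈ O) :
    HasDerivAt (fun ε => pd i (fun z => F (ε, z)) p.2)
      (pd i (fun z => deriv (fun ε => F (ε, z)) p.1) p.2) p.1 := by
  set e : ℝ × E4 := (0, EuclideanSpace.single i 1)
  have h1 := contDiffOn_family_pd hO hF i
  have h2 := contDiffOn_family_deriv hO hF
  have d1 := deriv_slice (ContDiffOn.differentiableAt_of_isOpen hO h1 (by simp) hp)
  have d2 := pd_slice (ContDiffOn.differentiableAt_of_isOpen hO h2 (by simp) hp) i
  have hd : DifferentiableAt ℝ (fderiv ℝ F) p :=
    ((hF.contDiffAt (hO.mem_nhds hp)).fderiv_right (m := ∞) le_rfl).differentiableAt (by simp)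
  have key : ∀ v w : ℝ × E4, fderiv ℝ (fun q => fderiv ℝ F q v) p w =
      fderiv ℝ (fderiv ℝ F) p w v := by
    intro v w
    rw [fderiv_clm_apply hd (differentiableAt_const v)]
    simp
  have e1 : (fun q : ℝ × E4 => pd i (fun z => F (q.1, z)) q.2) =ᶠ[𝓝 p]
      fun q => fderiv ℝ F q e := by
    filter_upwards [hO.mem_nhds hp] with q hq
    exact pd_slice (ContDiffOn.differentiableAt_of_isOpen hO hF (by simp) hq) i
  have e2 : (fun q : ℝ × E4 => deriv (fun ε => F (ε, q.2)) q.1) =ᶠ[𝓝 p]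
      fun q => fderiv ℝ F q (1, 0) := by
    filter_upwards [hO.mem_nhds hp] with q hq
    exact (deriv_slice (ContDiffOn.differentiableAt_of_isOpen hO hF (by simp) hq)).deriv
  have hsymm : IsSymmSndFDerivAt ℝ F p :=
    (hF.contDiffAt (hO.mem_nhds hp)).isSymmSndFDerivAt (by simpa using two_le_infty)
  rw [e1.fderiv_eq, key] at d1
  rw [e2.fderiv_eq, key] at d2
  rw [hsymm.eq] at d1
  rw [← d2] at d1
  exact d1

lemma pd_comm {u : E4 → ℝ} {y : E4} (hu : ContDiffAt ℝ 2 u y) (i j : Fin 4) :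
    pd i (pd j u) y = pd j (pd i u) y := by
  have hd : DifferentiableAt ℝ (fderiv ℝ u) y :=
    (hu.fderiv_right (m := 1) (by norm_num)).differentiableAt one_ne_zero
  have key : ∀ v w : E4, fderiv ℝ (fun q => fderiv ℝ u q v) y w =
      fderiv ℝ (fderiv ℝ u) y w v := by
    intro v w
    rw [fderiv_clm_apply hd (differentiableAt_const v)]
    simp
  have hsymm : IsSymmSndFDerivAt ℝ u y := hu.isSymmSndFDerivAt (by simp)
  exact (key _ _).trans ((hsymm.eq _ _).trans (key _ _).symm)

end Slices

section PdRules

variable {u v : E4 → ℝ} {y : E4}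

lemma pd_congr (h : u =ᶠ[𝓝 y] v) (i : Fin 4) : pd i u y = pd i v y := by
  rw [pd, pd, h.fderiv_eq]

lemma pd_eventuallyEq (h : u =ᶠ[𝓝 y] v) (i : Fin 4) : pd i u =ᶠ[𝓝 y] pd i v :=
  (eventually_eventually_nhds.2 h).mono fun _ hz => pd_congr hz i

lemma pd_add (hu : DifferentiableAt ℝ u y) (hv : DifferentiableAt ℝ v y) (i : Fin 4) :
    pd i (fun z => u z + v z) y = pd i u y + pd i v y := by
  rw [pd, fderiv_fun_add hu hv]; rfl

lemma pd_sub (hu : DifferentiableAt ℝ u y) (hv : DifferentiableAt ℝ v y) (i : Fin 4) :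
    pd i (fun z => u z - v z) y = pd i u y - pd i v y := by
  rw [pd, fderiv_fun_sub hu hv]; rfl

lemma pd_mul (hu : DifferentiableAt ℝ u y) (hv : DifferentiableAt ℝ v y) (i : Fin 4) :
    pd i (fun z => u z * v z) y = pd i u y * v y + u y * pd i v y := by
  rw [pd, fderiv_fun_mul hu hv]
  simp only [_root_.add_apply, _root_.smul_apply, smul_eq_mul, pd]
  ring

lemma pd_sum {ι : Type*} (s : Finset ι) {u : ι → E4 → ℝ}
    (hu : ∀ k ∈ s, DifferentiableAt ℝ (u k) y) (i : Fin 4) :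
    pd i (fun z => ∑ k ∈ s, u k z) y = ∑ k ∈ s, pd i (u k) y := by
  rw [pd, fderiv_fun_sum hu, _root_.sum_apply]; rfl

lemma pd_const (a : ℝ) (i : Fin 4) : pd i (fun _ => a) y = 0 := by
  simp [pd]

end PdRules

/-! ### Lorentzian metrics in coordinates -/

/-- The volume factor `√(-det g)` of a metric in coordinates. -/
def vol (G : E4 → Matrix (Fin 4) (Fin 4) ℝ) (y : E4) : ℝ := Real.sqrt (-(G y).det)

/-- `G` is the matrix of a smooth metric of negative determinant on the open set `Ω`. -/
structure LocalMetric (G : E4 → Matrix (Fin 4) (Fin 4) ℝ) (Ω : Set E4) : Prop where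
  isOpen : IsOpen Ω
  smooth : ∀ i j, ContDiffOn ℝ ∞ (fun y => G y i j) Ω
  symm : ∀ y ∈ Ω, ∀ i j, G y i j = G y j i
  det_neg : ∀ y ∈ Ω, (G y).det < 0

namespace LocalMetric

variable {G : E4 → Matrix (Fin 4) (Fin 4) ℝ} {Ω : Set E4} (hG : LocalMetric G Ω) {y : E4}
  (hy : y ∈ Ω)

include hG

lemma inv_smooth (i j : Fin 4) : ContDiffOn ℝ ∞ (fun y => (G y)⁻¹ i j) Ω :=
  contDiffOn_inv hG.smooth (fun y hy => (hG.det_neg y hy).ne) i j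

lemma pd_metric_smooth (k i j : Fin 4) : ContDiffOn ℝ ∞ (pd k fun z => G z i j) Ω :=
  contDiffOn_pd hG.isOpen (hG.smooth i j) le_rfl k

lemma christoffel_smooth (k i j : Fin 4) : ContDiffOn ℝ ∞ (christoffel G k i j) Ω := by
  unfold christoffel
  refine contDiffOn_const.mul (ContDiffOn.sum fun l _ => (hG.inv_smooth k l).mul ?_)
  exact ((hG.pd_metric_smooth _ _ _).add (hG.pd_metric_smooth _ _ _)).sub
    (hG.pd_metric_smooth _ _ _)

lemma vol_smooth : ContDiffOn ℝ ∞ (vol G) Ω :=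
  (contDiffOn_det hG.smooth).neg.sqrt fun y hy => by have := hG.det_neg y hy; simp; exact this.ne

lemma ricci_smooth (μ ν : Fin 4) : ContDiffOn ℝ ∞ (ricci G μ ν) Ω := by
  unfold ricci riemann
  refine ContDiffOn.sum fun α _ => ((contDiffOn_pd hG.isOpen (hG.christoffel_smooth _ _ _)
    le_rfl _).sub (contDiffOn_pd hG.isOpen (hG.christoffel_smooth _ _ _) le_rfl _)).add
    (ContDiffOn.sum fun l _ => ?_)
  exact ((hG.christoffel_smooth _ _ _).mul (hG.christoffel_smooth _ _ _)).sub
    ((hG.christoffel_smooth _ _ _).mul (hG.christoffel_smooth _ _ _))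

lemma hess_contDiffOn {u : E4 → ℝ} {m n : WithTop ℕ∞} (hu : ContDiffOn ℝ n u Ω) (hm : m ≤ ∞)
    (hmn : m + 1 + 1 ≤ n) (μ ν : Fin 4) : ContDiffOn ℝ m (hess G u μ ν) Ω := by
  have h1 : m + 1 ≤ n := le_trans le_self_add hmn
  unfold hess
  exact (contDiffOn_pd hG.isOpen (contDiffOn_pd hG.isOpen hu hmn ν) le_rfl μ).sub
    (ContDiffOn.sum fun l _ => ((hG.christoffel_smooth l μ ν).of_le hm).mul
      (contDiffOn_pd hG.isOpen hu h1 l))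

lemma localBox_contDiffOn {u : E4 → ℝ} {m n : WithTop ℕ∞} (hu : ContDiffOn ℝ n u Ω) (hm : m ≤ ∞)
    (hmn : m + 1 + 1 ≤ n) : ContDiffOn ℝ m (localBox G u) Ω := by
  unfold localBox
  exact ContDiffOn.sum fun μ _ => ContDiffOn.sum fun ν _ =>
    ((hG.inv_smooth μ ν).of_le hm).mul (hG.hess_contDiffOn hu hm hmn μ ν)

include hy

lemma isUnit_det : IsUnit (G y).det := isUnit_iff_ne_zero.2 (hG.det_neg y hy).ne

lemma vol_pos : 0 < vol G y := Real.sqrt_pos.2 (by have := hG.det_neg y hy; linarith)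

lemma diff (i j : Fin 4) : DifferentiableAt ℝ (fun y => G y i j) y :=
  ContDiffOn.differentiableAt_of_isOpen hG.isOpen (hG.smooth i j) (by simp) hy

lemma inv_diff (i j : Fin 4) : DifferentiableAt ℝ (fun y => (G y)⁻¹ i j) y :=
  ContDiffOn.differentiableAt_of_isOpen hG.isOpen (hG.inv_smooth i j) (by simp) hy

lemma vol_diff : DifferentiableAt ℝ (vol G) y :=
  ContDiffOn.differentiableAt_of_isOpen hG.isOpen hG.vol_smooth (by simp) hy

lemma christoffel_diff (k i j : Fin 4) : DifferentiableAt ℝ (christoffel G k i j) y :=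
  ContDiffOn.differentiableAt_of_isOpen hG.isOpen (hG.christoffel_smooth k i j) (by simp) hy

lemma transpose_eq : (G y)ᵀ = G y := by
  ext i j; exact hG.symm y hy j i

lemma inv_symm (i j : Fin 4) : (G y)⁻¹ i j = (G y)⁻¹ j i := by
  have : ((G y)⁻¹)ᵀ = (G y)⁻¹ := by rw [Matrix.transpose_nonsing_inv, hG.transpose_eq hy]
  exact congrFun (congrFun this j) i

lemma pd_symm (k i j : Fin 4) : pd k (fun z => G z i j) y = pd k (fun z => G z j i) y :=
  pd_congr (by filter_upwards [hG.isOpen.mem_nhds hy] with z hz using hG.symm z hz i j) k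

lemma christoffel_symm (k i j : Fin 4) : christoffel G k i j y = christoffel G k j i y := by
  simp only [christoffel]
  congr 1
  refine Finset.sum_congr rfl fun l _ => ?_
  rw [hG.pd_symm hy l i j, hG.pd_symm hy i l j, hG.pd_symm hy j i l]
  ring

/-- The Koszul formula for `Γ_{m,ij}`. -/
lemma lower_christoffel (m i j : Fin 4) : ∑ k, G y m k * christoffel G k i j y =
    (1 / 2) * (pd i (fun z => G z m j) y + pd j (fun z => G z m i) y
      - pd m (fun z => G z i j) y) := by
  set w : Fin 4 → ℝ := fun l => pd i (fun z => G z l j) y + pd j (fun z => G z i l) y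
      - pd l (fun z => G z i j) y with hw
  have h1 : (fun k => christoffel G k i j y) = (1 / 2 : ℝ) • ((G y)⁻¹ *ᵥ w) := by
    ext k
    simp only [christoffel, Pi.smul_apply, Matrix.mulVec, dotProduct, smul_eq_mul, hw]
  have h2 : G y *ᵥ (fun k => christoffel G k i j y) = (1 / 2 : ℝ) • w := by
    rw [h1, Matrix.mulVec_smul, Matrix.mulVec_mulVec,
      Matrix.mul_nonsing_inv _ (hG.isUnit_det hy), Matrix.one_mulVec]
  have := congrFun h2 m
  rw [hG.pd_symm hy j m i]
  simpa only [Matrix.mulVec, dotProduct, Pi.smul_apply, smul_eq_mul, hw] using this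

/-- The metric is parallel, in matrix form: `∂_α g = A_αᵀ g + g A_α` with `(A_α)^k_i = Γ^k_{αi}`. -/
lemma matDeriv_metric (α : Fin 4) :
    matDeriv G y (EuclideanSpace.single α 1) =
      (Matrix.of fun k i => christoffel G k α i y)ᵀ * G y +
        G y * Matrix.of fun k i => christoffel G k α i y := by
  ext i j
  have h1 : matDeriv G y (EuclideanSpace.single α 1) i j = pd α (fun z => G z i j) y := rfl
  rw [h1, Matrix.add_apply, Matrix.mul_apply, Matrix.mul_apply]
  simp only [Matrix.transpose_apply, Matrix.of_apply]
  have h2 := hG.lower_christoffel hy i α j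
  have h3 := hG.lower_christoffel hy j α i
  have h4 : ∑ k, christoffel G k α i y * G y k j = ∑ k, G y j k * christoffel G k α i y :=
    Finset.sum_congr rfl fun k _ => by rw [hG.symm y hy k j, mul_comm]
  rw [h4, h2, h3, hG.pd_symm hy α j i, hG.pd_symm hy i j α, hG.pd_symm hy j i α]
  ring

lemma pd_inv (α μ ν : Fin 4) : pd α (fun z => (G z)⁻¹ μ ν) y =
    -∑ l, (christoffel G μ α l y * (G y)⁻¹ l ν + christoffel G ν α l y * (G y)⁻¹ μ l) := by
  have h := matDeriv_inv (hG.diff hy) (hG.det_neg y hy).ne (EuclideanSpace.single α (1 : ℝ))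
  rw [hG.matDeriv_metric hy α, Matrix.mul_add, Matrix.add_mul, Matrix.mul_assoc,
    Matrix.mul_assoc, Matrix.mul_nonsing_inv _ (hG.isUnit_det hy), Matrix.mul_one,
    ← Matrix.mul_assoc (G y)⁻¹, Matrix.nonsing_inv_mul _ (hG.isUnit_det hy), Matrix.one_mul] at h
  have := congrFun (congrFun h μ) ν
  change pd α (fun z => (G z)⁻¹ μ ν) y = _ at this
  rw [this, Matrix.neg_apply, Matrix.add_apply, Matrix.mul_apply, Matrix.mul_apply,
    ← Finset.sum_add_distrib]
  simp only [Matrix.transpose_apply, Matrix.of_apply]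
  congr 1
  exact Finset.sum_congr rfl fun l _ => by ring

/-- `∂_α √(-g) = √(-g) Γ^l_{αl}`. -/
lemma pd_vol (α : Fin 4) : pd α (vol G) y = vol G y * ∑ l, christoffel G l α l y := by
  have h := (fderiv_sqrt_neg_det (hG.diff hy) (hG.det_neg y hy)
    (EuclideanSpace.single α (1 : ℝ))).2
  have ht : ((G y)⁻¹ * matDeriv G y (EuclideanSpace.single α 1)).trace =
      2 * ∑ l, christoffel G l α l y := by
    rw [hG.matDeriv_metric hy α, Matrix.mul_add, Matrix.trace_add, ← Matrix.mul_assoc,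
      Matrix.trace_mul_comm, ← Matrix.mul_assoc, Matrix.mul_nonsing_inv _ (hG.isUnit_det hy),
      ← Matrix.mul_assoc, Matrix.nonsing_inv_mul _ (hG.isUnit_det hy), Matrix.one_mul,
      Matrix.one_mul, Matrix.trace_transpose]
    simp only [Matrix.trace, Matrix.diag, Matrix.of_apply]
    ring
  change pd α (vol G) y = _ at h
  rw [h, ht]
  change _ * vol G y = _
  ring

/-- The contraction `∂_μ (√(-g) g^{μα}) = -√(-g) g^{μν} Γ^α_{μν}`. -/
lemma div_volInv (α : Fin 4) : ∑ μ, pd μ (fun z => vol G z * (G z)⁻¹ μ α) y =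
    -∑ μ, ∑ ν, vol G y * (G y)⁻¹ μ ν * christoffel G α μ ν y := by
  have h1 : ∀ μ, pd μ (fun z => vol G z * (G z)⁻¹ μ α) y =
      vol G y * (∑ l, christoffel G l μ l y) * (G y)⁻¹ μ α
      - vol G y * ∑ l, christoffel G μ μ l y * (G y)⁻¹ l α
      - vol G y * ∑ l, christoffel G α μ l y * (G y)⁻¹ μ l := by
    intro μ
    rw [pd_mul (hG.vol_diff hy) (hG.inv_diff hy μ α), hG.pd_vol hy, hG.pd_inv hy,
      Finset.sum_add_distrib]
    ring
  have h2 : ∑ μ, vol G y * (∑ l, christoffel G l μ l y) * (G y)⁻¹ μ α =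
      ∑ μ, vol G y * ∑ l, christoffel G μ μ l y * (G y)⁻¹ l α := by
    simp only [Finset.mul_sum, Finset.sum_mul]
    rw [Finset.sum_comm]
    refine Finset.sum_congr rfl fun μ _ => Finset.sum_congr rfl fun l _ => ?_
    rw [hG.christoffel_symm hy μ l μ]
    ring
  simp only [h1, Finset.sum_sub_distrib, h2, sub_self, zero_sub]
  congr 1
  refine Finset.sum_congr rfl fun μ _ => ?_
  rw [Finset.mul_sum]
  exact Finset.sum_congr rfl fun l _ => by ring

/-- The d'Alembertian in divergence form: `√(-g) □u = ∂_μ (√(-g) g^{μν} ∂_ν u)`. -/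
lemma vol_mul_localBox {u : E4 → ℝ} (hu : ContDiffAt ℝ 2 u y) :
    vol G y * localBox G u y =
      ∑ μ, pd μ (fun z => ∑ ν, (vol G z * (G z)⁻¹ μ ν) * pd ν u z) y := by
  have hud : ∀ ν, DifferentiableAt ℝ (pd ν u) y := fun ν =>
    (((hu.fderiv_right (m := 1) (by norm_num)).clm_apply contDiffAt_const).differentiableAt
      one_ne_zero)
  have ha : ∀ μ ν, DifferentiableAt ℝ (fun z => vol G z * (G z)⁻¹ μ ν) y := fun μ ν =>
    (hG.vol_diff hy).mul (hG.inv_diff hy μ ν)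
  have h1 : ∀ μ, pd μ (fun z => ∑ ν, (vol G z * (G z)⁻¹ μ ν) * pd ν u z) y =
      ∑ ν, pd μ (fun z => vol G z * (G z)⁻¹ μ ν) y * pd ν u y +
      ∑ ν, (vol G y * (G y)⁻¹ μ ν) * pd μ (pd ν u) y := by
    intro μ
    rw [pd_sum _ fun ν _ => (ha μ ν).fun_mul (hud ν), ← Finset.sum_add_distrib]
    exact Finset.sum_congr rfl fun ν _ => pd_mul (ha μ ν) (hud ν) μ
  simp only [h1, Finset.sum_add_distrib]
  rw [Finset.sum_comm]
  simp only [← Finset.sum_mul, hG.div_volInv hy]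
  simp only [localBox, hess, mul_sub, Finset.sum_sub_distrib, Finset.mul_sum, neg_mul,
    Finset.sum_neg_distrib, Finset.sum_mul]
  rw [neg_add_eq_sub]
  congr 1
  · exact Finset.sum_congr rfl fun μ _ => Finset.sum_congr rfl fun ν _ => by ring
  · have : ∀ f : Fin 4 → Fin 4 → Fin 4 → ℝ,
        ∑ α, ∑ μ, ∑ ν, f α μ ν = ∑ μ, ∑ ν, ∑ α, f α μ ν := by
      intro f
      rw [Finset.sum_comm]
      exact Finset.sum_congr rfl fun μ _ => Finset.sum_comm
    refine Eq.trans ?_ (this _).symm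
    exact Finset.sum_congr rfl fun μ _ => Finset.sum_congr rfl fun ν _ =>
      Finset.sum_congr rfl fun l _ => by ring

end LocalMetric

/-! ### First variations in coordinates -/

/-- `G ε`, `|ε| < r`, is a smooth one-parameter family of metrics of negative determinant on the
open set `Ω`. -/
structure MetricFamily (G : ℝ → E4 → Matrix (Fin 4) (Fin 4) ℝ) (r : ℝ) (Ω : Set E4) : Prop where
  pos : 0 < r
  isOpen : IsOpen Ω
  smooth : ∀ i j, ContDiffOn ℝ ∞ (fun p : ℝ × E4 => G p.1 p.2 i j) (Ioo (-r) r ×ˢ Ω)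
  symm : ∀ ε ∈ Ioo (-r) r, ∀ y ∈ Ω, ∀ i j, G ε y i j = G ε y j i
  det_neg : ∀ ε ∈ Ioo (-r) r, ∀ y ∈ Ω, (G ε y).det < 0

/-- `δΓ^k_{ij}`. -/
def dChristoffel (G : ℝ → E4 → Matrix (Fin 4) (Fin 4) ℝ) (k i j : Fin 4) (y : E4) : ℝ :=
  deriv (fun ε => christoffel (G ε) k i j y) 0

/-- `δg^{μν}`. -/
def dInv (G : ℝ → E4 → Matrix (Fin 4) (Fin 4) ℝ) (μ ν : Fin 4) (y : E4) : ℝ :=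
  deriv (fun ε => (G ε y)⁻¹ μ ν) 0

/-- `δ√(-g)`. -/
def dVol (G : ℝ → E4 → Matrix (Fin 4) (Fin 4) ℝ) (y : E4) : ℝ :=
  deriv (fun ε => vol (G ε) y) 0

/-- `√(-g) g^{μν}`. -/
def volInv (G : E4 → Matrix (Fin 4) (Fin 4) ℝ) (μ ν : Fin 4) (y : E4) : ℝ :=
  vol G y * (G y)⁻¹ μ ν

/-- `δ(√(-g) g^{μν})`. -/
def dVolInv (G : ℝ → E4 → Matrix (Fin 4) (Fin 4) ℝ) (μ ν : Fin 4) (y : E4) : ℝ :=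
  deriv (fun ε => volInv (G ε) μ ν y) 0

/-- `δ√(-g) / √(-g) = -½ g_{μν} δg^{μν}`. -/
def dLogVol (G : ℝ → E4 → Matrix (Fin 4) (Fin 4) ℝ) (y : E4) : ℝ :=
  -(1 / 2) * ∑ μ, ∑ ν, G 0 y μ ν * dInv G μ ν y

/-- `δR_{μν}`, expressed in terms of `δΓ`. -/
def dRicci (G : ℝ → E4 → Matrix (Fin 4) (Fin 4) ℝ) (μ ν : Fin 4) (y : E4) : ℝ :=
  ∑ α, (pd α (dChristoffel G α μ ν) y - pd ν (dChristoffel G α μ α) y +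
    ∑ l, (dChristoffel G l μ ν y * christoffel (G 0) α α l y
      + christoffel (G 0) l μ ν y * dChristoffel G α α l y
      - (dChristoffel G l μ α y * christoffel (G 0) α ν l y
      + christoffel (G 0) l μ α y * dChristoffel G α ν l y)))

/-- The vector density `√(-g) (g^{μν} δΓ^α_{μν} - g^{μα} δΓ^l_{μl})`, whose divergence is
`√(-g) g^{μν} δR_{μν}`. -/
def palatiniFlux (G : ℝ → E4 → Matrix (Fin 4) (Fin 4) ℝ) (α : Fin 4) (y : E4) : ℝ :=
  (∑ μ, ∑ ν, volInv (G 0) μ ν y * dChristoffel G α μ ν y)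
    - ∑ μ, volInv (G 0) μ α y * ∑ l, dChristoffel G l μ l y

/-- The vector density by whose divergence `u δR √(-g)` and
`(R_{μν} u - K_{μν} u) δg^{μν} √(-g)` differ. -/
def scalarFlux (G : ℝ → E4 → Matrix (Fin 4) (Fin 4) ℝ) (u : E4 → ℝ) (α : Fin 4) (y : E4) : ℝ :=
  u y * palatiniFlux G α y + ∑ μ, dVolInv G α μ y * pd μ u y
    + dLogVol G y * ∑ ν, volInv (G 0) α ν y * pd ν u y

/-- The vector density by whose divergence `A δ(□v) √(-g)` and
`(½ S_{μν}(A, v) δg^{μν} + □A δv) √(-g)` differ. -/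
def boxFlux (G : ℝ → E4 → Matrix (Fin 4) (Fin 4) ℝ) (v : ℝ → E4 → ℝ) (A : E4 → ℝ)
    (μ : Fin 4) (y : E4) : ℝ :=
  A y * (∑ ν, (dVolInv G μ ν y * pd ν (v 0) y
      + volInv (G 0) μ ν y * pd ν (fun z => deriv (fun ε => v ε z) 0) y))
    - deriv (fun ε => v ε y) 0 * ∑ ν, volInv (G 0) μ ν y * pd ν A y

lemma sum_swap_four (f : Fin 4 → Fin 4 → Fin 4 → Fin 4 → ℝ) :
    ∑ a, ∑ b, ∑ c, ∑ d, f a b c d = ∑ d, ∑ c, ∑ a, ∑ b, f a b c d := by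
  have h1 : ∀ a, ∑ b, ∑ c, ∑ d, f a b c d = ∑ d, ∑ c, ∑ b, f a b c d := by
    intro a
    rw [Finset.sum_comm]
    simp only [Finset.sum_comm (s := Finset.univ (α := Fin 4)) (f := fun b d => f a b _ d)]
    exact Finset.sum_comm
  simp only [h1]
  rw [Finset.sum_comm]
  exact Finset.sum_congr rfl fun d _ => Finset.sum_comm

namespace MetricFamily

variable {G : ℝ → E4 → Matrix (Fin 4) (Fin 4) ℝ} {r : ℝ} {Ω : Set E4} (hG : MetricFamily G r Ω)
  {y : E4} (hy : y ∈ Ω)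

include hG

lemma zero_mem : (0 : ℝ) ∈ Ioo (-r) r := ⟨by linarith [hG.pos], hG.pos⟩

lemma isOpen_prod : IsOpen (Ioo (-r) r ×ˢ Ω) := isOpen_Ioo.prod hG.isOpen

lemma localMetric {ε : ℝ} (hε : ε ∈ Ioo (-r) r) : LocalMetric (G ε) Ω where
  isOpen := hG.isOpen
  smooth i j := contDiffOn_slice (hG.smooth i j) hε
  symm := hG.symm ε hε
  det_neg := hG.det_neg ε hε

lemma inv_smooth (μ ν : Fin 4) :
    ContDiffOn ℝ ∞ (fun p : ℝ × E4 => (G p.1 p.2)⁻¹ μ ν) (Ioo (-r) r ×ˢ Ω) :=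
  contDiffOn_inv hG.smooth (fun p hp => (hG.det_neg p.1 hp.1 p.2 hp.2).ne) μ ν

lemma vol_smooth : ContDiffOn ℝ ∞ (fun p : ℝ × E4 => vol (G p.1) p.2) (Ioo (-r) r ×ˢ Ω) :=
  (contDiffOn_det hG.smooth).neg.sqrt fun p hp => by
    have := hG.det_neg p.1 hp.1 p.2 hp.2; simp; exact this.ne

lemma volInv_smooth (μ ν : Fin 4) :
    ContDiffOn ℝ ∞ (fun p : ℝ × E4 => volInv (G p.1) μ ν p.2) (Ioo (-r) r ×ˢ Ω) :=
  hG.vol_smooth.mul (hG.inv_smooth μ ν)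

lemma christoffel_smooth (k i j : Fin 4) :
    ContDiffOn ℝ ∞ (fun p : ℝ × E4 => christoffel (G p.1) k i j p.2) (Ioo (-r) r ×ˢ Ω) := by
  have h : ∀ k i j, ContDiffOn ℝ ∞ (fun p : ℝ × E4 => pd k (fun z => G p.1 z i j) p.2)
      (Ioo (-r) r ×ˢ Ω) := fun k i j => contDiffOn_family_pd hG.isOpen_prod (hG.smooth i j) k
  unfold christoffel
  exact contDiffOn_const.mul (ContDiffOn.sum fun l _ => (hG.inv_smooth k l).mul
    (((h _ _ _).add (h _ _ _)).sub (h _ _ _)))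

lemma pd_christoffel_smooth (β k i j : Fin 4) :
    ContDiffOn ℝ ∞ (fun p : ℝ × E4 => pd β (christoffel (G p.1) k i j) p.2) (Ioo (-r) r ×ˢ Ω) :=
  contDiffOn_family_pd hG.isOpen_prod (hG.christoffel_smooth k i j) β

lemma ricci_smooth (μ ν : Fin 4) :
    ContDiffOn ℝ ∞ (fun p : ℝ × E4 => ricci (G p.1) μ ν p.2) (Ioo (-r) r ×ˢ Ω) := by
  unfold ricci riemann
  exact ContDiffOn.sum fun α _ => ((hG.pd_christoffel_smooth _ _ _ _).sub
    (hG.pd_christoffel_smooth _ _ _ _)).add (ContDiffOn.sum fun l _ =>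
    ((hG.christoffel_smooth _ _ _).mul (hG.christoffel_smooth _ _ _)).sub
    ((hG.christoffel_smooth _ _ _).mul (hG.christoffel_smooth _ _ _)))

lemma localScalar_smooth :
    ContDiffOn ℝ ∞ (fun p : ℝ × E4 => localScalar (G p.1) p.2) (Ioo (-r) r ×ˢ Ω) := by
  unfold localScalar
  exact ContDiffOn.sum fun μ _ => ContDiffOn.sum fun ν _ =>
    (hG.inv_smooth μ ν).mul (hG.ricci_smooth μ ν)

lemma localBox_smooth {v : ℝ → E4 → ℝ}
    (hv : ContDiffOn ℝ ∞ (fun p : ℝ × E4 => v p.1 p.2) (Ioo (-r) r ×ˢ Ω)) :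
    ContDiffOn ℝ ∞ (fun p : ℝ × E4 => localBox (G p.1) (v p.1) p.2) (Ioo (-r) r ×ˢ Ω) := by
  have h1 : ∀ ν, ContDiffOn ℝ ∞ (fun p : ℝ × E4 => pd ν (v p.1) p.2) (Ioo (-r) r ×ˢ Ω) :=
    fun ν => contDiffOn_family_pd hG.isOpen_prod hv ν
  have h2 : ∀ μ ν, ContDiffOn ℝ ∞ (fun p : ℝ × E4 => pd μ (pd ν (v p.1)) p.2)
      (Ioo (-r) r ×ˢ Ω) := fun μ ν => contDiffOn_family_pd hG.isOpen_prod (h1 ν) μ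
  unfold localBox hess
  exact ContDiffOn.sum fun μ _ => ContDiffOn.sum fun ν _ =>
    (hG.inv_smooth μ ν).mul ((h2 μ ν).sub
      (ContDiffOn.sum fun l _ => (hG.christoffel_smooth l μ ν).mul (h1 l)))

/-- The first variation of a smooth family is smooth. -/
lemma variation_smooth {F : ℝ × E4 → ℝ} (hF : ContDiffOn ℝ ∞ F (Ioo (-r) r ×ˢ Ω)) :
    ContDiffOn ℝ ∞ (fun z => deriv (fun ε => F (ε, z)) 0) Ω :=
  contDiffOn_slice (F := fun p => deriv (fun ε => F (ε, p.2)) p.1)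
    (contDiffOn_family_deriv hG.isOpen_prod hF) hG.zero_mem

lemma dChristoffel_smooth (k i j : Fin 4) : ContDiffOn ℝ ∞ (dChristoffel G k i j) Ω :=
  hG.variation_smooth (hG.christoffel_smooth k i j)

lemma dInv_smooth (μ ν : Fin 4) : ContDiffOn ℝ ∞ (dInv G μ ν) Ω :=
  hG.variation_smooth (hG.inv_smooth μ ν)

lemma dVol_smooth : ContDiffOn ℝ ∞ (dVol G) Ω := hG.variation_smooth hG.vol_smooth

lemma dVolInv_smooth (μ ν : Fin 4) : ContDiffOn ℝ ∞ (dVolInv G μ ν) Ω :=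
  hG.variation_smooth (hG.volInv_smooth μ ν)

lemma volInv_zero_smooth (μ ν : Fin 4) : ContDiffOn ℝ ∞ (volInv (G 0) μ ν) Ω :=
  contDiffOn_slice (hG.volInv_smooth μ ν) hG.zero_mem

lemma dLogVol_smooth : ContDiffOn ℝ ∞ (dLogVol G) Ω := by
  unfold dLogVol
  exact contDiffOn_const.mul (ContDiffOn.sum fun μ _ => ContDiffOn.sum fun ν _ =>
    (contDiffOn_slice (hG.smooth μ ν) hG.zero_mem).mul (hG.dInv_smooth μ ν))

lemma palatiniFlux_smooth (α : Fin 4) : ContDiffOn ℝ ∞ (palatiniFlux G α) Ω := by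
  unfold palatiniFlux
  exact (ContDiffOn.sum fun μ _ => ContDiffOn.sum fun ν _ =>
    (hG.volInv_zero_smooth μ ν).mul (hG.dChristoffel_smooth _ _ _)).sub
    (ContDiffOn.sum fun μ _ => (hG.volInv_zero_smooth μ α).mul
      (ContDiffOn.sum fun l _ => hG.dChristoffel_smooth _ _ _))

lemma scalarFlux_contDiffOn {u : E4 → ℝ} (hu : ContDiffOn ℝ 2 u Ω) (α : Fin 4) :
    ContDiffOn ℝ 1 (scalarFlux G u α) Ω := by
  have h1 : (1 : WithTop ℕ∞) ≤ ∞ := le_trans (by norm_num) two_le_infty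
  have hpd : ∀ i, ContDiffOn ℝ 1 (pd i u) Ω := contDiffOn_pd hG.isOpen hu (by norm_num)
  unfold scalarFlux
  exact (((hu.of_le (by norm_num)).mul ((hG.palatiniFlux_smooth α).of_le h1)).add
    (ContDiffOn.sum fun μ _ => ((hG.dVolInv_smooth α μ).of_le h1).mul (hpd μ))).add
    ((hG.dLogVol_smooth.of_le h1).mul (ContDiffOn.sum fun ν _ =>
      ((hG.volInv_zero_smooth α ν).of_le h1).mul (hpd ν)))

lemma boxFlux_contDiffOn {v : ℝ → E4 → ℝ} {A : E4 → ℝ}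
    (hv : ContDiffOn ℝ ∞ (fun p : ℝ × E4 => v p.1 p.2) (Ioo (-r) r ×ˢ Ω))
    (hA : ContDiffOn ℝ 2 A Ω) (μ : Fin 4) : ContDiffOn ℝ 1 (boxFlux G v A μ) Ω := by
  have h1 : (1 : WithTop ℕ∞) ≤ ∞ := le_trans (by norm_num) two_le_infty
  have hpd : ∀ i, ContDiffOn ℝ 1 (pd i A) Ω := contDiffOn_pd hG.isOpen hA (by norm_num)
  have hv0 : ContDiffOn ℝ ∞ (v 0) Ω := contDiffOn_slice hv hG.zero_mem
  have hw := hG.variation_smooth hv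
  unfold boxFlux
  refine ((hA.of_le (by norm_num)).mul (ContDiffOn.sum fun ν _ => ContDiffOn.of_le (ContDiffOn.add
    ((hG.dVolInv_smooth μ ν).mul (contDiffOn_pd hG.isOpen hv0 le_rfl ν))
    ((hG.volInv_zero_smooth μ ν).mul (contDiffOn_pd hG.isOpen hw le_rfl ν))) h1)).sub
    ((hw.of_le h1).mul (ContDiffOn.sum fun ν _ =>
      ((hG.volInv_zero_smooth μ ν).of_le h1).mul (hpd ν)))

include hy

lemma mem_prod : ((0 : ℝ), y) ∈ Ioo (-r) r ×ˢ Ω := ⟨hG.zero_mem, hy⟩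

lemma hasDerivAt_variation {F : ℝ × E4 → ℝ} (hF : ContDiffOn ℝ ∞ F (Ioo (-r) r ×ˢ Ω)) :
    HasDerivAt (fun ε => F (ε, y)) (deriv (fun ε => F (ε, y)) 0) 0 :=
  (deriv_slice (p := (0, y)) (ContDiffOn.differentiableAt_of_isOpen hG.isOpen_prod hF (by simp)
    (hG.mem_prod hy))).differentiableAt.hasDerivAt

lemma hasDerivAt_pd_variation {F : ℝ × E4 → ℝ} (hF : ContDiffOn ℝ ∞ F (Ioo (-r) r ×ˢ Ω))
    (i : Fin 4) : HasDerivAt (fun ε => pd i (fun z => F (ε, z)) y)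
      (pd i (fun z => deriv (fun ε => F (ε, z)) 0) y) 0 :=
  deriv_pd_comm hG.isOpen_prod hF i (hG.mem_prod hy)

lemma hasDerivAt_inv (μ ν : Fin 4) :
    HasDerivAt (fun ε => (G ε y)⁻¹ μ ν) (dInv G μ ν y) 0 :=
  hG.hasDerivAt_variation hy (hG.inv_smooth μ ν)

lemma hasDerivAt_vol : HasDerivAt (fun ε => vol (G ε) y) (dVol G y) 0 :=
  hG.hasDerivAt_variation hy hG.vol_smooth

lemma hasDerivAt_christoffel (k i j : Fin 4) :
    HasDerivAt (fun ε => christoffel (G ε) k i j y) (dChristoffel G k i j y) 0 :=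
  hG.hasDerivAt_variation hy (hG.christoffel_smooth k i j)

lemma hasDerivAt_volInv (μ ν : Fin 4) :
    HasDerivAt (fun ε => volInv (G ε) μ ν y) (dVolInv G μ ν y) 0 :=
  hG.hasDerivAt_variation hy (hG.volInv_smooth μ ν)

omit hy in
lemma eventually_localMetric : ∀ᶠ ε in 𝓝 (0 : ℝ), LocalMetric (G ε) Ω := by
  filter_upwards [isOpen_Ioo.mem_nhds hG.zero_mem] with ε hε using hG.localMetric hε

lemma dChristoffel_symm (k i j : Fin 4) : dChristoffel G k i j y = dChristoffel G k j i y := by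
  refine Filter.EventuallyEq.deriv_eq ?_
  filter_upwards [hG.eventually_localMetric] with ε hε using hε.christoffel_symm hy k i j

/-- `δ√(-g) = -½ √(-g) g_{μν} δg^{μν}`. -/
lemma dVol_eq : dVol G y = dLogVol G y * vol (G 0) y := by
  have hd : ∀ i j, DifferentiableAt ℝ (fun ε => G ε y i j) 0 := fun i j =>
    (hG.hasDerivAt_variation hy (hG.smooth i j)).differentiableAt
  have h0 := hG.localMetric hG.zero_mem
  have hu := h0.isUnit_det hy
  have hv : dVol G y = (1 / 2) * ((G 0 y)⁻¹ * matDeriv (fun ε => G ε y) 0 1).trace * vol (G 0) y :=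
    (fderiv_sqrt_neg_det hd (h0.det_neg y hy) 1).2
  have hk := matDeriv_inv hd (h0.det_neg y hy).ne 1
  have ht : ∑ μ, ∑ ν, G 0 y μ ν * dInv G μ ν y =
      (G 0 y * matDeriv (fun ε => (G ε y)⁻¹) 0 1).trace := by
    simp only [Matrix.trace, Matrix.diag, Matrix.mul_apply]
    rw [Finset.sum_comm]
    exact Finset.sum_congr rfl fun ν _ => Finset.sum_congr rfl fun μ _ => by
      rw [h0.symm y hy μ ν]; rfl
  rw [hv, dLogVol, ht, hk, Matrix.mul_neg, Matrix.trace_neg, ← Matrix.mul_assoc,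
    ← Matrix.mul_assoc, Matrix.mul_nonsing_inv _ hu, Matrix.one_mul, Matrix.trace_mul_comm]
  ring

/-- `δ(√(-g) g^{μν}) = √(-g) (δg^{μν} - ½ g_{αβ} δg^{αβ} g^{μν})`. -/
lemma dVolInv_eq (μ ν : Fin 4) : dVolInv G μ ν y =
    vol (G 0) y * (dLogVol G y * (G 0 y)⁻¹ μ ν + dInv G μ ν y) := by
  rw [((hG.hasDerivAt_volInv hy μ ν)).unique ((hG.hasDerivAt_vol hy).mul (hG.hasDerivAt_inv hy μ ν)),
    hG.dVol_eq hy]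
  ring

lemma volInv_zero_symm (μ ν : Fin 4) : volInv (G 0) μ ν y = volInv (G 0) ν μ y := by
  simp only [volInv, (hG.localMetric hG.zero_mem).inv_symm hy μ ν]

/-- `δΓ^l_{αl} = ∂_α (δ√(-g) / √(-g))`. -/
lemma sum_dChristoffel (α : Fin 4) : ∑ l, dChristoffel G l α l y = pd α (dLogVol G) y := by
  have h0 := hG.localMetric hG.zero_mem
  have h1 : HasDerivAt (fun ε => pd α (vol (G ε)) y) (pd α (dVol G) y) 0 :=
    hG.hasDerivAt_pd_variation hy hG.vol_smooth α
  have h2 : HasDerivAt (fun ε => vol (G ε) y * ∑ l, christoffel (G ε) l α l y)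
      (dVol G y * ∑ l, christoffel (G 0) l α l y + vol (G 0) y * ∑ l, dChristoffel G l α l y) 0 :=
    (hG.hasDerivAt_vol hy).mul (HasDerivAt.fun_sum fun l _ => hG.hasDerivAt_christoffel hy l α l)
  have h3 : (fun ε => pd α (vol (G ε)) y) =ᶠ[𝓝 0]
      fun ε => vol (G ε) y * ∑ l, christoffel (G ε) l α l y := by
    filter_upwards [hG.eventually_localMetric] with ε hε using hε.pd_vol hy α
  have h4 := h1.unique (h2.congr_of_eventuallyEq h3)
  have h5 : pd α (dVol G) y = pd α (dLogVol G) y * vol (G 0) y +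
      dLogVol G y * (vol (G 0) y * ∑ l, christoffel (G 0) l α l y) := by
    rw [← h0.pd_vol hy, ← pd_mul (ContDiffOn.differentiableAt_of_isOpen hG.isOpen hG.dLogVol_smooth
      (by simp) hy) (h0.vol_diff hy)]
    refine pd_congr ?_ α
    filter_upwards [hG.isOpen.mem_nhds hy] with z hz using hG.dVol_eq hz
  rw [h5, hG.dVol_eq hy] at h4
  have hs := (h0.vol_pos hy).ne'
  apply mul_left_cancel₀ hs
  linarith

/-- The variation of `∂_μ (√(-g) g^{μα}) = -√(-g) g^{μν} Γ^α_{μν}`. -/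
lemma div_dVolInv (α : Fin 4) : ∑ μ, pd μ (dVolInv G μ α) y =
    -∑ μ, ∑ ν, (dVolInv G μ ν y * christoffel (G 0) α μ ν y
      + volInv (G 0) μ ν y * dChristoffel G α μ ν y) := by
  have h1 : HasDerivAt (fun ε => ∑ μ, pd μ (volInv (G ε) μ α) y)
      (∑ μ, pd μ (dVolInv G μ α) y) 0 :=
    HasDerivAt.fun_sum fun μ _ => hG.hasDerivAt_pd_variation hy (hG.volInv_smooth μ α) μ
  have h2 : HasDerivAt (fun ε => -∑ μ, ∑ ν, volInv (G ε) μ ν y * christoffel (G ε) α μ ν y)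
      (-∑ μ, ∑ ν, (dVolInv G μ ν y * christoffel (G 0) α μ ν y
      + volInv (G 0) μ ν y * dChristoffel G α μ ν y)) 0 :=
    (HasDerivAt.fun_sum fun μ _ => HasDerivAt.fun_sum fun ν _ =>
      (hG.hasDerivAt_volInv hy μ ν).mul (hG.hasDerivAt_christoffel hy α μ ν)).fun_neg
  refine h1.unique (h2.congr_of_eventuallyEq ?_)
  filter_upwards [hG.eventually_localMetric] with ε hε using hε.div_volInv hy α

/-- `δR = R_{μν} δg^{μν} + g^{μν} δR_{μν}`. -/
lemma hasDerivAt_localScalar : HasDerivAt (fun ε => localScalar (G ε) y)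
    (∑ μ, ∑ ν, (dInv G μ ν y * ricci (G 0) μ ν y + (G 0 y)⁻¹ μ ν * dRicci G μ ν y)) 0 := by
  have hpd : ∀ β k i j, HasDerivAt (fun ε => pd β (christoffel (G ε) k i j) y)
      (pd β (dChristoffel G k i j) y) 0 := fun β k i j =>
    hG.hasDerivAt_pd_variation hy (hG.christoffel_smooth k i j) β
  have hc := hG.hasDerivAt_christoffel hy
  have hric : ∀ μ ν, HasDerivAt (fun ε => ricci (G ε) μ ν y) (dRicci G μ ν y) 0 := by
    intro μ ν
    unfold ricci riemann dRicci
    exact HasDerivAt.fun_sum fun α _ => ((hpd _ _ _ _).sub (hpd _ _ _ _)).add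
      (HasDerivAt.fun_sum fun l _ => ((hc _ _ _).mul (hc _ _ _)).sub ((hc _ _ _).mul (hc _ _ _)))
  unfold localScalar
  exact HasDerivAt.fun_sum fun μ _ => HasDerivAt.fun_sum fun ν _ =>
    (hG.hasDerivAt_inv hy μ ν).mul (hric μ ν)

end MetricFamily

/-! ### The variation of the curvature and of the d'Alembertian up to a divergence -/

namespace MetricFamily

variable {G : ℝ → E4 → Matrix (Fin 4) (Fin 4) ℝ} {r : ℝ} {Ω : Set E4} (hG : MetricFamily G r Ω)
  {y : E4} (hy : y ∈ Ω)

include hG hy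

lemma volInv_diff (μ ν : Fin 4) : DifferentiableAt ℝ (volInv (G 0) μ ν) y :=
  ContDiffOn.differentiableAt_of_isOpen hG.isOpen (hG.volInv_zero_smooth μ ν) (by simp) hy

lemma dChristoffel_diff (k i j : Fin 4) : DifferentiableAt ℝ (dChristoffel G k i j) y :=
  ContDiffOn.differentiableAt_of_isOpen hG.isOpen (hG.dChristoffel_smooth k i j) (by simp) hy

lemma pd_volInv (α μ ν : Fin 4) : pd α (volInv (G 0) μ ν) y = vol (G 0) y *
    ((∑ l, christoffel (G 0) l α l y) * (G 0 y)⁻¹ μ ν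
      - ∑ l, christoffel (G 0) μ α l y * (G 0 y)⁻¹ l ν
      - ∑ l, christoffel (G 0) ν α l y * (G 0 y)⁻¹ μ l) := by
  have h0 := hG.localMetric hG.zero_mem
  change pd α (fun z => vol (G 0) z * (G 0 z)⁻¹ μ ν) y = _
  rw [pd_mul (h0.vol_diff hy) (h0.inv_diff hy μ ν), h0.pd_vol hy, h0.pd_inv hy,
    Finset.sum_add_distrib]
  ring

/-- The Palatini identity: `√(-g) g^{μν} δR_{μν}` is a divergence. -/
lemma div_palatiniFlux : ∑ α, pd α (palatiniFlux G α) y =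
    vol (G 0) y * ∑ μ, ∑ ν, (G 0 y)⁻¹ μ ν * dRicci G μ ν y := by
  have h0 := hG.localMetric hG.zero_mem
  have hsym := h0.christoffel_symm hy
  have hCsym := hG.dChristoffel_symm hy
  have hdiv : ∀ μ, ∑ α, pd α (volInv (G 0) μ α) y =
      -∑ α, ∑ β, vol (G 0) y * (G 0 y)⁻¹ α β * christoffel (G 0) μ α β y := by
    intro μ
    rw [← h0.div_volInv hy μ]
    refine Finset.sum_congr rfl fun α _ => pd_congr ?_ α
    filter_upwards [hG.isOpen.mem_nhds hy] with z hz using hG.volInv_zero_symm hz μ α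
  have hexp : ∀ α, pd α (palatiniFlux G α) y =
      (∑ μ, ∑ ν, (pd α (volInv (G 0) μ ν) y * dChristoffel G α μ ν y
        + volInv (G 0) μ ν y * pd α (dChristoffel G α μ ν) y))
      - ∑ μ, (pd α (volInv (G 0) μ α) y * ∑ l, dChristoffel G l μ l y
        + volInv (G 0) μ α y * ∑ l, pd α (dChristoffel G l μ l) y) := by
    intro α
    have ha := hG.volInv_diff hy
    have hC := hG.dChristoffel_diff hy
    have hCs : ∀ μ, DifferentiableAt ℝ (fun z => ∑ l, dChristoffel G l μ l z) y := fun μ =>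
      DifferentiableAt.fun_sum fun l _ => hC l μ l
    unfold palatiniFlux
    rw [pd_sub (DifferentiableAt.fun_sum fun μ _ => DifferentiableAt.fun_sum fun ν _ =>
      (ha μ ν).fun_mul (hC α μ ν)) (DifferentiableAt.fun_sum fun μ _ => (ha μ α).fun_mul (hCs μ)),
      pd_sum _ (fun μ _ => DifferentiableAt.fun_sum fun ν _ => (ha μ ν).fun_mul (hC α μ ν)),
      pd_sum _ (fun μ _ => (ha μ α).fun_mul (hCs μ))]
    congr 1
    · refine Finset.sum_congr rfl fun μ _ => ?_
      rw [pd_sum _ (fun ν _ => (ha μ ν).fun_mul (hC α μ ν))]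
      exact Finset.sum_congr rfl fun ν _ => pd_mul (ha μ ν) (hC α μ ν) α
    · refine Finset.sum_congr rfl fun μ _ => ?_
      rw [pd_mul (ha μ α) (hCs μ), pd_sum _ (fun l _ => hC l μ l)]
  -- the terms with derivatives of `δΓ`
  have e1 : ∑ α, ∑ μ, ∑ ν, volInv (G 0) μ ν y * pd α (dChristoffel G α μ ν) y =
      ∑ μ, ∑ ν, volInv (G 0) μ ν y * ∑ α, pd α (dChristoffel G α μ ν) y := by
    rw [Finset.sum_comm]
    refine Finset.sum_congr rfl fun μ _ => ?_
    rw [Finset.sum_comm]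
    exact Finset.sum_congr rfl fun ν _ => (Finset.mul_sum _ _ _).symm
  have e2 : ∑ α, ∑ μ, volInv (G 0) μ α y * ∑ l, pd α (dChristoffel G l μ l) y =
      ∑ μ, ∑ ν, volInv (G 0) μ ν y * ∑ α, pd ν (dChristoffel G α μ α) y := Finset.sum_comm
  -- the terms with `Γ^l_{αl}` and with `g^{αβ} Γ^μ_{αβ}`
  have e3 : ∑ α, ∑ μ, ∑ ν, vol (G 0) y * ((∑ l, christoffel (G 0) l α l y) * (G 0 y)⁻¹ μ ν)
        * dChristoffel G α μ ν y =
      ∑ μ, ∑ ν, volInv (G 0) μ ν y * ∑ α, ∑ l,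
        dChristoffel G l μ ν y * christoffel (G 0) α α l y := by
    rw [Finset.sum_comm]
    refine Finset.sum_congr rfl fun μ _ => ?_
    rw [Finset.sum_comm]
    refine Finset.sum_congr rfl fun ν _ => ?_
    rw [Finset.sum_comm (s := Finset.univ (α := Fin 4)), Finset.mul_sum]
    refine Finset.sum_congr rfl fun α _ => ?_
    simp only [Finset.mul_sum, Finset.sum_mul]
    refine Finset.sum_congr rfl fun l _ => ?_
    rw [hsym l l α, volInv]
    ring
  have e4 : ∑ α, ∑ μ, pd α (volInv (G 0) μ α) y * ∑ l, dChristoffel G l μ l y =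
      -∑ μ, ∑ ν, volInv (G 0) μ ν y * ∑ α, ∑ l,
        christoffel (G 0) l μ ν y * dChristoffel G α α l y := by
    rw [Finset.sum_comm]
    simp only [← Finset.sum_mul, hdiv]
    simp only [neg_mul, Finset.sum_neg_distrib]
    congr 1
    simp only [Finset.sum_mul]
    rw [Finset.sum_comm]
    refine Finset.sum_congr rfl fun μ _ => ?_
    rw [Finset.sum_comm]
    refine Finset.sum_congr rfl fun ν _ => ?_
    rw [Finset.sum_comm (s := Finset.univ (α := Fin 4)), Finset.mul_sum]
    simp only [Finset.mul_sum]
    refine Finset.sum_congr rfl fun α _ => Finset.sum_congr rfl fun l _ => ?_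
    rw [hCsym l α l, volInv]
    ring
  -- the terms with two contractions of `Γ` with `δΓ`
  have e5 : ∑ α, ∑ μ, ∑ ν, vol (G 0) y * (∑ l, christoffel (G 0) μ α l y * (G 0 y)⁻¹ l ν)
        * dChristoffel G α μ ν y =
      ∑ μ, ∑ ν, volInv (G 0) μ ν y * ∑ α, ∑ l,
        christoffel (G 0) l μ α y * dChristoffel G α ν l y := by
    simp only [Finset.mul_sum, Finset.sum_mul]
    refine (sum_swap_four _).trans ?_
    refine Finset.sum_congr rfl fun μ _ => Finset.sum_congr rfl fun ν _ =>
      Finset.sum_congr rfl fun α _ => Finset.sum_congr rfl fun l _ => ?_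
    rw [hsym l μ α, hCsym α ν l, volInv]
    ring
  have e6 : ∑ α, ∑ μ, ∑ ν, vol (G 0) y * (∑ l, christoffel (G 0) ν α l y * (G 0 y)⁻¹ μ l)
        * dChristoffel G α μ ν y =
      ∑ μ, ∑ ν, volInv (G 0) μ ν y * ∑ α, ∑ l,
        dChristoffel G l μ α y * christoffel (G 0) α ν l y := by
    simp only [Finset.mul_sum, Finset.sum_mul]
    have h1 : ∀ f : Fin 4 → Fin 4 → Fin 4 → Fin 4 → ℝ,
        ∑ a, ∑ b, ∑ c, ∑ d, f a b c d = ∑ b, ∑ d, ∑ c, ∑ a, f a b c d := by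
      intro f
      rw [Finset.sum_comm]
      refine Finset.sum_congr rfl fun b _ => ?_
      rw [Finset.sum_congr rfl fun a _ => Finset.sum_comm, Finset.sum_comm]
      exact Finset.sum_congr rfl fun d _ => Finset.sum_comm
    refine (h1 _).trans ?_
    refine Finset.sum_congr rfl fun μ _ => Finset.sum_congr rfl fun ν _ =>
      Finset.sum_congr rfl fun α _ => Finset.sum_congr rfl fun l _ => ?_
    rw [hsym α ν l, volInv]
    ring
  have hL : ∑ α, pd α (palatiniFlux G α) y =
      (∑ α, ∑ μ, ∑ ν, vol (G 0) y * ((∑ l, christoffel (G 0) l α l y) * (G 0 y)⁻¹ μ ν)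
        * dChristoffel G α μ ν y)
      - (∑ α, ∑ μ, ∑ ν, vol (G 0) y * (∑ l, christoffel (G 0) μ α l y * (G 0 y)⁻¹ l ν)
        * dChristoffel G α μ ν y)
      - (∑ α, ∑ μ, ∑ ν, vol (G 0) y * (∑ l, christoffel (G 0) ν α l y * (G 0 y)⁻¹ μ l)
        * dChristoffel G α μ ν y)
      + (∑ α, ∑ μ, ∑ ν, volInv (G 0) μ ν y * pd α (dChristoffel G α μ ν) y)
      - (∑ α, ∑ μ, pd α (volInv (G 0) μ α) y * ∑ l, dChristoffel G l μ l y)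
      - ∑ α, ∑ μ, volInv (G 0) μ α y * ∑ l, pd α (dChristoffel G l μ l) y := by
    rw [Finset.sum_congr rfl fun α _ => hexp α]
    simp only [Finset.sum_sub_distrib, Finset.sum_add_distrib]
    have : ∑ α, ∑ μ, ∑ ν, pd α (volInv (G 0) μ ν) y * dChristoffel G α μ ν y =
      (∑ α, ∑ μ, ∑ ν, vol (G 0) y * ((∑ l, christoffel (G 0) l α l y) * (G 0 y)⁻¹ μ ν)
        * dChristoffel G α μ ν y)
      - (∑ α, ∑ μ, ∑ ν, vol (G 0) y * (∑ l, christoffel (G 0) μ α l y * (G 0 y)⁻¹ l ν)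
        * dChristoffel G α μ ν y)
      - (∑ α, ∑ μ, ∑ ν, vol (G 0) y * (∑ l, christoffel (G 0) ν α l y * (G 0 y)⁻¹ μ l)
        * dChristoffel G α μ ν y) := by
      simp only [← Finset.sum_sub_distrib]
      refine Finset.sum_congr rfl fun α _ => Finset.sum_congr rfl fun μ _ =>
        Finset.sum_congr rfl fun ν _ => ?_
      rw [hG.pd_volInv hy]
      ring
    rw [this]
    ring
  have hR : vol (G 0) y * ∑ μ, ∑ ν, (G 0 y)⁻¹ μ ν * dRicci G μ ν y =
      (∑ μ, ∑ ν, volInv (G 0) μ ν y * ∑ α, pd α (dChristoffel G α μ ν) y)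
      - (∑ μ, ∑ ν, volInv (G 0) μ ν y * ∑ α, pd ν (dChristoffel G α μ α) y)
      + (∑ μ, ∑ ν, volInv (G 0) μ ν y * ∑ α, ∑ l,
        dChristoffel G l μ ν y * christoffel (G 0) α α l y)
      + (∑ μ, ∑ ν, volInv (G 0) μ ν y * ∑ α, ∑ l,
        christoffel (G 0) l μ ν y * dChristoffel G α α l y)
      - (∑ μ, ∑ ν, volInv (G 0) μ ν y * ∑ α, ∑ l,
        dChristoffel G l μ α y * christoffel (G 0) α ν l y)
      - (∑ μ, ∑ ν, volInv (G 0) μ ν y * ∑ α, ∑ l,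
        christoffel (G 0) l μ α y * dChristoffel G α ν l y) := by
    simp only [Finset.mul_sum (s := Finset.univ (α := Fin 4)) (a := vol (G 0) y),
      ← Finset.sum_sub_distrib, ← Finset.sum_add_distrib]
    refine Finset.sum_congr rfl fun μ _ => Finset.sum_congr rfl fun ν _ => ?_
    simp only [dRicci, Finset.sum_add_distrib, Finset.sum_sub_distrib, volInv]
    ring
  rw [hL, hR, e1, e2, e3, e4, e5, e6]
  ring

/-- The Palatini flux in terms of `δ(√(-g) g^{μν})`, without `δΓ`. -/
lemma palatiniFlux_eq (α : Fin 4) : palatiniFlux G α y =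
    -(∑ μ, pd μ (dVolInv G μ α) y)
      - (∑ μ, ∑ ν, dVolInv G μ ν y * christoffel (G 0) α μ ν y)
      - ∑ ν, volInv (G 0) α ν y * pd ν (dLogVol G) y := by
  have h1 : ∀ μ, volInv (G 0) μ α y * ∑ l, dChristoffel G l μ l y =
      volInv (G 0) α μ y * pd μ (dLogVol G) y := fun μ => by
    rw [hG.sum_dChristoffel hy, hG.volInv_zero_symm hy]
  simp only [palatiniFlux, h1, hG.div_dVolInv hy α, Finset.sum_add_distrib]
  ring

/-- The variation of the scalar curvature tested against `u`, up to a divergence. -/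
theorem div_scalarFlux {u : E4 → ℝ} (hu : ContDiffOn ℝ 2 u Ω) :
    u y * deriv (fun ε => localScalar (G ε) y) 0 * vol (G 0) y
      - (∑ μ, ∑ ν, (ricci (G 0) μ ν y * u y - opK (G 0) u μ ν y) * dInv G μ ν y) * vol (G 0) y
      = ∑ α, pd α (scalarFlux G u α) y := by
  have h0 := hG.localMetric hG.zero_mem
  have hud : DifferentiableAt ℝ u y :=
    ContDiffOn.differentiableAt_of_isOpen hG.isOpen hu (by norm_num) hy
  have hpd : ∀ i, DifferentiableAt ℝ (pd i u) y := fun i =>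
    ContDiffOn.differentiableAt_of_isOpen hG.isOpen
      (contDiffOn_pd (m := 1) hG.isOpen hu (by norm_num) i) (by norm_num) hy
  have hV : ∀ α, DifferentiableAt ℝ (palatiniFlux G α) y := fun α =>
    ContDiffOn.differentiableAt_of_isOpen hG.isOpen (hG.palatiniFlux_smooth α) (by simp) hy
  have had : ∀ μ ν, DifferentiableAt ℝ (dVolInv G μ ν) y := fun μ ν =>
    ContDiffOn.differentiableAt_of_isOpen hG.isOpen (hG.dVolInv_smooth μ ν) (by simp) hy
  have hτ : DifferentiableAt ℝ (dLogVol G) y :=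
    ContDiffOn.differentiableAt_of_isOpen hG.isOpen hG.dLogVol_smooth (by simp) hy
  have ha := hG.volInv_diff hy
  have hexp : ∀ α, pd α (scalarFlux G u α) y =
      pd α u y * palatiniFlux G α y + u y * pd α (palatiniFlux G α) y
      + (∑ μ, pd α (dVolInv G α μ) y * pd μ u y + ∑ μ, dVolInv G α μ y * pd α (pd μ u) y)
      + (pd α (dLogVol G) y * (∑ ν, volInv (G 0) α ν y * pd ν u y)
        + dLogVol G y * pd α (fun z => ∑ ν, volInv (G 0) α ν z * pd ν u z) y) := by
    intro α
    have d1 := hud.fun_mul (hV α)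
    have d2 : DifferentiableAt ℝ (fun z => ∑ μ, dVolInv G α μ z * pd μ u z) y :=
      DifferentiableAt.fun_sum fun μ _ => (had α μ).fun_mul (hpd μ)
    have d3 : DifferentiableAt ℝ (fun z => ∑ ν, volInv (G 0) α ν z * pd ν u z) y :=
      DifferentiableAt.fun_sum fun ν _ => (ha α ν).fun_mul (hpd ν)
    unfold scalarFlux
    rw [pd_add (d1.fun_add d2) (hτ.fun_mul d3), pd_add d1 d2, pd_mul hud (hV α), pd_mul hτ d3,
      pd_sum _ fun μ _ => (had α μ).fun_mul (hpd μ), ← Finset.sum_add_distrib]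
    congr 2
    exact Finset.sum_congr rfl fun μ _ => pd_mul (had α μ) (hpd μ) α
  have hbox := h0.vol_mul_localBox hy (hu.contDiffAt (hG.isOpen.mem_nhds hy))
  change _ = ∑ μ, pd μ (fun z => ∑ ν, volInv (G 0) μ ν z * pd ν u z) y at hbox
  -- the terms with first derivatives of `u` and of `δ√(-g)/√(-g)` or `δ(√(-g) g^{μν})` cancel
  have c1 : ∑ α, pd α u y * palatiniFlux G α y =
      -(∑ α, ∑ μ, pd α (dVolInv G α μ) y * pd μ u y)
      - (∑ μ, ∑ ν, dVolInv G μ ν y * ∑ l, christoffel (G 0) l μ ν y * pd l u y)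
      - ∑ α, pd α (dLogVol G) y * (∑ ν, volInv (G 0) α ν y * pd ν u y) := by
    simp only [hG.palatiniFlux_eq hy, mul_sub, mul_neg, Finset.sum_sub_distrib,
      Finset.sum_neg_distrib]
    congr 1
    · congr 1
      · congr 1
        simp only [Finset.mul_sum]
        rw [Finset.sum_comm]
        exact Finset.sum_congr rfl fun α _ => Finset.sum_congr rfl fun μ _ => mul_comm _ _
      · simp only [Finset.mul_sum]
        rw [Finset.sum_comm]
        refine Finset.sum_congr rfl fun μ _ => ?_
        rw [Finset.sum_comm]
        exact Finset.sum_congr rfl fun ν _ => Finset.sum_congr rfl fun l _ => by ring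
    · simp only [Finset.mul_sum]
      rw [Finset.sum_comm]
      refine Finset.sum_congr rfl fun μ _ => Finset.sum_congr rfl fun ν _ => ?_
      rw [hG.volInv_zero_symm hy]
      ring
  have c2 : (∑ α, ∑ μ, dVolInv G α μ y * pd α (pd μ u) y)
      - (∑ μ, ∑ ν, dVolInv G μ ν y * ∑ l, christoffel (G 0) l μ ν y * pd l u y) =
      dLogVol G y * (vol (G 0) y * localBox (G 0) u y)
        + vol (G 0) y * ∑ μ, ∑ ν, hess (G 0) u μ ν y * dInv G μ ν y := by
    simp only [localBox, Finset.mul_sum (s := Finset.univ (α := Fin 4)) (a := vol (G 0) y),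
      Finset.mul_sum (s := Finset.univ (α := Fin 4)) (a := dLogVol G y),
      ← Finset.sum_sub_distrib, ← Finset.sum_add_distrib]
    refine Finset.sum_congr rfl fun μ _ => Finset.sum_congr rfl fun ν _ => ?_
    rw [hG.dVolInv_eq hy, hess]
    ring
  have c3 : ∑ μ, ∑ ν, (ricci (G 0) μ ν y * u y - opK (G 0) u μ ν y) * dInv G μ ν y =
      u y * (∑ μ, ∑ ν, dInv G μ ν y * ricci (G 0) μ ν y)
      - (∑ μ, ∑ ν, hess (G 0) u μ ν y * dInv G μ ν y)
      - 2 * dLogVol G y * localBox (G 0) u y := by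
    have : 2 * dLogVol G y * localBox (G 0) u y =
        -∑ μ, ∑ ν, localBox (G 0) u y * (G 0 y μ ν * dInv G μ ν y) := by
      simp only [dLogVol, ← Finset.mul_sum]
      ring
    rw [this]
    simp only [Finset.mul_sum, ← Finset.sum_sub_distrib, sub_neg_eq_add,
      ← Finset.sum_add_distrib]
    refine Finset.sum_congr rfl fun μ _ => Finset.sum_congr rfl fun ν _ => ?_
    rw [opK]
    ring
  have c4 : ∑ α, u y * pd α (palatiniFlux G α) y =
      u y * (vol (G 0) y * ∑ μ, ∑ ν, (G 0 y)⁻¹ μ ν * dRicci G μ ν y) := by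
    rw [← Finset.mul_sum, hG.div_palatiniFlux hy]
  have c5 : ∑ α, dLogVol G y * pd α (fun z => ∑ ν, volInv (G 0) α ν z * pd ν u z) y =
      dLogVol G y * (vol (G 0) y * localBox (G 0) u y) := by
    rw [← Finset.mul_sum, hbox]
  rw [Finset.sum_congr rfl fun α _ => hexp α]
  simp only [Finset.sum_add_distrib]
  rw [(hG.hasDerivAt_localScalar hy).deriv, c1, c3, c4, c5]
  simp only [Finset.sum_add_distrib]
  linear_combination -c2

/-- The variation of the d'Alembertian tested against `A`, up to a divergence. -/
theorem div_boxFlux {v : ℝ → E4 → ℝ} {A : E4 → ℝ}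
    (hv : ContDiffOn ℝ ∞ (fun p : ℝ × E4 => v p.1 p.2) (Ioo (-r) r ×ˢ Ω))
    (hA : ContDiffOn ℝ 2 A Ω) :
    A y * deriv (fun ε => localBox (G ε) (v ε) y) 0 * vol (G 0) y
      - (1 / 2) * ((∑ μ, ∑ ν, tensorS (G 0) A (v 0) μ ν y * dInv G μ ν y) * vol (G 0) y)
      - localBox (G 0) A y * deriv (fun ε => v ε y) 0 * vol (G 0) y
      = ∑ μ, pd μ (boxFlux G v A μ) y := by
  have h0 := hG.localMetric hG.zero_mem
  set w : E4 → ℝ := fun z => deriv (fun ε => v ε z) 0 with hw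
  set Y : Fin 4 → E4 → ℝ := fun μ z => ∑ ν, (dVolInv G μ ν z * pd ν (v 0) z
      + volInv (G 0) μ ν z * pd ν w z) with hY
  set Z : Fin 4 → E4 → ℝ := fun μ z => ∑ ν, volInv (G 0) μ ν z * pd ν A z with hZ
  have hv0 : ∀ ε ∈ Ioo (-r) r, ContDiffOn ℝ ∞ (v ε) Ω := fun ε hε => contDiffOn_slice hv hε
  have hws : ContDiffOn ℝ ∞ w Ω := hG.variation_smooth hv
  have hAd : DifferentiableAt ℝ A y :=
    ContDiffOn.differentiableAt_of_isOpen hG.isOpen hA (by norm_num) hy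
  have hwd : DifferentiableAt ℝ w y :=
    ContDiffOn.differentiableAt_of_isOpen hG.isOpen hws (by simp) hy
  have hYd : ∀ μ, DifferentiableAt ℝ (Y μ) y := fun μ =>
    ContDiffOn.differentiableAt_of_isOpen (n := ∞) hG.isOpen (ContDiffOn.sum fun ν _ =>
      ((hG.dVolInv_smooth μ ν).mul (contDiffOn_pd hG.isOpen (hv0 0 hG.zero_mem) le_rfl ν)).add
      ((hG.volInv_zero_smooth μ ν).mul (contDiffOn_pd hG.isOpen hws le_rfl ν))) (by simp) hy
  have hZd : ∀ μ, DifferentiableAt ℝ (Z μ) y := fun μ =>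
    ContDiffOn.differentiableAt_of_isOpen (n := 1) hG.isOpen (ContDiffOn.sum fun ν _ =>
      ((hG.volInv_zero_smooth μ ν).of_le (le_trans (by norm_num) two_le_infty)).mul
      (contDiffOn_pd hG.isOpen hA (by norm_num) ν)) (by norm_num) hy
  have hbA : vol (G 0) y * localBox (G 0) A y = ∑ μ, pd μ (Z μ) y :=
    h0.vol_mul_localBox hy (hA.contDiffAt (hG.isOpen.mem_nhds hy))
  have hexp : ∀ μ, pd μ (boxFlux G v A μ) y =
      pd μ A y * Y μ y + A y * pd μ (Y μ) y - (pd μ w y * Z μ y + w y * pd μ (Z μ) y) := by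
    intro μ
    change pd μ (fun z => A z * Y μ z - w z * Z μ z) y = _
    rw [pd_sub (hAd.fun_mul (hYd μ)) (hwd.fun_mul (hZd μ)), pd_mul hAd (hYd μ),
      pd_mul hwd (hZd μ)]
  -- the variation of the divergence form of the d'Alembertian
  have hvar : dVol G y * localBox (G 0) (v 0) y +
      vol (G 0) y * deriv (fun ε => localBox (G ε) (v ε) y) 0 = ∑ μ, pd μ (Y μ) y := by
    have h1 := (hG.hasDerivAt_vol hy).mul (hG.hasDerivAt_variation hy (hG.localBox_smooth hv))
    have hF : ∀ μ, ContDiffOn ℝ ∞ (fun p : ℝ × E4 => ∑ ν, volInv (G p.1) μ ν p.2 *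
        pd ν (v p.1) p.2) (Ioo (-r) r ×ˢ Ω) := fun μ => ContDiffOn.sum fun ν _ =>
      (hG.volInv_smooth μ ν).mul (contDiffOn_family_pd hG.isOpen_prod hv ν)
    have h2 : HasDerivAt (fun ε => ∑ μ, pd μ (fun z => ∑ ν, volInv (G ε) μ ν z * pd ν (v ε) z) y)
        (∑ μ, pd μ (fun z => deriv (fun ε => ∑ ν, volInv (G ε) μ ν z * pd ν (v ε) z) 0) y) 0 :=
      HasDerivAt.fun_sum fun μ _ => hG.hasDerivAt_pd_variation hy (hF μ) μ
    have h3 : ∀ μ, pd μ (fun z => deriv (fun ε => ∑ ν, volInv (G ε) μ ν z * pd ν (v ε) z) 0) y =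
        pd μ (Y μ) y := by
      intro μ
      refine pd_congr ?_ μ
      filter_upwards [hG.isOpen.mem_nhds hy] with z hz
      exact (HasDerivAt.fun_sum fun ν _ => (hG.hasDerivAt_volInv hz μ ν).mul
        (hG.hasDerivAt_pd_variation hz hv ν)).deriv
    simp only [h3] at h2
    refine h1.unique (h2.congr_of_eventuallyEq ?_)
    filter_upwards [isOpen_Ioo.mem_nhds hG.zero_mem] with ε hε
    exact (hG.localMetric hε).vol_mul_localBox hy
      (((hv0 ε hε).contDiffAt (hG.isOpen.mem_nhds hy)).of_le two_le_infty)
  have c1 : ∑ μ, pd μ A y * Y μ y - ∑ μ, pd μ w y * Z μ y =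
      ∑ μ, ∑ ν, pd μ A y * pd ν (v 0) y * dVolInv G μ ν y := by
    have : ∑ μ, pd μ w y * Z μ y = ∑ μ, ∑ ν, pd μ A y * (volInv (G 0) μ ν y * pd ν w y) := by
      simp only [hZ, Finset.mul_sum]
      rw [Finset.sum_comm]
      refine Finset.sum_congr rfl fun μ _ => Finset.sum_congr rfl fun ν _ => ?_
      rw [hG.volInv_zero_symm hy]
      ring
    rw [this, ← Finset.sum_sub_distrib]
    refine Finset.sum_congr rfl fun μ _ => ?_
    rw [hY]
    simp only [Finset.mul_sum]
    rw [← Finset.sum_sub_distrib]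
    exact Finset.sum_congr rfl fun ν _ => by ring
  have c2 : ∑ μ, ∑ ν, tensorS (G 0) A (v 0) μ ν y * dInv G μ ν y =
      -2 * dLogVol G y * ((∑ α, ∑ β, (G 0 y)⁻¹ α β * pd α A y * pd β (v 0) y)
        + A y * localBox (G 0) (v 0) y)
      - 2 * ∑ μ, ∑ ν, pd μ A y * pd ν (v 0) y * dInv G μ ν y := by
    set N := ∑ α, ∑ β, (G 0 y)⁻¹ α β * pd α A y * pd β (v 0) y with hN
    have : -2 * dLogVol G y * (N + A y * localBox (G 0) (v 0) y) =
        ∑ μ, ∑ ν, (N + A y * localBox (G 0) (v 0) y) * (G 0 y μ ν * dInv G μ ν y) := by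
      simp only [dLogVol, ← Finset.mul_sum]
      ring
    rw [this]
    simp only [Finset.mul_sum, ← Finset.sum_sub_distrib]
    refine Finset.sum_congr rfl fun μ _ => Finset.sum_congr rfl fun ν _ => ?_
    rw [tensorS, ← hN]
    ring
  have c3 : ∑ μ, ∑ ν, pd μ A y * pd ν (v 0) y * dVolInv G μ ν y =
      vol (G 0) y * dLogVol G y * (∑ α, ∑ β, (G 0 y)⁻¹ α β * pd α A y * pd β (v 0) y)
      + vol (G 0) y * ∑ μ, ∑ ν, pd μ A y * pd ν (v 0) y * dInv G μ ν y := by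
    simp only [Finset.mul_sum, ← Finset.sum_add_distrib]
    refine Finset.sum_congr rfl fun μ _ => Finset.sum_congr rfl fun ν _ => ?_
    rw [hG.dVolInv_eq hy]
    ring
  rw [Finset.sum_congr rfl fun μ _ => hexp μ]
  simp only [Finset.sum_add_distrib, Finset.sum_sub_distrib, ← Finset.mul_sum]
  rw [← hvar, ← hbA, c2, hG.dVol_eq hy]
  linear_combination -c1 - c3

end MetricFamily

/-! ### Changes of coordinates -/

/-- The Jacobian matrix `J^a_i = ∂_i φ^a`. -/
def jac (φ : E4 → E4) (y : E4) : Matrix (Fin 4) (Fin 4) ℝ :=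
  Matrix.of fun a i => pd i (fun z => φ z a) y

lemma fderiv_single_eq {φ : E4 → E4} {y : E4} (hφ : DifferentiableAt ℝ φ y) (i : Fin 4) :
    fderiv ℝ φ y (EuclideanSpace.single i 1) =
    ∑ a, jac φ y a i • EuclideanSpace.single a (1 : ℝ) := by
  have h : ∀ a, (fderiv ℝ φ y (EuclideanSpace.single i 1)) a = jac φ y a i := by
    intro a
    have := ((EuclideanSpace.proj (𝕜 := ℝ) a : E4 →L[ℝ] ℝ).hasFDerivAt.comp y
      hφ.hasFDerivAt).fderiv
    change _ = fderiv ℝ (fun z => φ z a) y (EuclideanSpace.single i 1)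
    erw [this]
    rfl
  ext b
  simp [h, Pi.single_apply]

lemma det_fderiv_eq {φ : E4 → E4} {y : E4} (hφ : DifferentiableAt ℝ φ y) :
    (fderiv ℝ φ y).det = (jac φ y).det := by
  rw [ContinuousLinearMap.det, ← LinearMap.det_toMatrix (EuclideanSpace.basisFun (Fin 4) ℝ).toBasis]
  congr 1
  ext a i
  rw [LinearMap.toMatrix_apply]
  simp [fderiv_single_eq hφ]

/-- A change of coordinates `φ` from the open set `Ω'` to the open set `Ω`. -/
structure CoordChange (φ : E4 → E4) (Ω' Ω : Set E4) : Prop where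
  isOpen : IsOpen Ω'
  smooth : ContDiffOn ℝ ∞ φ Ω'
  mapsTo : MapsTo φ Ω' Ω
  det_ne : ∀ y ∈ Ω', (jac φ y).det ≠ 0

/-- The matrix `(A_i)^k_j = Γ^k_{ij}` of the connection form in the direction `∂_i`. -/
def conn (G : E4 → Matrix (Fin 4) (Fin 4) ℝ) (i : Fin 4) (y : E4) : Matrix (Fin 4) (Fin 4) ℝ :=
  Matrix.of fun k j => christoffel G k i j y

/-- The matrix of the curvature form, `(F_{βν})^α_μ = R^α_{μβν}`. -/
def curv (G : E4 → Matrix (Fin 4) (Fin 4) ℝ) (β ν : Fin 4) (y : E4) :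
    Matrix (Fin 4) (Fin 4) ℝ :=
  Matrix.of fun α μ => riemann G α μ β ν y

/-- The matrix of the partial derivatives in the direction `∂_i`. -/
def pdMat (i : Fin 4) (A : E4 → Matrix (Fin 4) (Fin 4) ℝ) (y : E4) :
    Matrix (Fin 4) (Fin 4) ℝ :=
  matDeriv A y (EuclideanSpace.single i 1)

lemma pdMat_apply (i : Fin 4) (A : E4 → Matrix (Fin 4) (Fin 4) ℝ) (y : E4) (k l : Fin 4) :
    pdMat i A y k l = pd i (fun z => A z k l) y := rfl

/-- The structure equation `F_{βν} = ∂_β A_ν - ∂_ν A_β + [A_β, A_ν]`. -/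
lemma LocalMetric.curv_eq {G : E4 → Matrix (Fin 4) (Fin 4) ℝ} {Ω : Set E4}
    (hG : LocalMetric G Ω) {y : E4} (hy : y ∈ Ω) (β ν : Fin 4) :
    curv G β ν y = pdMat β (conn G ν) y - pdMat ν (conn G β) y
      + (conn G β y * conn G ν y - conn G ν y * conn G β y) := by
  have hs : ∀ i k j l, pd i (christoffel G k j l) y = pd i (christoffel G k l j) y :=
    fun i k j l => pd_congr (by
      filter_upwards [hG.isOpen.mem_nhds hy] with z hz using hG.christoffel_symm hz k j l) i
  ext α μ
  have h1 : ∀ i j, pdMat i (conn G j) y α μ = pd i (christoffel G α μ j) y := fun i j =>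
    hs i α j μ
  simp only [curv, Matrix.of_apply, Matrix.add_apply, Matrix.sub_apply, h1, conn,
    Matrix.mul_apply, riemann, ← Finset.sum_sub_distrib]
  congr 1
  refine Finset.sum_congr rfl fun l _ => ?_
  rw [hG.christoffel_symm hy l μ ν, hG.christoffel_symm hy l μ β]
  ring

/-- The full contraction of a covariant with a contravariant two-tensor is invariant. -/
lemma sum_mul_congruence {J T k T' k' : Matrix (Fin 4) (Fin 4) ℝ} (hJ : J.det ≠ 0)
    (hT : T' = Jᵀ * T * J) (hk : k' = J⁻¹ * k * (J⁻¹)ᵀ) :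
    ∑ μ, ∑ ν, T' μ ν * k' μ ν = ∑ μ, ∑ ν, T μ ν * k μ ν := by
  have htr : ∀ A B : Matrix (Fin 4) (Fin 4) ℝ, ∑ μ, ∑ ν, A μ ν * B μ ν = (A * Bᵀ).trace := by
    intro A B
    simp [Matrix.trace, Matrix.mul_apply]
  have hu : IsUnit J.det := isUnit_iff_ne_zero.2 hJ
  have h1 : Jᵀ * T * J * (J⁻¹ * (kᵀ * (J⁻¹)ᵀ)) = Jᵀ * (T * kᵀ * (J⁻¹)ᵀ) := by
    rw [Matrix.mul_assoc (Jᵀ * T), ← Matrix.mul_assoc J, Matrix.mul_nonsing_inv _ hu,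
      Matrix.one_mul, Matrix.mul_assoc, Matrix.mul_assoc]
  rw [htr, htr, hT, hk, Matrix.transpose_mul, Matrix.transpose_mul, Matrix.transpose_transpose,
    h1, Matrix.trace_mul_comm, Matrix.mul_assoc (T * kᵀ), ← Matrix.transpose_mul,
    Matrix.mul_nonsing_inv _ hu, Matrix.transpose_one, Matrix.mul_one]

namespace CoordChange

variable {φ : E4 → E4} {Ω' Ω : Set E4} (hφ : CoordChange φ Ω' Ω) {y : E4} (hy : y ∈ Ω')

include hφ

lemma coord_smooth (a : Fin 4) : ContDiffOn ℝ ∞ (fun z => φ z a) Ω' :=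
  (EuclideanSpace.proj (𝕜 := ℝ) a : E4 →L[ℝ] ℝ).contDiff.comp_contDiffOn hφ.smooth

lemma jac_smooth (a i : Fin 4) : ContDiffOn ℝ ∞ (fun z => jac φ z a i) Ω' :=
  contDiffOn_pd hφ.isOpen (hφ.coord_smooth a) le_rfl i

include hy

lemma jac_diff (a i : Fin 4) : DifferentiableAt ℝ (fun z => jac φ z a i) y :=
  ContDiffOn.differentiableAt_of_isOpen hφ.isOpen (hφ.jac_smooth a i) (by simp) hy

lemma differentiableAt : DifferentiableAt ℝ φ y :=
  (hφ.smooth.contDiffAt (hφ.isOpen.mem_nhds hy)).differentiableAt (by simp)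

lemma pd_comp {u : E4 → ℝ} (hu : DifferentiableAt ℝ u (φ y)) (i : Fin 4) :
    pd i (fun z => u (φ z)) y = ∑ a, jac φ y a i * pd a u (φ y) := by
  have h : fderiv ℝ (fun z => u (φ z)) y = (fderiv ℝ u (φ y)).comp (fderiv ℝ φ y) :=
    fderiv_comp y hu (hφ.differentiableAt hy)
  rw [pd, h, ContinuousLinearMap.comp_apply, fderiv_single_eq (hφ.differentiableAt hy), map_sum]
  simp [pd]

lemma pd_jac_symm (a i j : Fin 4) :
    pd i (fun z => jac φ z a j) y = pd j (fun z => jac φ z a i) y :=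
  pd_comm (((hφ.coord_smooth a).contDiffAt (hφ.isOpen.mem_nhds hy)).of_le two_le_infty) i j

lemma isUnit_det : IsUnit (jac φ y).det := isUnit_iff_ne_zero.2 (hφ.det_ne y hy)

lemma mul_inv : jac φ y * (jac φ y)⁻¹ = 1 := Matrix.mul_nonsing_inv _ (hφ.isUnit_det hy)

lemma inv_mul : (jac φ y)⁻¹ * jac φ y = 1 := Matrix.nonsing_inv_mul _ (hφ.isUnit_det hy)

lemma pdMat_comp {A : E4 → Matrix (Fin 4) (Fin 4) ℝ}
    (hA : ∀ i j, DifferentiableAt ℝ (fun z => A z i j) (φ y)) (i : Fin 4) :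
    pdMat i (fun z => A (φ z)) y = ∑ a, jac φ y a i • pdMat a A (φ y) := by
  ext k l
  rw [pdMat_apply, hφ.pd_comp hy (hA k l), Matrix.sum_apply]
  rfl

end CoordChange

/-- The matrix `J^b_i A_b` of the connection form at `φ y` in the direction of the image of
`∂_i`. -/
def pullConn (G : E4 → Matrix (Fin 4) (Fin 4) ℝ) (φ : E4 → E4) (i : Fin 4) (y : E4) :
    Matrix (Fin 4) (Fin 4) ℝ :=
  ∑ b, jac φ y b i • conn G b (φ y)

/-- The metric `G'` on `Ω'` is the pullback of the metric `G` on `Ω` by a change of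
coordinates. -/
structure Isometric (G' G : E4 → Matrix (Fin 4) (Fin 4) ℝ) (φ : E4 → E4) (Ω' Ω : Set E4) : Prop
    where
  left : LocalMetric G' Ω'
  right : LocalMetric G Ω
  change : CoordChange φ Ω' Ω
  pullback : ∀ y ∈ Ω', G' y = (jac φ y)ᵀ * G (φ y) * jac φ y

namespace Isometric

variable {G' G : E4 → Matrix (Fin 4) (Fin 4) ℝ} {φ : E4 → E4} {Ω' Ω : Set E4}
  (h : Isometric G' G φ Ω' Ω) {y : E4} (hy : y ∈ Ω')

include h hy

lemma mapsTo : φ y ∈ Ω := h.change.mapsTo hy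

lemma inv_eq : (G' y)⁻¹ = (jac φ y)⁻¹ * (G (φ y))⁻¹ * ((jac φ y)⁻¹)ᵀ := by
  rw [h.pullback y hy, Matrix.mul_inv_rev, Matrix.mul_inv_rev, Matrix.transpose_nonsing_inv,
    Matrix.mul_assoc]

lemma vol_eq : vol G' y = |(jac φ y).det| * vol G (φ y) := by
  rw [vol, vol, h.pullback y hy, Matrix.det_mul, Matrix.det_mul, Matrix.det_transpose]
  have : -((jac φ y).det * (G (φ y)).det * (jac φ y).det) =
      (jac φ y).det ^ 2 * -(G (φ y)).det := by ring
  rw [this, Real.sqrt_mul (sq_nonneg _), Real.sqrt_sq_eq_abs]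

lemma conn_diff (b i j : Fin 4) : DifferentiableAt ℝ (fun z => conn G b z i j) (φ y) :=
  h.right.christoffel_diff (h.mapsTo hy) i b j

/-- The transformation law of the Christoffel symbols, `J A'_i = J^b_i A_b J + ∂_i J`. The matrices
`B_i = J⁻¹ (J^b_i A_b J + ∂_i J)` define a torsion-free connection for which `G'` is parallel, and
the Koszul formula says that there is only one. -/
lemma conn_law (i : Fin 4) :
    jac φ y * conn G' i y = pullConn G φ i y * jac φ y + pdMat i (jac φ) y := by
  set J := jac φ y with hJ
  set g := G (φ y) with hg
  set N : Fin 4 → Matrix (Fin 4) (Fin 4) ℝ := fun i => pullConn G φ i y * J + pdMat i (jac φ) y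
    with hN
  set B : Fin 4 → Matrix (Fin 4) (Fin 4) ℝ := fun i => J⁻¹ * N i with hB
  have hJB : ∀ i, J * B i = N i := fun i => by
    rw [hB, ← Matrix.mul_assoc, h.change.mul_inv hy, Matrix.one_mul]
  -- `B` is symmetric in its lower indices
  have hNsymm : ∀ i k j, N i k j = N j k i := by
    intro i k j
    simp only [hN, Matrix.add_apply, pdMat_apply, h.change.pd_jac_symm hy k i j]
    congr 1
    simp only [pullConn, Matrix.mul_apply, Matrix.sum_apply, Matrix.smul_apply, smul_eq_mul,
      Finset.sum_mul, conn, Matrix.of_apply]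
    rw [Finset.sum_comm]
    refine Finset.sum_congr rfl fun a _ => Finset.sum_congr rfl fun b _ => ?_
    rw [h.right.christoffel_symm (h.mapsTo hy) k b a]
    ring
  have hBsymm : ∀ i k j, B i k j = B j k i := fun i k j => by
    simp only [hB, Matrix.mul_apply, hNsymm i _ j]
  -- the metric `G'` is parallel with respect to `B`
  have hpar : ∀ i, pdMat i G' y = (B i)ᵀ * G' y + G' y * B i := by
    intro i
    have hJd := h.change.jac_diff hy
    have hGd : ∀ k l, DifferentiableAt ℝ (fun z => G (φ z) k l) y := fun k l =>
      (h.right.diff (h.mapsTo hy) k l).comp y (h.change.differentiableAt hy)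
    have hJTd : ∀ k l, DifferentiableAt ℝ (fun z => (jac φ z)ᵀ k l) y := fun k l => hJd l k
    have hTGd : ∀ k l, DifferentiableAt ℝ (fun z => ((jac φ z)ᵀ * G (φ z)) k l) y := fun k l => by
      simp only [Matrix.mul_apply]
      exact DifferentiableAt.fun_sum fun m _ => (hJTd k m).fun_mul (hGd m l)
    have h1 : pdMat i G' y = pdMat i (fun z => (jac φ z)ᵀ * G (φ z) * jac φ z) y :=
      matDeriv_congr (by
        filter_upwards [h.change.isOpen.mem_nhds hy] with z hz using h.pullback z hz) _
    have h2 : pdMat i (fun z => G (φ z)) y =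
        (pullConn G φ i y)ᵀ * g + g * pullConn G φ i y := by
      rw [h.change.pdMat_comp hy (h.right.diff (h.mapsTo hy))]
      have : ∀ a, pdMat a G (φ y) = (conn G a (φ y))ᵀ * g + g * conn G a (φ y) :=
        fun a => h.right.matDeriv_metric (h.mapsTo hy) a
      simp only [this, pullConn, Matrix.transpose_sum, Matrix.transpose_smul, Matrix.sum_mul,
        Matrix.mul_sum, smul_add, Finset.sum_add_distrib, Matrix.smul_mul, Matrix.mul_smul]
    have h3 : pdMat i (fun z => (jac φ z)ᵀ) y = (pdMat i (jac φ) y)ᵀ := rfl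
    have h4 : pdMat i (fun z => (jac φ z)ᵀ * G (φ z) * jac φ z) y =
        (pdMat i (fun z => (jac φ z)ᵀ) y * g + Jᵀ * pdMat i (fun z => G (φ z)) y) * J
          + Jᵀ * g * pdMat i (jac φ) y := by
      unfold pdMat
      rw [matDeriv_mul hTGd hJd, matDeriv_mul hJTd hGd]
    have h5 : G' y = Jᵀ * g * J := h.pullback y hy
    have h6 : (B i)ᵀ * Jᵀ = (N i)ᵀ := by rw [← Matrix.transpose_mul, hJB]
    rw [h1, h4, h3, h2, h5, ← Matrix.mul_assoc (B i)ᵀ, ← Matrix.mul_assoc (B i)ᵀ, h6,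
      Matrix.mul_assoc (Jᵀ * g) J, hJB, hN]
    simp only [Matrix.transpose_add, Matrix.transpose_mul, Matrix.mul_add, Matrix.add_mul,
      Matrix.mul_assoc]
    abel
  -- hence `B` is the Levi-Civita connection of `G'`
  have hconn : conn G' i y = B i := by
    have hlow : ∀ m j, (G' y * B i) m j = (1 / 2) * (pd i (fun z => G' z m j) y
        + pd j (fun z => G' z m i) y - pd m (fun z => G' z i j) y) := by
      intro m j
      have e : ∀ p q l, pd p (fun z => G' z q l) y =
          (∑ k, G' y l k * B p k q) + ∑ k, G' y q k * B p k l := by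
        intro p q l
        have := congrFun (congrFun (hpar p) q) l
        rw [pdMat_apply] at this
        rw [this, Matrix.add_apply, Matrix.mul_apply, Matrix.mul_apply]
        congr 1
        exact Finset.sum_congr rfl fun k _ => by
          rw [Matrix.transpose_apply, h.left.symm y hy k l, mul_comm]
      rw [e i m j, e j m i, e m i j, Matrix.mul_apply]
      have s1 : ∀ k, B j k i = B i k j := fun k => hBsymm j k i
      have s2 : ∀ k, B m k i = B i k m := fun k => hBsymm m k i
      have s3 : ∀ k, B m k j = B j k m := fun k => hBsymm m k j
      simp only [s2, s3]
      simp only [s1]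
      ring
    have hGB : G' y * conn G' i y = G' y * B i := by
      ext m j
      rw [hlow, ← h.left.lower_christoffel hy m i j, Matrix.mul_apply]
      rfl
    have hu := h.left.isUnit_det hy
    calc conn G' i y = (G' y)⁻¹ * (G' y * conn G' i y) := by
          rw [← Matrix.mul_assoc, Matrix.nonsing_inv_mul _ hu, Matrix.one_mul]
      _ = B i := by
          rw [hGB, ← Matrix.mul_assoc, Matrix.nonsing_inv_mul _ hu, Matrix.one_mul]
  rw [hconn, hJB]

omit hy in
/-- The transformation law of the curvature forms: the derivative of `conn_law`, in which the
second derivatives of `J` cancel. -/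
lemma curv_law (hy : y ∈ Ω') (β ν : Fin 4) : jac φ y * curv G' β ν y =
    (∑ c, ∑ b, (jac φ y c β * jac φ y b ν) • curv G c b (φ y)) * jac φ y := by
  set J := jac φ y with hJ
  have hJd := h.change.jac_diff hy
  have hAd := h.conn_diff hy
  have hA'd : ∀ b i j, DifferentiableAt ℝ (fun z => conn G' b z i j) y := fun b i j =>
    h.left.christoffel_diff hy i b j
  have hAφ : ∀ b i j, DifferentiableAt ℝ (fun z => conn G b (φ z) i j) y := fun b i j =>
    (hAd b i j).comp y (h.change.differentiableAt hy)
  have hPd : ∀ b i j, DifferentiableAt ℝ (fun z => pullConn G φ b z i j) y := fun b i j => by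
    simp only [pullConn, Matrix.sum_apply, Matrix.smul_apply, smul_eq_mul]
    exact DifferentiableAt.fun_sum fun m _ => (hJd m b).fun_mul (hAφ m i j)
  have hdJd : ∀ b i j, DifferentiableAt ℝ (fun z => pdMat b (jac φ) z i j) y := fun b i j =>
    ContDiffOn.differentiableAt_of_isOpen (n := ∞) h.change.isOpen
      (contDiffOn_pd h.change.isOpen (h.change.jac_smooth i j) le_rfl b) (by simp) hy
  have hPJd : ∀ b i j, DifferentiableAt ℝ (fun z => (pullConn G φ b z * jac φ z) i j) y :=
    fun b i j => by
      simp only [Matrix.mul_apply]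
      exact DifferentiableAt.fun_sum fun m _ => (hPd b i m).fun_mul (hJd m j)
  have hddJ : pdMat β (pdMat ν (jac φ)) y = pdMat ν (pdMat β (jac φ)) y := by
    ext k l
    exact pd_comm (((h.change.jac_smooth k l).contDiffAt (h.change.isOpen.mem_nhds hy)).of_le
      two_le_infty) β ν
  have hdiff : ∀ β ν, pdMat β (jac φ) y * conn G' ν y + J * pdMat β (conn G' ν) y =
      pdMat β (pullConn G φ ν) y * J + pullConn G φ ν y * pdMat β (jac φ) y
        + pdMat β (pdMat ν (jac φ)) y := by
    intro β ν
    have e1 : pdMat β (fun z => jac φ z * conn G' ν z) y =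
        pdMat β (fun z => pullConn G φ ν z * jac φ z + pdMat ν (jac φ) z) y :=
      matDeriv_congr (by
        filter_upwards [h.change.isOpen.mem_nhds hy] with z hz using h.conn_law hz ν) _
    have e2 : pdMat β (fun z => pullConn G φ ν z * jac φ z + pdMat ν (jac φ) z) y =
        pdMat β (fun z => pullConn G φ ν z * jac φ z) y + pdMat β (pdMat ν (jac φ)) y := by
      ext k l
      exact pd_add (hPJd ν k l) (hdJd ν k l) β
    rw [e2] at e1
    unfold pdMat at e1 ⊢
    rwa [matDeriv_mul hJd (hA'd ν), matDeriv_mul (hPd ν) hJd] at e1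
  have hpull : ∀ β ν, pdMat β (pullConn G φ ν) y =
      ∑ b, pd β (fun z => jac φ z b ν) y • conn G b (φ y)
      + ∑ c, ∑ b, (J c β * J b ν) • pdMat c (conn G b) (φ y) := by
    intro β ν
    have e1 : pdMat β (pullConn G φ ν) y = ∑ b, (pd β (fun z => jac φ z b ν) y • conn G b (φ y)
        + J b ν • pdMat β (fun z => conn G b (φ z)) y) := by
      ext k l
      simp only [pdMat_apply, pullConn, Matrix.sum_apply, Matrix.smul_apply, smul_eq_mul,
        Matrix.add_apply]
      rw [pd_sum _ fun b _ => (hJd b ν).fun_mul (hAφ b k l)]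
      exact Finset.sum_congr rfl fun b _ => pd_mul (hJd b ν) (hAφ b k l) β
    rw [e1, Finset.sum_add_distrib]
    congr 1
    rw [Finset.sum_comm]
    refine Finset.sum_congr rfl fun b _ => ?_
    rw [h.change.pdMat_comp hy (hAd b), Finset.smul_sum]
    exact Finset.sum_congr rfl fun c _ => by rw [smul_smul, mul_comm]
  have hhalf : ∀ β ν, J * (pdMat β (conn G' ν) y + conn G' β y * conn G' ν y) =
      (pdMat β (pullConn G φ ν) y + pullConn G φ β y * pullConn G φ ν y) * J
      + (pullConn G φ ν y * pdMat β (jac φ) y + pullConn G φ β y * pdMat ν (jac φ) y)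
      + pdMat β (pdMat ν (jac φ)) y := by
    intro β ν
    have e1 : J * (conn G' β y * conn G' ν y) = pullConn G φ β y * (pullConn G φ ν y * J
        + pdMat ν (jac φ) y) + pdMat β (jac φ) y * conn G' ν y := by
      rw [← Matrix.mul_assoc, h.conn_law hy, Matrix.add_mul, Matrix.mul_assoc, h.conn_law hy]
    rw [Matrix.mul_add, e1, eq_sub_of_add_eq' (hdiff β ν)]
    simp only [Matrix.mul_add, Matrix.add_mul, Matrix.mul_assoc]
    abel
  have hF : curv G' β ν y = (pdMat β (conn G' ν) y + conn G' β y * conn G' ν y)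
      - (pdMat ν (conn G' β) y + conn G' ν y * conn G' β y) := by
    rw [h.left.curv_eq hy]; abel
  have hquad : ∀ β ν, pullConn G φ β y * pullConn G φ ν y =
      ∑ c, ∑ b, (J c β * J b ν) • (conn G c (φ y) * conn G b (φ y)) := by
    intro β ν
    simp only [pullConn, Matrix.sum_mul, Matrix.mul_sum, Matrix.smul_mul, Matrix.mul_smul,
      smul_smul, Finset.smul_sum]
    rw [Finset.sum_comm]
    simp only [hJ, mul_comm]
  have hR : ∑ c, ∑ b, (J c β * J b ν) • curv G c b (φ y) =
      (pdMat β (pullConn G φ ν) y + pullConn G φ β y * pullConn G φ ν y)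
      - (pdMat ν (pullConn G φ β) y + pullConn G φ ν y * pullConn G φ β y) := by
    have hs : ∀ f : Fin 4 → Fin 4 → Matrix (Fin 4) (Fin 4) ℝ,
        ∑ c, ∑ b, (J c ν * J b β) • f c b = ∑ c, ∑ b, (J c β * J b ν) • f b c := by
      intro f
      rw [Finset.sum_comm]
      simp only [mul_comm]
    rw [hpull, hpull, hquad, hquad, hs, hs]
    simp only [h.change.pd_jac_symm hy _ ν β]
    simp only [h.right.curv_eq (h.mapsTo hy), smul_add, smul_sub, Finset.sum_add_distrib,
      Finset.sum_sub_distrib]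
    abel
  rw [hF, Matrix.mul_sub, hhalf, hhalf, hR, hddJ]
  simp only [Matrix.sub_mul, Matrix.add_mul]
  abel

/-- The Ricci tensor is a tensor. -/
lemma ricci_law : Matrix.of (fun μ ν => ricci G' μ ν y) =
    (jac φ y)ᵀ * Matrix.of (fun μ ν => ricci G μ ν (φ y)) * jac φ y := by
  set J := jac φ y with hJ
  have hc : ∀ β ν, curv G' β ν y =
      ∑ c, ∑ b, (J c β * J b ν) • (J⁻¹ * (curv G c b (φ y) * J)) := by
    intro β ν
    calc curv G' β ν y = J⁻¹ * (J * curv G' β ν y) := by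
          rw [← Matrix.mul_assoc, h.change.inv_mul hy, Matrix.one_mul]
      _ = _ := by
          rw [h.curv_law hy]
          simp only [Matrix.sum_mul, Matrix.mul_sum, Matrix.smul_mul, Matrix.mul_smul]
          rfl
  ext μ ν
  have e1 : ricci G' μ ν y = ∑ α, curv G' α ν y α μ := rfl
  have e2 : ∀ c b, ∑ α, J c α * (J⁻¹ * (curv G c b (φ y) * J)) α μ =
      (curv G c b (φ y) * J) c μ := by
    intro c b
    rw [← Matrix.mul_apply, ← Matrix.mul_assoc, h.change.mul_inv hy, Matrix.one_mul]
  have e3 : ∑ α, curv G' α ν y α μ = ∑ c, ∑ b, J b ν * (curv G c b (φ y) * J) c μ := by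
    simp only [hc, Matrix.sum_apply, Matrix.smul_apply, smul_eq_mul, ← e2, Finset.mul_sum]
    rw [Finset.sum_comm]
    refine Finset.sum_congr rfl fun c _ => ?_
    rw [Finset.sum_comm]
    exact Finset.sum_congr rfl fun b _ => Finset.sum_congr rfl fun α _ => by ring
  rw [Matrix.of_apply, e1, e3, Matrix.mul_apply, Finset.sum_comm]
  refine Finset.sum_congr rfl fun b _ => ?_
  simp only [Matrix.mul_apply, Matrix.transpose_apply, Matrix.of_apply, ricci, Finset.mul_sum,
    Finset.sum_mul, curv]
  rw [Finset.sum_comm]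
  exact Finset.sum_congr rfl fun c _ => Finset.sum_congr rfl fun m _ => by ring

/-- The second covariant derivative of a scalar is a tensor. -/
lemma hess_law {u : E4 → ℝ} (hu : ContDiffAt ℝ 2 u (φ y)) :
    Matrix.of (fun μ ν => hess G' (fun z => u (φ z)) μ ν y) =
    (jac φ y)ᵀ * Matrix.of (fun μ ν => hess G u μ ν (φ y)) * jac φ y := by
  set J := jac φ y with hJ
  have hJd := h.change.jac_diff hy
  have hφc : ContinuousAt φ y := (h.change.differentiableAt hy).continuousAt
  have hue : ∀ᶠ z in 𝓝 y, DifferentiableAt ℝ u (φ z) ∧ z ∈ Ω' := by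
    have h1 : ∀ᶠ x in 𝓝 (φ y), ContDiffAt ℝ 2 u x := hu.eventually (by simp)
    filter_upwards [hφc.eventually h1, h.change.isOpen.mem_nhds hy] with z hz hz'
    exact ⟨hz.differentiableAt (by norm_num), hz'⟩
  have hud : ∀ a, DifferentiableAt ℝ (pd a u) (φ y) := fun a =>
    (((hu.fderiv_right (m := 1) (by norm_num)).clm_apply contDiffAt_const).differentiableAt
      one_ne_zero)
  have hudφ : ∀ a, DifferentiableAt ℝ (fun z => pd a u (φ z)) y := fun a =>
    (hud a).comp y (h.change.differentiableAt hy)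
  ext μ ν
  have e1 : pd μ (pd ν fun z => u (φ z)) y =
      ∑ a, (pdMat μ (jac φ) y a ν * pd a u (φ y) +
        J a ν * ∑ b, J b μ * pd b (pd a u) (φ y)) := by
    have : pd ν (fun z => u (φ z)) =ᶠ[𝓝 y] fun z => ∑ a, jac φ z a ν * pd a u (φ z) :=
      hue.mono fun z hz => h.change.pd_comp hz.2 hz.1 ν
    rw [pd_congr this, pd_sum _ fun a _ => (hJd a ν).fun_mul (hudφ a)]
    refine Finset.sum_congr rfl fun a _ => ?_
    rw [pd_mul (hJd a ν) (hudφ a), h.change.pd_comp hy (hud a)]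
    rfl
  have e2 : ∑ l, christoffel G' l μ ν y * pd l (fun z => u (φ z)) y =
      ∑ a, (pullConn G φ μ y * J + pdMat μ (jac φ) y) a ν * pd a u (φ y) := by
    rw [← h.conn_law hy]
    have : ∀ l, pd l (fun z => u (φ z)) y = ∑ a, J a l * pd a u (φ y) := fun l =>
      h.change.pd_comp hy (hu.differentiableAt (by norm_num)) l
    simp only [this, Matrix.mul_apply, Finset.mul_sum, Finset.sum_mul]
    rw [Finset.sum_comm]
    refine Finset.sum_congr rfl fun a _ => Finset.sum_congr rfl fun l _ => ?_
    simp only [conn, Matrix.of_apply]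
    ring
  have e3 : ∑ a, (pullConn G φ μ y * J) a ν * pd a u (φ y) =
      ∑ a, ∑ b, J a ν * J b μ * ∑ l, christoffel G l b a (φ y) * pd l u (φ y) := by
    simp only [pullConn, Matrix.sum_apply, Matrix.smul_apply,
      smul_eq_mul, Matrix.mul_apply, conn, Matrix.of_apply, Finset.mul_sum, Finset.sum_mul]
    have hperm : ∀ f : Fin 4 → Fin 4 → Fin 4 → ℝ,
        ∑ l, ∑ b, ∑ a, f l b a = ∑ b, ∑ a, ∑ l, f l b a := by
      intro f
      rw [Finset.sum_comm, Finset.sum_congr rfl fun b _ => Finset.sum_comm]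
    rw [hperm]
    exact Finset.sum_congr rfl fun a _ => Finset.sum_congr rfl fun b _ =>
      Finset.sum_congr rfl fun l _ => by ring
  have e4 : ((jac φ y)ᵀ * Matrix.of (fun μ ν => hess G u μ ν (φ y)) * jac φ y) μ ν =
      ∑ a, ∑ b, J a ν * J b μ * hess G u b a (φ y) := by
    simp only [Matrix.mul_apply, Matrix.transpose_apply, Matrix.of_apply, Finset.sum_mul]
    exact Finset.sum_congr rfl fun a _ => Finset.sum_congr rfl fun b _ => by rw [← hJ]; ring
  rw [← hJ] at e4
  rw [e4, Matrix.of_apply, hess, e1, e2]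
  simp only [Matrix.add_apply, add_mul, Finset.sum_add_distrib, e3, hess, mul_sub,
    Finset.sum_sub_distrib, Finset.mul_sum, mul_assoc]
  ring

lemma localScalar_eq : localScalar G' y = localScalar G (φ y) := by
  have := sum_mul_congruence (h.change.det_ne y hy) (h.ricci_law hy) (h.inv_eq hy)
  simpa only [localScalar, Matrix.of_apply, mul_comm] using this

lemma localBox_eq {u : E4 → ℝ} (hu : ContDiffAt ℝ 2 u (φ y)) :
    localBox G' (fun z => u (φ z)) y = localBox G u (φ y) := by
  have := sum_mul_congruence (h.change.det_ne y hy) (h.hess_law hy hu) (h.inv_eq hy)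
  simpa only [localBox, Matrix.of_apply, mul_comm] using this

end Isometric

/-! ### Tensor laws -/

lemma congruence_apply (J T : Matrix (Fin 4) (Fin 4) ℝ) (μ ν : Fin 4) :
    (Jᵀ * T * J) μ ν = ∑ a, ∑ b, J a μ * J b ν * T a b := by
  simp only [Matrix.mul_apply, Matrix.transpose_apply, Finset.sum_mul]
  rw [Finset.sum_comm]
  exact Finset.sum_congr rfl fun a _ => Finset.sum_congr rfl fun b _ => by ring

namespace Isometric

variable {G' G : E4 → Matrix (Fin 4) (Fin 4) ℝ} {φ : E4 → E4} {Ω' Ω : Set E4}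
  (h : Isometric G' G φ Ω' Ω) {y : E4} (hy : y ∈ Ω')

include h hy

/-- `R_{μν} u - K_{μν} u` is a tensor. -/
lemma ricci_sub_opK_law {u : E4 → ℝ} (hu : ContDiffAt ℝ 2 u (φ y)) :
    Matrix.of (fun μ ν => ricci G' μ ν y * u (φ y) - opK G' (fun z => u (φ z)) μ ν y) =
    (jac φ y)ᵀ * Matrix.of (fun μ ν => ricci G μ ν (φ y) * u (φ y) - opK G u μ ν (φ y))
      * jac φ y := by
  have e : ∀ (H : E4 → Matrix (Fin 4) (Fin 4) ℝ) (f : E4 → ℝ) (a : ℝ) (z : E4),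
      Matrix.of (fun μ ν => ricci H μ ν z * a - opK H f μ ν z) =
      a • Matrix.of (fun μ ν => ricci H μ ν z) - (Matrix.of (fun μ ν => hess H f μ ν z)
        - localBox H f z • H z) := by
    intro H f a z
    ext μ ν
    simp only [opK, Matrix.of_apply, Matrix.sub_apply, Matrix.smul_apply, smul_eq_mul]
    ring
  rw [e, e, h.ricci_law hy, h.hess_law hy hu, h.localBox_eq hy hu, h.pullback y hy]
  simp only [Matrix.mul_sub, Matrix.sub_mul, Matrix.mul_smul, Matrix.smul_mul]

/-- `S_{μν}(A, B)` is a tensor. -/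
lemma tensorS_law {A B : E4 → ℝ} (hA : DifferentiableAt ℝ A (φ y))
    (hB : ContDiffAt ℝ 2 B (φ y)) :
    Matrix.of (fun μ ν => tensorS G' (fun z => A (φ z)) (fun z => B (φ z)) μ ν y) =
    (jac φ y)ᵀ * Matrix.of (fun μ ν => tensorS G A B μ ν (φ y)) * jac φ y := by
  have e : ∀ (H : E4 → Matrix (Fin 4) (Fin 4) ℝ) (f k : E4 → ℝ) (z : E4),
      Matrix.of (fun μ ν => tensorS H f k μ ν z) =
      ((∑ α, ∑ β, (Matrix.of fun μ ν => pd μ f z * pd ν k z) α β * (H z)⁻¹ α β)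
        + f z * localBox H k z) • H z
      - (2 : ℝ) • Matrix.of (fun μ ν => pd μ f z * pd ν k z) := by
    intro H f k z
    have : ∑ α, ∑ β, (H z)⁻¹ α β * pd α f z * pd β k z =
        ∑ α, ∑ β, (Matrix.of fun μ ν => pd μ f z * pd ν k z) α β * (H z)⁻¹ α β :=
      Finset.sum_congr rfl fun α _ => Finset.sum_congr rfl fun β _ => by
        rw [Matrix.of_apply]; ring
    ext μ ν
    simp only [tensorS, this, Matrix.sub_apply, Matrix.smul_apply, smul_eq_mul]
    simp only [Matrix.of_apply]
    ring
  have hT : Matrix.of (fun μ ν => pd μ (fun z => A (φ z)) y * pd ν (fun z => B (φ z)) y) =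
      (jac φ y)ᵀ * Matrix.of (fun μ ν => pd μ A (φ y) * pd ν B (φ y)) * jac φ y := by
    ext μ ν
    rw [congruence_apply, Matrix.of_apply, h.change.pd_comp hy hA,
      h.change.pd_comp hy (hB.differentiableAt (by norm_num)), Finset.sum_mul_sum]
    exact Finset.sum_congr rfl fun a _ => Finset.sum_congr rfl fun b _ => by
      rw [Matrix.of_apply]; ring
  rw [e, e, sum_mul_congruence (h.change.det_ne y hy) hT (h.inv_eq hy), hT, h.localBox_eq hy hB,
    h.pullback y hy]
  simp only [Matrix.mul_sub, Matrix.sub_mul, Matrix.mul_smul, Matrix.smul_mul]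

end Isometric

/-- `δg^{μν}` is a contravariant tensor. -/
lemma dInv_law {G' G : ℝ → E4 → Matrix (Fin 4) (Fin 4) ℝ} {φ : E4 → E4} {Ω' Ω : Set E4} {r : ℝ}
    (hG : MetricFamily G r Ω) (h : ∀ ε ∈ Ioo (-r) r, Isometric (G' ε) (G ε) φ Ω' Ω)
    {y : E4} (hy : y ∈ Ω') :
    Matrix.of (fun μ ν => dInv G' μ ν y) =
      (jac φ y)⁻¹ * Matrix.of (fun μ ν => dInv G μ ν (φ y)) * ((jac φ y)⁻¹)ᵀ := by
  have hφy : φ y ∈ Ω := (h 0 hG.zero_mem).mapsTo hy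
  set K := (jac φ y)⁻¹ with hK
  have happ : ∀ (T : Matrix (Fin 4) (Fin 4) ℝ) (μ ν : Fin 4),
      (K * T * Kᵀ) μ ν = ∑ a, ∑ b, K μ a * K ν b * T a b := by
    intro T μ ν
    simpa using congruence_apply Kᵀ T μ ν
  ext μ ν
  rw [happ, Matrix.of_apply]
  have h1 : HasDerivAt (fun ε => ∑ a, ∑ b, K μ a * K ν b * (G ε (φ y))⁻¹ a b)
      (∑ a, ∑ b, K μ a * K ν b * dInv G a b (φ y)) 0 :=
    HasDerivAt.fun_sum fun a _ => HasDerivAt.fun_sum fun b _ =>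
      (hG.hasDerivAt_inv hφy a b).const_mul _
  refine (h1.congr_of_eventuallyEq ?_).deriv
  filter_upwards [isOpen_Ioo.mem_nhds hG.zero_mem] with ε hε
  rw [(h ε hε).inv_eq hy, happ]

/-! ### Integrals of compactly supported divergences -/

section Integration

/-- A function that is `C^n` on an open set and vanishes off a compact subset of it extends by zero
to a `C^n` function. -/
lemma contDiff_indicator {n : WithTop ℕ∞} {Ω C : Set E4} (hΩ : IsOpen Ω) (hC : IsCompact C)
    (hCΩ : C ⊆ Ω) {f : E4 → ℝ} (hf : ContDiffOn ℝ n f Ω) (h0 : ∀ y ∈ Ω, y ∉ C → f y = 0) :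
    ContDiff ℝ n (Ω.indicator f) := by
  rw [contDiff_iff_contDiffAt]
  intro y
  by_cases hy : y ∈ Ω
  · refine (hf.contDiffAt (hΩ.mem_nhds hy)).congr_of_eventuallyEq ?_
    filter_upwards [hΩ.mem_nhds hy] with z hz using indicator_of_mem hz f
  · refine (contDiffAt_const (c := (0 : ℝ))).congr_of_eventuallyEq ?_
    have : Cᶜ ∈ 𝓝 y := hC.isClosed.isOpen_compl.mem_nhds fun h => hy (hCΩ h)
    filter_upwards [this] with z hz
    by_cases hzΩ : z ∈ Ω
    · rw [indicator_of_mem hzΩ, h0 z hzΩ hz]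
    · exact indicator_of_notMem hzΩ f

lemma hasCompactSupport_indicator {Ω C : Set E4} (hC : IsCompact C) {f : E4 → ℝ}
    (h0 : ∀ y ∈ Ω, y ∉ C → f y = 0) : HasCompactSupport (Ω.indicator f) :=
  HasCompactSupport.intro hC fun y hy => by
    by_cases hyΩ : y ∈ Ω
    · rw [indicator_of_mem hyΩ, h0 y hyΩ hy]
    · exact indicator_of_notMem hyΩ f

lemma integrableOn_of_compact {Ω C : Set E4} (hΩ : IsOpen Ω) (hC : IsCompact C)
    (hCΩ : C ⊆ Ω) {f : E4 → ℝ} (hf : ContinuousOn f Ω) (h0 : ∀ y ∈ Ω, y ∉ C → f y = 0) :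
    IntegrableOn f Ω := by
  rw [← integrable_indicator_iff hΩ.measurableSet]
  have hc := (contDiff_indicator hΩ hC hCΩ (contDiffOn_zero.2 hf) h0).continuous
  exact hc.integrable_of_hasCompactSupport (hasCompactSupport_indicator hC h0)

/-- The integral of a partial derivative of a compactly supported `C¹` function vanishes. -/
lemma integral_pd_eq_zero {Ω C : Set E4} (hΩ : IsOpen Ω) (hC : IsCompact C)
    (hCΩ : C ⊆ Ω) {f : E4 → ℝ} (hf : ContDiffOn ℝ 1 f Ω) (h0 : ∀ y ∈ Ω, y ∉ C → f y = 0)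
    (i : Fin 4) : IntegrableOn (pd i f) Ω ∧ ∫ y in Ω, pd i f y = 0 := by
  set F := Ω.indicator f with hF
  have hF1 : ContDiff ℝ 1 F := contDiff_indicator hΩ hC hCΩ hf h0
  have hFc : HasCompactSupport F := hasCompactSupport_indicator hC h0
  have hpdF : Continuous (pd i F) :=
    (hF1.continuous_fderiv one_ne_zero).clm_apply continuous_const
  have hpdc : HasCompactSupport (pd i F) := by
    refine (hFc.fderiv (𝕜 := ℝ)).mono fun y hy => ?_
    rw [Function.mem_support] at hy ⊢
    intro h
    exact hy (by rw [pd, h]; rfl)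
  have hint : Integrable (pd i F) := hpdF.integrable_of_hasCompactSupport hpdc
  have hEq : EqOn (pd i F) (pd i f) Ω := fun y hy => pd_congr (by
    filter_upwards [hΩ.mem_nhds hy] with z hz using indicator_of_mem hz f) i
  have hz : ∀ y, y ∉ Ω → pd i F y = 0 := fun y hy => by
    have : F =ᶠ[𝓝 y] fun _ => 0 := by
      have : Cᶜ ∈ 𝓝 y := hC.isClosed.isOpen_compl.mem_nhds fun h => hy (hCΩ h)
      filter_upwards [this] with z hz
      by_cases hzΩ : z ∈ Ω
      · rw [hF, indicator_of_mem hzΩ, h0 z hzΩ hz]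
      · exact indicator_of_notMem hzΩ f
    rw [pd_congr this, pd_const]
  refine ⟨hint.integrableOn.congr_fun hEq hΩ.measurableSet, ?_⟩
  rw [← setIntegral_congr_fun hΩ.measurableSet hEq, setIntegral_eq_integral_of_forall_compl_eq_zero
    hz]
  -- integration by parts against the constant function `1`
  have := integral_mul_fderiv_eq_neg_fderiv_mul_of_integrable (μ := (volume : Measure E4))
    (f := fun _ : E4 => (1 : ℝ)) (g := F) (v := EuclideanSpace.single i (1 : ℝ))
    (by simp) (by simp only [one_mul]; exact hint)
    (by simpa using hF1.continuous.integrable_of_hasCompactSupport hFc)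
    (fun _ _ => differentiableAt_const _)
    (fun _ _ => (hF1.differentiable one_ne_zero).differentiableAt)
  simpa [pd] using this

lemma integral_div_eq_zero {Ω C : Set E4} (hΩ : IsOpen Ω) (hC : IsCompact C)
    (hCΩ : C ⊆ Ω) {W : Fin 4 → E4 → ℝ} (hW : ∀ i, ContDiffOn ℝ 1 (W i) Ω)
    (h0 : ∀ i, ∀ y ∈ Ω, y ∉ C → W i y = 0) : ∫ y in Ω, ∑ i, pd i (W i) y = 0 := by
  rw [integral_finsetSum _ fun i _ => (integral_pd_eq_zero hΩ hC hCΩ (hW i) (h0 i) i).1]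
  exact Finset.sum_eq_zero fun i _ => (integral_pd_eq_zero hΩ hC hCΩ (hW i) (h0 i) i).2

end Integration

/-! ### Scalars, tensors and densities in the charts of a manifold -/

section Charts

variable {M : Type*} [TopologicalSpace M] [ChartedSpace E4 M]

/-- The transition map from the chart at `c` to the chart at `c'`. -/
def transition (c c' : M) (y : E4) : E4 :=
  extChartAt (𝓡 4) c' ((extChartAt (𝓡 4) c).symm y)

/-- The domain of the transition map from the chart at `c` to the chart at `c'`. -/
def overlap (c c' : M) : Set E4 :=
  (extChartAt (𝓡 4) c).target ∩ (extChartAt (𝓡 4) c).symm ⁻¹' (extChartAt (𝓡 4) c').source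

lemma isOpen_target (c : M) : IsOpen (extChartAt (𝓡 4) c).target := isOpen_extChartAt_target c

lemma isOpen_overlap (c c' : M) : IsOpen (overlap c c') :=
  (continuousOn_extChartAt_symm c).isOpen_inter_preimage (isOpen_target c)
    (isOpen_extChartAt_source c')

lemma transition_mem {c c' : M} {y : E4} (hy : y ∈ overlap c c') :
    transition c c' y ∈ (extChartAt (𝓡 4) c').target :=
  (extChartAt (𝓡 4) c').map_source hy.2

lemma symm_transition {c c' : M} {y : E4} (hy : y ∈ overlap c c') :
    (extChartAt (𝓡 4) c').symm (transition c c' y) = (extChartAt (𝓡 4) c).symm y :=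
  (extChartAt (𝓡 4) c').left_inv hy.2

lemma transition_mem_overlap {c c' : M} {y : E4} (hy : y ∈ overlap c c') :
    transition c c' y ∈ overlap c' c :=
  ⟨transition_mem hy, by
    rw [mem_preimage, symm_transition hy]; exact (extChartAt (𝓡 4) c).map_target hy.1⟩

lemma transition_transition {c c' : M} {y : E4} (hy : y ∈ overlap c c') :
    transition c' c (transition c c' y) = y := by
  rw [transition, symm_transition hy]; exact (extChartAt (𝓡 4) c).right_inv hy.1

lemma mem_overlap_self {c : M} {y : E4} (hy : y ∈ (extChartAt (𝓡 4) c).target) :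
    y ∈ overlap c ((extChartAt (𝓡 4) c).symm y) :=
  ⟨hy, mem_extChartAt_source _⟩

variable [IsManifold (𝓡 4) ∞ M]

lemma transition_smooth (c c' : M) : ContDiffOn ℝ ∞ (transition c c') (overlap c c') := by
  have h := contDiffOn_ext_coord_change (I := 𝓡 4) (n := ∞) c' c
  exact h

lemma transition_diff {c c' : M} {y : E4} (hy : y ∈ overlap c c') :
    DifferentiableAt ℝ (transition c c') y :=
  ((transition_smooth c c').contDiffAt ((isOpen_overlap c c').mem_nhds hy)).differentiableAt
    (by simp)

lemma mdifferentiableAt_symm {c : M} {y : E4} (hy : y ∈ (extChartAt (𝓡 4) c).target) :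
    MDifferentiableAt 𝓘(ℝ, E4) (𝓡 4) (extChartAt (𝓡 4) c).symm y :=
  ((contMDiffOn_extChartAt_symm (I := 𝓡 4) (n := ∞) c).contMDiffAt
    ((isOpen_target c).mem_nhds hy)).mdifferentiableAt (by simp)

lemma coordVector_transition {c c' : M} {y : E4} (hy : y ∈ overlap c c') (i : Fin 4) :
    (coordVector c i y : E4) =
      ∑ a, jac (transition c c') y a i • (coordVector c' a (transition c c' y) : E4) := by
  have h1 : (extChartAt (𝓡 4) c).symm =ᶠ[𝓝 y]
      (extChartAt (𝓡 4) c').symm ∘ transition c c' := by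
    filter_upwards [(isOpen_overlap c c').mem_nhds hy] with z hz using (symm_transition hz).symm
  have h2 : MDifferentiableAt 𝓘(ℝ, E4) 𝓘(ℝ, E4) (transition c c') y :=
    (transition_diff hy).mdifferentiableAt
  have h3 := mfderiv_comp y (mdifferentiableAt_symm (transition_mem hy)) h2
  have h4 : ∀ v : E4, (mfderiv 𝓘(ℝ, E4) (𝓡 4) (extChartAt (𝓡 4) c).symm y v : E4) =
      (mfderiv 𝓘(ℝ, E4) (𝓡 4) ((extChartAt (𝓡 4) c').symm ∘ transition c c') y v : E4) := by
    intro v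
    have := h1.mfderiv_eq (I := 𝓘(ℝ, E4)) (I' := 𝓡 4)
    exact DFunLike.congr_fun this v
  have h5 : (coordVector c i y : E4) = (mfderiv 𝓘(ℝ, E4) (𝓡 4) (extChartAt (𝓡 4) c').symm
      (transition c c' y) (fderiv ℝ (transition c c') y (EuclideanSpace.single i 1)) : E4) := by
    refine (h4 _).trans ?_
    rw [h3, mfderiv_eq_fderiv]
    rfl
  rw [h5, fderiv_single_eq (transition_diff hy)]
  exact (map_sum (mfderiv 𝓘(ℝ, E4) (𝓡 4) (extChartAt (𝓡 4) c').symm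
      (transition c c' y) : E4 →L[ℝ] E4) _ _).trans
    (Finset.sum_congr rfl fun a _ => map_smul (mfderiv 𝓘(ℝ, E4) (𝓡 4)
      (extChartAt (𝓡 4) c').symm (transition c c' y) : E4 →L[ℝ] E4) _ _)

lemma comp_transition (g : BilinField M) {c c' : M} {y : E4} (hy : y ∈ overlap c c') :
    comp g c y = (jac (transition c c') y)ᵀ * comp g c' (transition c c' y) *
      jac (transition c c') y := by
  set b : M → E4 →L[ℝ] E4 →L[ℝ] ℝ := fun x => g x with hb
  have hcomp : ∀ (c : M) (y : E4) (i j : Fin 4), comp g c y i j =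
      b ((extChartAt (𝓡 4) c).symm y) (coordVector c i y : E4) (coordVector c j y : E4) :=
    fun _ _ _ _ => rfl
  have hsum : ∀ (B : E4 →L[ℝ] E4 →L[ℝ] ℝ) (w : Fin 4 → E4) (p q : Fin 4 → ℝ),
      B (∑ a, p a • w a) (∑ k, q k • w k) = ∑ a, ∑ k, p a * q k * B (w a) (w k) := by
    intro B w p q
    simp only [map_sum, map_smul, _root_.sum_apply, _root_.smul_apply, smul_eq_mul,
      Finset.mul_sum]
    rw [Finset.sum_comm]
    exact Finset.sum_congr rfl fun a _ => Finset.sum_congr rfl fun k _ => by ring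
  ext i j
  rw [congruence_apply, hcomp, coordVector_transition hy i, coordVector_transition hy j,
    ← symm_transition hy]
  exact hsum _ _ _ _

end Charts

lemma LocalMetric.mono {G : E4 → Matrix (Fin 4) (Fin 4) ℝ} {Ω Ω' : Set E4}
    (hG : LocalMetric G Ω) (hΩ' : IsOpen Ω') (h : Ω' ⊆ Ω) : LocalMetric G Ω' where
  isOpen := hΩ'
  smooth i j := (hG.smooth i j).mono h
  symm y hy := hG.symm y (h hy)
  det_neg y hy := hG.det_neg y (h hy)

lemma hess_congr (G : E4 → Matrix (Fin 4) (Fin 4) ℝ) {u v : E4 → ℝ} {y : E4} (h : u =ᶠ[𝓝 y] v)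
    (μ ν : Fin 4) : hess G u μ ν y = hess G v μ ν y := by
  simp only [hess, pd_congr (pd_eventuallyEq h ν) μ, pd_congr h]

lemma localBox_congr (G : E4 → Matrix (Fin 4) (Fin 4) ℝ) {u v : E4 → ℝ} {y : E4}
    (h : u =ᶠ[𝓝 y] v) : localBox G u y = localBox G v y := by
  simp only [localBox, hess_congr G h]

lemma opK_congr (G : E4 → Matrix (Fin 4) (Fin 4) ℝ) {u v : E4 → ℝ} {y : E4}
    (h : u =ᶠ[𝓝 y] v) (μ ν : Fin 4) : opK G u μ ν y = opK G v μ ν y := by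
  simp only [opK, hess_congr G h, localBox_congr G h]

lemma tensorS_congr (G : E4 → Matrix (Fin 4) (Fin 4) ℝ) {u v u' v' : E4 → ℝ} {y : E4}
    (h : u =ᶠ[𝓝 y] v) (h' : u' =ᶠ[𝓝 y] v') (μ ν : Fin 4) :
    tensorS G u u' μ ν y = tensorS G v v' μ ν y := by
  simp only [tensorS, localBox_congr G h', pd_congr h, pd_congr h', h.self_of_nhds]

section Metrics

variable {M : Type*} [TopologicalSpace M] [ChartedSpace E4 M]

/-- A scalar function that is `C^n` in every chart. -/
def ChartContDiff (n : WithTop ℕ∞) (u : M → ℝ) : Prop :=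
  ∀ c : M, ContDiffOn ℝ n (u ∘ (extChartAt (𝓡 4) c).symm) (extChartAt (𝓡 4) c).target

/-- A density that transforms with the absolute value of the Jacobian determinant. -/
def CovariantDensity (D : M → E4 → ℝ) : Prop :=
  ∀ c c' : M, ∀ y ∈ overlap c c',
    D c y = |(jac (transition c c') y).det| * D c' (transition c c' y)

lemma ChartContDiff.contDiffAt {n : WithTop ℕ∞} {u : M → ℝ} (hu : ChartContDiff n u) {c : M}
    {y : E4} (hy : y ∈ (extChartAt (𝓡 4) c).target) :
    ContDiffAt ℝ n (u ∘ (extChartAt (𝓡 4) c).symm) y :=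
  (hu c).contDiffAt ((isOpen_target c).mem_nhds hy)

lemma ChartContDiff.of_le {m n : WithTop ℕ∞} {u : M → ℝ} (hu : ChartContDiff n u) (h : m ≤ n) :
    ChartContDiff m u := fun c => (hu c).of_le h

lemma ChartContDiff.continuous {n : WithTop ℕ∞} {u : M → ℝ} (hu : ChartContDiff n u) :
    Continuous u := by
  rw [continuous_iff_continuousAt]
  intro x
  have h1 : ContinuousAt (u ∘ (extChartAt (𝓡 4) x).symm) (extChartAt (𝓡 4) x x) :=
    (hu.contDiffAt (mem_extChartAt_target x)).continuousAt
  have h2 : ContinuousAt (extChartAt (𝓡 4) x) x := continuousAt_extChartAt x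
  refine (h1.comp h2).congr ?_
  filter_upwards [extChartAt_source_mem_nhds (I := 𝓡 4) x] with z hz
  simp only [Function.comp_apply, (extChartAt (𝓡 4) x).left_inv hz]

lemma IsLorentzMetric.localMetric {g : BilinField M} (hg : IsLorentzMetric g) (c : M) :
    LocalMetric (comp g c) (extChartAt (𝓡 4) c).target where
  isOpen := isOpen_target c
  smooth := hg.smooth c
  symm _ _ _ _ := hg.symm _ _ _
  det_neg := hg.det_neg c

variable [IsManifold (𝓡 4) ∞ M]

lemma chartContDiff_of_contMDiff {n : WithTop ℕ∞} (hn : n ≤ ∞) {u : M → ℝ}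
    (hu : ContMDiff (𝓡 4) 𝓘(ℝ, ℝ) n u) : ChartContDiff n u := fun c =>
  (hu.comp_contMDiffOn ((contMDiffOn_extChartAt_symm (I := 𝓡 4) (n := ∞) c).of_le hn)).contDiffOn

lemma IsLorentzMetric.isometric {g : BilinField M} (hg : IsLorentzMetric g) (c c' : M) :
    Isometric (comp g c) (comp g c') (transition c c') (overlap c c')
      (extChartAt (𝓡 4) c').target where
  left := (hg.localMetric c).mono (isOpen_overlap c c') inter_subset_left
  right := hg.localMetric c'
  change :=
    { isOpen := isOpen_overlap c c'
      smooth := transition_smooth c c'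
      mapsTo := fun _ hy => transition_mem hy
      det_ne := fun y hy h0 => by
        have h1 := hg.det_neg c y hy.1
        rw [comp_transition g hy, Matrix.det_mul, h0, mul_zero] at h1
        exact lt_irrefl _ h1 }
  pullback _ hy := comp_transition g hy

omit [IsManifold (𝓡 4) ∞ M] in
lemma comp_symm_eventuallyEq (u : M → ℝ) {c c' : M} {y : E4} (hy : y ∈ overlap c c') :
    u ∘ (extChartAt (𝓡 4) c).symm =ᶠ[𝓝 y]
      fun z => (u ∘ (extChartAt (𝓡 4) c').symm) (transition c c' z) := by
  filter_upwards [(isOpen_overlap c c').mem_nhds hy] with z hz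
  simp only [Function.comp_apply, symm_transition hz]

/-- The scalar curvature can be computed in any chart. -/
lemma scalarCurv_symm {g : BilinField M} (hg : IsLorentzMetric g) {c : M} {y : E4}
    (hy : y ∈ (extChartAt (𝓡 4) c).target) :
    scalarCurv g ((extChartAt (𝓡 4) c).symm y) = localScalar (comp g c) y :=
  ((hg.isometric c _).localScalar_eq (mem_overlap_self hy)).symm

/-- The d'Alembertian can be computed in any chart. -/
lemma box_symm {g : BilinField M} (hg : IsLorentzMetric g) {u : M → ℝ} (hu : ChartContDiff 2 u)
    {c : M} {y : E4} (hy : y ∈ (extChartAt (𝓡 4) c).target) :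
    box g u ((extChartAt (𝓡 4) c).symm y) =
      localBox (comp g c) (u ∘ (extChartAt (𝓡 4) c).symm) y := by
  have hy' := mem_overlap_self hy
  rw [localBox_congr _ (comp_symm_eventuallyEq u hy'),
    (hg.isometric c _).localBox_eq hy' (hu.contDiffAt (transition_mem hy'))]
  rfl

lemma sqrtNegDet_covariant {g : BilinField M} (hg : IsLorentzMetric g) :
    CovariantDensity (sqrtNegDet g) := fun c c' _ hy => (hg.isometric c c').vol_eq hy

lemma scalarDensity_covariant {g : BilinField M} (hg : IsLorentzMetric g) (u : M → ℝ) :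
    CovariantDensity (scalarDensity g u) := fun c c' y hy => by
  rw [scalarDensity, scalarDensity, symm_transition hy, sqrtNegDet_covariant hg c c' y hy]
  ring

end Metrics

section Variations

variable {M : Type*} [TopologicalSpace M] [ChartedSpace E4 M]

lemma IsVariation.metricFamily {g : BilinField M} {γ : ℝ → BilinField M} {r : ℝ}
    (hγ : IsVariation g γ r) (c : M) :
    MetricFamily (fun ε => comp (γ ε) c) r (extChartAt (𝓡 4) c).target where
  pos := hγ.pos
  isOpen := isOpen_target c
  smooth := hγ.smooth c
  symm ε hε _ _ _ _ := (hγ.metric ε hε).symm _ _ _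
  det_neg ε hε := (hγ.metric ε hε).det_neg c

lemma IsVariation.zero_mem {g : BilinField M} {γ : ℝ → BilinField M} {r : ℝ}
    (hγ : IsVariation g γ r) : (0 : ℝ) ∈ Ioo (-r) r := ⟨by linarith [hγ.pos], hγ.pos⟩

lemma IsVariation.metric_zero {g : BilinField M} {γ : ℝ → BilinField M} {r : ℝ}
    (hγ : IsVariation g γ r) : IsLorentzMetric g := hγ.zero ▸ hγ.metric 0 hγ.zero_mem

lemma IsVariation.mono {g : BilinField M} {γ : ℝ → BilinField M} {r r' : ℝ}
    (hγ : IsVariation g γ r) (h0 : 0 < r') (h : r' ≤ r) : IsVariation g γ r' := by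
  have hsub : Ioo (-r') r' ⊆ Ioo (-r) r := Ioo_subset_Ioo (by linarith) h
  obtain ⟨K, hK, hKγ⟩ := hγ.compact_support
  exact ⟨h0, hγ.zero, fun ε hε => hγ.metric ε (hsub hε), fun c i j =>
    (hγ.smooth c i j).mono (prod_mono hsub le_rfl), K, hK, fun ε hε => hKγ ε (hsub hε)⟩

variable [IsManifold (𝓡 4) ∞ M]

/-- The full contraction of a covariant two-tensor with `δg^{μν}` is a density. -/
lemma pairingDensity_covariant {g : BilinField M} {γ : ℝ → BilinField M} {r : ℝ}
    (hγ : IsVariation g γ r) {T : M → Fin 4 → Fin 4 → E4 → ℝ}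
    (hT : ∀ c c' : M, ∀ y ∈ overlap c c', Matrix.of (fun μ ν => T c μ ν y) =
      (jac (transition c c') y)ᵀ * Matrix.of (fun μ ν => T c' μ ν (transition c c' y)) *
        jac (transition c c') y) :
    CovariantDensity (pairingDensity g γ T) := fun c c' y hy => by
  have h1 := dInv_law (hγ.metricFamily c') (fun ε hε => (hγ.metric ε hε).isometric c c') hy
  have h2 := sum_mul_congruence ((hγ.metric_zero.isometric c c').change.det_ne y hy)
    (hT c c' y hy) h1
  have h3 : ∀ (c : M) (y : E4), pairingDensity g γ T c y =
      (∑ μ, ∑ ν, (Matrix.of fun μ ν => T c μ ν y) μ ν *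
        (Matrix.of fun μ ν => dInv (fun ε => comp (γ ε) c) μ ν y) μ ν) * sqrtNegDet g c y :=
    fun _ _ => rfl
  rw [h3, h3, h2, sqrtNegDet_covariant hγ.metric_zero c c' y hy]
  ring

lemma ricciMinusK_law {g : BilinField M} (hg : IsLorentzMetric g) {u : M → ℝ}
    (hu : ChartContDiff 2 u) (c c' : M) (y : E4) (hy : y ∈ overlap c c') :
    Matrix.of (fun μ ν => ricciMinusK g u c μ ν y) =
      (jac (transition c c') y)ᵀ * Matrix.of (fun μ ν => ricciMinusK g u c' μ ν (transition c c' y))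
        * jac (transition c c') y := by
  have h := (hg.isometric c c').ricci_sub_opK_law hy (hu.contDiffAt (transition_mem hy))
  have e := comp_symm_eventuallyEq u hy
  refine Eq.trans ?_ h
  ext μ ν
  simp only [Matrix.of_apply, ricciMinusK]
  rw [opK_congr _ e, Function.comp_apply, symm_transition hy]

lemma fieldS_law {g : BilinField M} (hg : IsLorentzMetric g) {A B : M → ℝ}
    (hA : ChartContDiff 2 A) (hB : ChartContDiff 2 B) (c c' : M) (y : E4)
    (hy : y ∈ overlap c c') :
    Matrix.of (fun μ ν => fieldS g A B c μ ν y) =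
      (jac (transition c c') y)ᵀ * Matrix.of (fun μ ν => fieldS g A B c' μ ν (transition c c' y))
        * jac (transition c c') y := by
  have h := (hg.isometric c c').tensorS_law hy
    ((hA.contDiffAt (transition_mem hy)).differentiableAt (by norm_num))
    (hB.contDiffAt (transition_mem hy))
  refine Eq.trans ?_ h
  ext μ ν
  simp only [Matrix.of_apply, fieldS]
  exact tensorS_congr _ (comp_symm_eventuallyEq A hy) (comp_symm_eventuallyEq B hy) μ ν

end Variations

/-! ### Integrals of densities -/

section Integrals

variable {M : Type*} [TopologicalSpace M] [ChartedSpace E4 M]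

/-- The density `D` vanishes off the set `K`. -/
def DensitySupported (D : M → E4 → ℝ) (K : Set M) : Prop :=
  ∀ c : M, ∀ y ∈ (extChartAt (𝓡 4) c).target, (extChartAt (𝓡 4) c).symm y ∉ K → D c y = 0

/-- The density `D` is continuous in every chart. -/
def DensityContinuous (D : M → E4 → ℝ) : Prop :=
  ∀ c : M, ContinuousOn (D c) (extChartAt (𝓡 4) c).target

variable [IsManifold (𝓡 4) ∞ M] [T2Space M] [SigmaCompactSpace M]

lemma atlasPartition_tsupport (c : M) :
    tsupport (atlasPartition M c) ⊆ (extChartAt (𝓡 4) c).source := by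
  rw [extChartAt_source]
  exact (SmoothPartitionOfUnity.exists_isSubordinate_chartAt_source (𝓡 4) M).choose_spec c

lemma atlasPartition_finite {K : Set M} (hK : IsCompact K) :
    {c : M | (tsupport (atlasPartition M c) ∩ K).Nonempty}.Finite :=
  (atlasPartition M).locallyFinite.closure.finite_nonempty_inter_compact hK

/-- The finitely many indices whose functions in the partition of unity matter on the compact
set `K`. -/
def activeCharts {K : Set M} (hK : IsCompact K) : Finset M := (atlasPartition_finite hK).toFinset

lemma mem_activeCharts {K : Set M} (hK : IsCompact K) {c x : M} (hx : x ∈ K)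
    (hc : x ∈ tsupport (atlasPartition M c)) : c ∈ activeCharts hK :=
  (atlasPartition_finite hK).mem_toFinset.2 ⟨x, hc, hx⟩

lemma sum_activeCharts_eventually {K : Set M} (hK : IsCompact K) {x : M} (hx : x ∈ K) :
    ∀ᶠ z in 𝓝 x, ∑ c ∈ activeCharts hK, atlasPartition M c z = 1 := by
  filter_upwards [(atlasPartition M).eventually_finsupport_subset x] with z hz
  refine (atlasPartition M).sum_finsupport' z (mem_univ z) (hz.trans fun c hc => ?_)
  exact mem_activeCharts hK hx (((atlasPartition M).mem_fintsupport_iff x c).1 hc)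

lemma chartContDiff_atlasPartition (c : M) : ChartContDiff ∞ (atlasPartition M c) :=
  chartContDiff_of_contMDiff le_rfl (atlasPartition M c).contMDiff

/-- The image of `K ∩ tsupport ψ_c` in the chart at `c`. -/
lemma isCompact_chart_image {K : Set M} (hK : IsCompact K) (c : M) :
    IsCompact (extChartAt (𝓡 4) c '' (tsupport (atlasPartition M c) ∩ K)) :=
  (hK.inter_left (isClosed_tsupport _)).image_of_continuousOn
    ((continuousOn_extChartAt c).mono (inter_subset_left.trans (atlasPartition_tsupport c)))

omit [IsManifold (𝓡 4) ∞ M] [T2Space M] [SigmaCompactSpace M] in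
lemma chart_image_subset {s : Set M} {c : M} (hs : s ⊆ (extChartAt (𝓡 4) c).source) :
    extChartAt (𝓡 4) c '' s ⊆ (extChartAt (𝓡 4) c).target := by
  rintro _ ⟨x, hx, rfl⟩
  exact (extChartAt (𝓡 4) c).map_source (hs hx)

omit [IsManifold (𝓡 4) ∞ M] [T2Space M] [SigmaCompactSpace M] in
lemma symm_notMem_of_notMem_image {s : Set M} {c : M} {y : E4}
    (hy : y ∈ (extChartAt (𝓡 4) c).target) (h : y ∉ extChartAt (𝓡 4) c '' s) :
    (extChartAt (𝓡 4) c).symm y ∉ s := fun hs =>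
  h ⟨_, hs, (extChartAt (𝓡 4) c).right_inv hy⟩

lemma densityPiece_eq_zero {D : M → E4 → ℝ} {K : Set M} (hD : DensitySupported D K) {c : M}
    {y : E4} (hy : y ∈ (extChartAt (𝓡 4) c).target)
    (h : (extChartAt (𝓡 4) c).symm y ∉ tsupport (atlasPartition M c) ∩ K) :
    densityPiece D c y = 0 := by
  rw [densityPiece]
  by_cases h1 : (extChartAt (𝓡 4) c).symm y ∈ K
  · rw [image_eq_zero_of_notMem_tsupport fun h2 => h ⟨h2, h1⟩, zero_mul]
  · rw [hD c y hy h1, mul_zero]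

lemma densityPiece_eq_zero_of_notMem {D : M → E4 → ℝ} {K : Set M} (hK : IsCompact K)
    (hD : DensitySupported D K) {c : M} (hc : c ∉ activeCharts hK) {y : E4}
    (hy : y ∈ (extChartAt (𝓡 4) c).target) : densityPiece D c y = 0 :=
  densityPiece_eq_zero hD hy fun h => hc (mem_activeCharts hK h.2 h.1)

lemma densityPiece_continuousOn {D : M → E4 → ℝ} (hD : DensityContinuous D) (c : M) :
    ContinuousOn (densityPiece D c) (extChartAt (𝓡 4) c).target :=
  ((chartContDiff_atlasPartition c) c).continuousOn.mul (hD c)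

lemma densityIntegrable_of_compact {D : M → E4 → ℝ} {K : Set M} (hK : IsCompact K)
    (hD : DensityContinuous D) (hDK : DensitySupported D K) : DensityIntegrable D := by
  refine ⟨(activeCharts hK).finite_toSet.subset ?_, fun c => ?_⟩
  · rintro c ⟨y, hy, hne⟩
    by_contra hc
    exact hne (densityPiece_eq_zero_of_notMem hK hDK hc hy)
  · refine integrableOn_of_compact (isOpen_target c) (isCompact_chart_image hK c)
      (chart_image_subset (inter_subset_left.trans (atlasPartition_tsupport c)))
      (densityPiece_continuousOn hD c) fun y hy h => ?_
    exact densityPiece_eq_zero hDK hy (symm_notMem_of_notMem_image hy h)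

lemma densityIntegral_eq_sum {D : M → E4 → ℝ} {K : Set M} (hK : IsCompact K)
    (hD : DensitySupported D K) : densityIntegral D =
      ∑ c ∈ activeCharts hK, ∫ y in (extChartAt (𝓡 4) c).target, densityPiece D c y := by
  refine finsum_eq_sum_of_support_subset _ fun c hc => ?_
  by_contra h
  exact hc (setIntegral_eq_zero_of_forall_eq_zero fun y hy =>
    densityPiece_eq_zero_of_notMem hK hD h hy)

lemma densityIntegral_congr {D D' : M → E4 → ℝ}
    (h : ∀ c, ∀ y ∈ (extChartAt (𝓡 4) c).target, D c y = D' c y) :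
    densityIntegral D = densityIntegral D' :=
  finsum_congr fun c => setIntegral_congr_fun (isOpen_target c).measurableSet fun y hy => by
    rw [densityPiece, densityPiece, h c y hy]

lemma densityIntegral_add {D D' : M → E4 → ℝ} {K : Set M} (hK : IsCompact K)
    (hD : DensityContinuous D) (hDK : DensitySupported D K)
    (hD' : DensityContinuous D') (hDK' : DensitySupported D' K) :
    densityIntegral (fun c y => D c y + D' c y) = densityIntegral D + densityIntegral D' := by
  rw [densityIntegral_eq_sum hK hDK, densityIntegral_eq_sum hK hDK',
    densityIntegral_eq_sum (D := fun c y => D c y + D' c y) hK fun c y hy h => by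
      simp only [hDK c y hy h, hDK' c y hy h, add_zero], ← Finset.sum_add_distrib]
  refine Finset.sum_congr rfl fun c _ => ?_
  rw [← integral_add ((densityIntegrable_of_compact hK hD hDK).2 c)
    ((densityIntegrable_of_compact hK hD' hDK').2 c)]
  simp only [densityPiece, mul_add]

omit [IsManifold (𝓡 4) ∞ M] [T2Space M] [SigmaCompactSpace M] in
lemma DensityContinuous.const_mul {D : M → E4 → ℝ} (hD : DensityContinuous D) (a : ℝ) :
    DensityContinuous (fun c y => a * D c y) := fun c => (hD c).const_mul a

lemma densityIntegral_const_mul (a : ℝ) (D : M → E4 → ℝ) :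
    densityIntegral (fun c y => a * D c y) = a * densityIntegral D := by
  rw [densityIntegral, densityIntegral, ← smul_eq_mul, smul_finsum]
  refine finsum_congr fun c => ?_
  rw [smul_eq_mul, ← integral_const_mul]
  simp only [densityPiece, mul_left_comm]

/-- The integral of a density supported in the domain of a chart can be computed in that chart. -/
lemma densityIntegral_eq_chart {D : M → E4 → ℝ} {K : Set M} (hK : IsCompact K)
    (hD : DensityContinuous D) (hDK : DensitySupported D K) (hcov : CovariantDensity D) {d : M}
    (hKd : K ⊆ (extChartAt (𝓡 4) d).source) :
    densityIntegral D = ∫ y in (extChartAt (𝓡 4) d).target, D d y := by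
  have hmove : ∀ c : M, ∫ y in (extChartAt (𝓡 4) c).target, densityPiece D c y =
      ∫ y in (extChartAt (𝓡 4) d).target,
        atlasPartition M c ((extChartAt (𝓡 4) d).symm y) * D d y := by
    intro c
    have h1 : ∫ y in (extChartAt (𝓡 4) c).target, densityPiece D c y =
        ∫ y in overlap c d, densityPiece D c y := by
      refine setIntegral_eq_of_subset_of_forall_sdiff_eq_zero (isOpen_target c).measurableSet
        inter_subset_left fun y hy => ?_
      rw [densityPiece, hDK c y hy.1 fun h => hy.2 ⟨hy.1, hKd h⟩, mul_zero]
    have h2 : ∫ y in (extChartAt (𝓡 4) d).target,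
        atlasPartition M c ((extChartAt (𝓡 4) d).symm y) * D d y =
        ∫ y in overlap d c, atlasPartition M c ((extChartAt (𝓡 4) d).symm y) * D d y := by
      refine setIntegral_eq_of_subset_of_forall_sdiff_eq_zero (isOpen_target d).measurableSet
        inter_subset_left fun y hy => ?_
      rw [image_eq_zero_of_notMem_tsupport fun h =>
        hy.2 ⟨hy.1, atlasPartition_tsupport c h⟩, zero_mul]
    have himage : transition d c '' overlap d c = overlap c d := by
      refine Subset.antisymm ?_ fun y hy => ?_
      · rintro _ ⟨y, hy, rfl⟩
        exact transition_mem_overlap hy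
      · exact ⟨transition c d y, transition_mem_overlap hy, transition_transition hy⟩
    have hinj : InjOn (transition d c) (overlap d c) := fun y hy z hz h => by
      rw [← transition_transition hy, h, transition_transition hz]
    rw [h1, h2, ← himage, integral_image_eq_integral_abs_det_fderiv_smul volume
      (isOpen_overlap d c).measurableSet
      (fun y hy => (transition_diff hy).hasFDerivAt.hasFDerivWithinAt) hinj]
    refine setIntegral_congr_fun (isOpen_overlap d c).measurableSet fun y hy => ?_
    simp only [det_fderiv_eq (transition_diff hy), smul_eq_mul, densityPiece, symm_transition hy]
    rw [hcov d c y hy]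
    ring
  rw [densityIntegral_eq_sum hK hDK, Finset.sum_congr rfl fun c _ => hmove c,
    ← integral_finsetSum _ fun c _ => ?_]
  · refine setIntegral_congr_fun (isOpen_target d).measurableSet fun y hy => ?_
    simp only [← Finset.sum_mul]
    by_cases h : (extChartAt (𝓡 4) d).symm y ∈ K
    · rw [(sum_activeCharts_eventually hK h).self_of_nhds, one_mul]
    · rw [hDK d y hy h, mul_zero]
  · refine integrableOn_of_compact (isOpen_target d)
      (hK.image_of_continuousOn ((continuousOn_extChartAt d).mono hKd)) (chart_image_subset hKd)
      (((chartContDiff_atlasPartition c) d).continuousOn.mul (hD d)) fun y hy h => ?_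
    rw [hDK d y hy (symm_notMem_of_notMem_image hy h), mul_zero]

omit [IsManifold (𝓡 4) ∞ M] [T2Space M] [SigmaCompactSpace M] in
lemma ChartContDiff.mul {n : WithTop ℕ∞} {u v : M → ℝ} (hu : ChartContDiff n u)
    (hv : ChartContDiff n v) : ChartContDiff n (fun x => u x * v x) := fun c => (hu c).mul (hv c)

omit [IsManifold (𝓡 4) ∞ M] [T2Space M] [SigmaCompactSpace M] in
lemma ChartContDiff.sub {n : WithTop ℕ∞} {u v : M → ℝ} (hu : ChartContDiff n u)
    (hv : ChartContDiff n v) : ChartContDiff n (fun x => u x - v x) := fun c => (hu c).sub (hv c)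

omit [IsManifold (𝓡 4) ∞ M] [T2Space M] [SigmaCompactSpace M] in
lemma ChartContDiff.sum {ι : Type*} {n : WithTop ℕ∞} (s : Finset ι) {u : ι → M → ℝ}
    (hu : ∀ i ∈ s, ChartContDiff n (u i)) : ChartContDiff n (fun x => ∑ i ∈ s, u i x) :=
  fun c => ContDiffOn.sum fun i hi => hu i hi c

/-- Passage from one chart to the manifold: if `T u` is a density that depends additively and
locally on the scalar `u`, vanishes off a compact set, and integrates to zero for every `u`
supported in the domain of a chart, then it integrates to zero for every `u`. -/
theorem densityIntegral_eq_zero_of_local {T : (M → ℝ) → M → E4 → ℝ} {K : Set M}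
    (hK : IsCompact K)
    (hcov : ∀ u, ChartContDiff 2 u → CovariantDensity (T u))
    (hcont : ∀ u, ChartContDiff 2 u → DensityContinuous (T u))
    (hTK : ∀ u, ChartContDiff 2 u → DensitySupported (T u) K)
    (hloc : ∀ u, ChartContDiff 2 u → ∀ c, ∀ y ∈ (extChartAt (𝓡 4) c).target,
      u =ᶠ[𝓝 ((extChartAt (𝓡 4) c).symm y)] (fun _ => 0) → T u c y = 0)
    (hadd : ∀ u v, ChartContDiff 2 u → ChartContDiff 2 v → ∀ c,
      ∀ y ∈ (extChartAt (𝓡 4) c).target, T (fun x => u x + v x) c y = T u c y + T v c y)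
    (hzero : ∀ u, ChartContDiff 2 u → ∀ d, ∀ C : Set E4, IsCompact C →
      C ⊆ (extChartAt (𝓡 4) d).target →
      (∀ y ∈ (extChartAt (𝓡 4) d).target, y ∉ C → (extChartAt (𝓡 4) d).symm y ∉ K ∨
        u =ᶠ[𝓝 ((extChartAt (𝓡 4) d).symm y)] (fun _ => 0)) →
      ∫ y in (extChartAt (𝓡 4) d).target, T u d y = 0)
    {u : M → ℝ} (hu : ChartContDiff 2 u) : densityIntegral (T u) = 0 := by
  set w : M → M → ℝ := fun c x => atlasPartition M c x * u x with hw
  have hw2 : ∀ c, ChartContDiff 2 (w c) := fun c =>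
    ((chartContDiff_atlasPartition c).of_le two_le_infty).mul hu
  have hw0 : ∀ c x, x ∉ tsupport (atlasPartition M c) → w c =ᶠ[𝓝 x] fun _ => 0 := by
    intro c x hx
    filter_upwards [(isClosed_tsupport (atlasPartition M c)).isOpen_compl.mem_nhds hx] with z hz
    simp only [hw, image_eq_zero_of_notMem_tsupport hz, zero_mul]
  have hT0 : ∀ c, ∀ y ∈ (extChartAt (𝓡 4) c).target, T (fun _ => 0) c y = 0 := fun c y hy =>
    hloc _ (fun c => contDiffOn_const) c y hy (Eventually.of_forall fun _ => rfl)
  have hTsum : ∀ s : Finset M, ∀ c, ∀ y ∈ (extChartAt (𝓡 4) c).target,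
      T (fun x => ∑ d ∈ s, w d x) c y = ∑ d ∈ s, T (w d) c y := by
    classical
    intro s
    induction s using Finset.induction_on with
    | empty => intro c y hy; simpa using hT0 c y hy
    | insert a s ha ih =>
      intro c y hy
      simp only [Finset.sum_insert ha]
      rw [hadd _ _ (hw2 a) (ChartContDiff.sum s fun i _ => hw2 i) c y hy, ih c y hy]
  -- on `K` only the charts of a finite set contribute
  have hT : ∀ c, ∀ y ∈ (extChartAt (𝓡 4) c).target,
      T u c y = ∑ d ∈ activeCharts hK, T (w d) c y := by
    intro c y hy
    set S := activeCharts hK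
    have hsum2 : ChartContDiff 2 (fun x => ∑ d ∈ S, w d x) := ChartContDiff.sum S fun i _ => hw2 i
    have h1 := hadd _ _ hsum2 (hu.sub hsum2) c y hy
    have h2 : (fun x => ∑ d ∈ S, w d x + (u x - ∑ d ∈ S, w d x)) = u := by
      ext x; ring
    have h3 : T (fun x => u x - ∑ d ∈ S, w d x) c y = 0 := by
      by_cases h : (extChartAt (𝓡 4) c).symm y ∈ K
      · refine hloc _ (hu.sub hsum2) c y hy ?_
        filter_upwards [sum_activeCharts_eventually hK h] with z hz
        rw [← Finset.sum_mul, hz, one_mul, sub_self]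
      · exact hTK _ (hu.sub hsum2) c y hy h
    rw [h2, h3, add_zero, hTsum S c y hy] at h1
    exact h1
  have hpiece : ∀ d, densityIntegral (T (w d)) = 0 := by
    intro d
    have hsub : tsupport (atlasPartition M d) ∩ K ⊆ (extChartAt (𝓡 4) d).source :=
      inter_subset_left.trans (atlasPartition_tsupport d)
    rw [densityIntegral_eq_chart (hK.inter_left (isClosed_tsupport (atlasPartition M d)))
      (hcont _ (hw2 d)) (fun c y hy h => ?_) (hcov _ (hw2 d)) hsub]
    · refine hzero _ (hw2 d) d _ (isCompact_chart_image hK d) (chart_image_subset hsub)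
        fun y hy h => ?_
      by_cases h1 : (extChartAt (𝓡 4) d).symm y ∈ K
      · exact Or.inr (hw0 d _ fun h2 => symm_notMem_of_notMem_image hy h ⟨h2, h1⟩)
      · exact Or.inl h1
    · by_cases h1 : (extChartAt (𝓡 4) c).symm y ∈ K
      · exact hloc _ (hw2 d) c y hy (hw0 d _ fun h2 => h ⟨h2, h1⟩)
      · exact hTK _ (hw2 d) c y hy h1
  have hsum : ∀ s : Finset M, densityIntegral (fun c y => ∑ d ∈ s, T (w d) c y) = 0 := by
    classical
    intro s
    induction s using Finset.induction_on with
    | empty => simp [densityIntegral, densityPiece]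
    | insert a s ha ih =>
      simp only [Finset.sum_insert ha]
      rw [densityIntegral_add hK (hcont _ (hw2 a)) (hTK _ (hw2 a))
        (fun c => continuousOn_finsetSum s fun d _ => hcont _ (hw2 d) c)
        (fun c y hy h => Finset.sum_eq_zero fun d _ => hTK _ (hw2 d) c y hy h), hpiece, ih,
        add_zero]
  rw [densityIntegral_congr hT, hsum]

/-- Integrals over a compact set pass to the limit under locally uniform convergence. -/
theorem tendsto_densityIntegral {K : Set M} (hK : IsCompact K) {E : M → E4 → ℝ}
    (hE : DensityContinuous E) {v : ℕ → M → ℝ} {w : M → ℝ} (hv : ∀ N, Continuous (v N))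
    (hvw : TendstoLocallyUniformly v w atTop)
    (hsupp : ∀ N, DensitySupported (fun c y => v N ((extChartAt (𝓡 4) c).symm y) * E c y) K) :
    DensityIntegrable (fun c y => w ((extChartAt (𝓡 4) c).symm y) * E c y) ∧
    Tendsto (fun N => densityIntegral fun c y => v N ((extChartAt (𝓡 4) c).symm y) * E c y) atTop
      (𝓝 (densityIntegral fun c y => w ((extChartAt (𝓡 4) c).symm y) * E c y)) := by
  have hw : Continuous w := hvw.continuous (Eventually.of_forall hv).frequently
  have hlim : ∀ x, Tendsto (fun N => v N x) atTop (𝓝 (w x)) := fun x =>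
    (tendstoLocallyUniformlyOn_univ.2 hvw).tendsto_at (mem_univ x)
  have hwsupp : DensitySupported (fun c y => w ((extChartAt (𝓡 4) c).symm y) * E c y) K := by
    intro c y hy h
    refine tendsto_nhds_unique ((hlim _).mul_const (E c y)) ?_
    simp only [fun N => hsupp N c y hy h]
    exact tendsto_const_nhds
  have hcont : ∀ f : M → ℝ, Continuous f →
      DensityContinuous (fun c y => f ((extChartAt (𝓡 4) c).symm y) * E c y) := fun f hf c =>
    (hf.comp_continuousOn (continuousOn_extChartAt_symm c)).mul (hE c)
  refine ⟨densityIntegrable_of_compact hK (hcont w hw) hwsupp, ?_⟩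
  simp only [densityIntegral_eq_sum hK hwsupp, fun N => densityIntegral_eq_sum hK (hsupp N)]
  refine tendsto_finsetSum _ fun c _ => ?_
  set s := tsupport (atlasPartition M c) ∩ K with hs
  have hsc : IsCompact s := hK.inter_left (isClosed_tsupport _)
  have hsub : s ⊆ (extChartAt (𝓡 4) c).source :=
    inter_subset_left.trans (atlasPartition_tsupport c)
  set C := extChartAt (𝓡 4) c '' s with hC
  have hCc : IsCompact C := isCompact_chart_image hK c
  have hCt : C ⊆ (extChartAt (𝓡 4) c).target := chart_image_subset hsub
  have hCs : ∀ y ∈ C, (extChartAt (𝓡 4) c).symm y ∈ s := by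
    rintro _ ⟨x, hx, rfl⟩
    rwa [(extChartAt (𝓡 4) c).left_inv (hsub hx)]
  have hrestr : ∀ f : M → ℝ,
      DensitySupported (fun c y => f ((extChartAt (𝓡 4) c).symm y) * E c y) K →
      ∫ y in (extChartAt (𝓡 4) c).target,
        densityPiece (fun c y => f ((extChartAt (𝓡 4) c).symm y) * E c y) c y =
      ∫ y in C, densityPiece (fun c y => f ((extChartAt (𝓡 4) c).symm y) * E c y) c y := by
    intro f hf
    refine setIntegral_eq_of_subset_of_forall_sdiff_eq_zero (isOpen_target c).measurableSet hCt
      fun y hy => densityPiece_eq_zero hf hy.1 (symm_notMem_of_notMem_image hy.1 hy.2)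
  rw [hrestr w hwsupp]
  simp only [fun N => hrestr (v N) (hsupp N)]
  obtain ⟨B, hB⟩ := hsc.exists_bound_of_continuousOn hw.continuousOn
  have hunif : TendstoUniformlyOn v w atTop s :=
    (tendstoLocallyUniformlyOn_iff_tendstoUniformlyOn_of_compact hsc).1
      hvw.tendstoLocallyUniformlyOn
  have hEc : ContinuousOn (fun y => atlasPartition M c ((extChartAt (𝓡 4) c).symm y) * E c y) C :=
    (densityPiece_continuousOn hE c).mono hCt
  refine tendsto_integral_filter_of_dominated_convergence
    (fun y => (B + 1) * ‖atlasPartition M c ((extChartAt (𝓡 4) c).symm y) * E c y‖)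
    (Eventually.of_forall fun N => ?_) ?_ ?_ ?_
  · exact ((densityPiece_continuousOn (hcont (v N) (hv N)) c).mono hCt).aestronglyMeasurable
      hCc.measurableSet
  · filter_upwards [Metric.tendstoUniformlyOn_iff.1 hunif 1 one_pos] with N hN
    refine (ae_restrict_iff' hCc.measurableSet).2 (Eventually.of_forall fun y hy => ?_)
    have h1 := hN _ (hCs y hy)
    have h2 := hB _ (hCs y hy)
    have h3 : ‖v N ((extChartAt (𝓡 4) c).symm y)‖ ≤ B + 1 := by
      rw [dist_eq_norm] at h1
      have := norm_sub_norm_le (v N ((extChartAt (𝓡 4) c).symm y))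
        (w ((extChartAt (𝓡 4) c).symm y))
      rw [norm_sub_rev] at this
      linarith
    rw [densityPiece, mul_left_comm, norm_mul]
    exact mul_le_mul_of_nonneg_right h3 (norm_nonneg _)
  · exact (continuousOn_const.mul hEc.norm).integrableOn_compact hCc
  · refine Eventually.of_forall fun y => ?_
    exact ((hlim _).mul_const _).const_mul _

end Integrals

/-! ### Smooth families of scalars along a variation of the metric -/

section Germs

variable {G G' : E4 → Matrix (Fin 4) (Fin 4) ℝ} {y : E4}

lemma christoffel_congr (h : G =ᶠ[𝓝 y] G') (k i j : Fin 4) :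
    christoffel G k i j y = christoffel G' k i j y := by
  have hij : ∀ i j, (fun z => G z i j) =ᶠ[𝓝 y] fun z => G' z i j := fun i j =>
    h.mono fun z hz => by simp only [hz]
  simp only [christoffel, h.self_of_nhds, pd_congr (hij _ _)]

lemma christoffel_eventuallyEq (h : G =ᶠ[𝓝 y] G') (k i j : Fin 4) :
    christoffel G k i j =ᶠ[𝓝 y] christoffel G' k i j :=
  (eventually_eventually_nhds.2 h).mono fun _ hz => christoffel_congr hz k i j

lemma localScalar_congr (h : G =ᶠ[𝓝 y] G') : localScalar G y = localScalar G' y := by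
  simp only [localScalar, ricci, riemann, h.self_of_nhds, christoffel_congr h,
    pd_congr (christoffel_eventuallyEq h _ _ _)]

lemma localBox_congr_metric (h : G =ᶠ[𝓝 y] G') (u : E4 → ℝ) :
    localBox G u y = localBox G' u y := by
  simp only [localBox, hess, h.self_of_nhds, christoffel_congr h]

lemma pd_add_eventuallyEq {u v : E4 → ℝ} (hu : ContDiffAt ℝ 2 u y) (hv : ContDiffAt ℝ 2 v y)
    (i : Fin 4) : pd i (fun z => u z + v z) =ᶠ[𝓝 y] fun z => pd i u z + pd i v z := by
  filter_upwards [hu.eventually (by simp), hv.eventually (by simp)] with z hz hz'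
  exact pd_add (hz.differentiableAt (by norm_num)) (hz'.differentiableAt (by norm_num)) i

lemma hess_add {u v : E4 → ℝ} (hu : ContDiffAt ℝ 2 u y) (hv : ContDiffAt ℝ 2 v y)
    (μ ν : Fin 4) : hess G (fun z => u z + v z) μ ν y = hess G u μ ν y + hess G v μ ν y := by
  have hd : ∀ {w : E4 → ℝ}, ContDiffAt ℝ 2 w y → DifferentiableAt ℝ (pd ν w) y := fun hw =>
    ((hw.fderiv_right (m := 1) (by norm_num)).clm_apply contDiffAt_const).differentiableAt
      one_ne_zero
  have h1 := pd_add_eventuallyEq hu hv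
  simp only [hess, pd_congr (h1 ν), (h1 _).self_of_nhds, pd_add (hd hu) (hd hv), mul_add,
    Finset.sum_add_distrib]
  ring

lemma localBox_add {u v : E4 → ℝ} (hu : ContDiffAt ℝ 2 u y) (hv : ContDiffAt ℝ 2 v y) :
    localBox G (fun z => u z + v z) y = localBox G u y + localBox G v y := by
  simp only [localBox, hess_add hu hv, mul_add, Finset.sum_add_distrib]

lemma hess_zero (μ ν : Fin 4) : hess G (fun _ => 0) μ ν y = 0 := by
  have : pd ν (fun _ : E4 => (0 : ℝ)) = fun _ => 0 := funext fun z => pd_const 0 ν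
  simp [hess, this, pd_const]

lemma localBox_zero : localBox G (fun _ => 0) y = 0 := by
  simp [localBox, hess_zero]

end Germs

section Variation

variable {M : Type*} [TopologicalSpace M] [ChartedSpace E4 M]

/-- A family of scalars, smooth jointly in the parameter and in the coordinates of any chart. -/
def SmoothFamily (r : ℝ) (v : ℝ → M → ℝ) : Prop :=
  ∀ c : M, ContDiffOn ℝ ∞ (fun p : ℝ × E4 => v p.1 ((extChartAt (𝓡 4) c).symm p.2))
    (Ioo (-r) r ×ˢ (extChartAt (𝓡 4) c).target)

lemma eventually_symm_mem {c : M} {y : E4} (hy : y ∈ (extChartAt (𝓡 4) c).target) {p : M → Prop}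
    (h : ∀ᶠ x in 𝓝 ((extChartAt (𝓡 4) c).symm y), p x) :
    ∀ᶠ z in 𝓝 y, p ((extChartAt (𝓡 4) c).symm z) :=
  ((continuousOn_extChartAt_symm c).continuousAt ((isOpen_target c).mem_nhds hy)).eventually h

variable {g : BilinField M} {γ : ℝ → BilinField M} {r : ℝ} (hγ : IsVariation g γ r)
  {K : Set M} (hK : IsClosed K) (hKγ : ∀ ε ∈ Ioo (-r) r, ∀ x ∉ K, γ ε x = g x)

include hKγ hK in
lemma comp_eventuallyEq_off {c : M} {y : E4} (hy : y ∈ (extChartAt (𝓡 4) c).target)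
    (h : (extChartAt (𝓡 4) c).symm y ∉ K) {ε : ℝ} (hε : ε ∈ Ioo (-r) r) :
    comp (γ ε) c =ᶠ[𝓝 y] comp g c := by
  filter_upwards [eventually_symm_mem hy (hK.isOpen_compl.mem_nhds h)] with z hz
  ext i j
  simp only [comp, hKγ ε hε _ hz]

include hγ

lemma IsVariation.eventually_mem : ∀ᶠ ε in 𝓝 (0 : ℝ), ε ∈ Ioo (-r) r :=
  isOpen_Ioo.mem_nhds hγ.zero_mem

lemma IsVariation.comp_zero (c : M) : comp (γ 0) c = comp g c := by rw [hγ.zero]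

omit hγ in
lemma SmoothFamily.slice {v : ℝ → M → ℝ} (hv : SmoothFamily r v) {ε : ℝ} (hε : ε ∈ Ioo (-r) r) :
    ChartContDiff ∞ (v ε) := fun c => contDiffOn_slice (hv c) hε

lemma SmoothFamily.variation {v : ℝ → M → ℝ} (hv : SmoothFamily r v) :
    ChartContDiff ∞ (fun x => deriv (fun ε => v ε x) 0) := fun c =>
  (hγ.metricFamily c).variation_smooth (hv c)

omit hγ in
lemma SmoothFamily.differentiableAt {v : ℝ → M → ℝ} (hv : SmoothFamily r v) {ε : ℝ}
    (hε : ε ∈ Ioo (-r) r) (x : M) : DifferentiableAt ℝ (fun ε => v ε x) ε := by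
  have h := ContDiffOn.differentiableAt_of_isOpen (isOpen_Ioo.prod (isOpen_target x)) (hv x)
    (by simp) (p := (ε, extChartAt (𝓡 4) x x)) ⟨hε, mem_extChartAt_target x⟩
  have h1 := (deriv_slice h).differentiableAt
  simpa only [extChartAt_to_inv] using h1

include hK hKγ

lemma dInv_eq_zero_off {c : M} {y : E4} (hy : y ∈ (extChartAt (𝓡 4) c).target)
    (h : (extChartAt (𝓡 4) c).symm y ∉ K) (μ ν : Fin 4) :
    dInv (fun ε => comp (γ ε) c) μ ν y = 0 := by
  have : (fun ε => (comp (γ ε) c y)⁻¹ μ ν) =ᶠ[𝓝 0] fun _ => (comp g c y)⁻¹ μ ν := by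
    filter_upwards [hγ.eventually_mem] with ε hε
    rw [(comp_eventuallyEq_off hK hKγ hy h hε).self_of_nhds]
  rw [dInv, this.deriv_eq, deriv_const]

lemma dVolInv_eq_zero_off {c : M} {y : E4} (hy : y ∈ (extChartAt (𝓡 4) c).target)
    (h : (extChartAt (𝓡 4) c).symm y ∉ K) (μ ν : Fin 4) :
    dVolInv (fun ε => comp (γ ε) c) μ ν y = 0 := by
  have : (fun ε => volInv (comp (γ ε) c) μ ν y) =ᶠ[𝓝 0] fun _ => volInv (comp g c) μ ν y := by
    filter_upwards [hγ.eventually_mem] with ε hε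
    rw [volInv, vol, (comp_eventuallyEq_off hK hKγ hy h hε).self_of_nhds]
    rfl
  rw [dVolInv, this.deriv_eq, deriv_const]

lemma dVol_eq_zero_off {c : M} {y : E4} (hy : y ∈ (extChartAt (𝓡 4) c).target)
    (h : (extChartAt (𝓡 4) c).symm y ∉ K) : dVol (fun ε => comp (γ ε) c) y = 0 := by
  have : (fun ε => vol (comp (γ ε) c) y) =ᶠ[𝓝 0] fun _ => vol (comp g c) y := by
    filter_upwards [hγ.eventually_mem] with ε hε
    rw [vol, (comp_eventuallyEq_off hK hKγ hy h hε).self_of_nhds]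
    rfl
  rw [dVol, this.deriv_eq, deriv_const]

lemma dChristoffel_eq_zero_off {c : M} {y : E4} (hy : y ∈ (extChartAt (𝓡 4) c).target)
    (h : (extChartAt (𝓡 4) c).symm y ∉ K) (k i j : Fin 4) :
    dChristoffel (fun ε => comp (γ ε) c) k i j y = 0 := by
  have : (fun ε => christoffel (comp (γ ε) c) k i j y) =ᶠ[𝓝 0]
      fun _ => christoffel (comp g c) k i j y := by
    filter_upwards [hγ.eventually_mem] with ε hε
    exact christoffel_congr (comp_eventuallyEq_off hK hKγ hy h hε) k i j
  rw [dChristoffel, this.deriv_eq, deriv_const]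

lemma scalarFlux_eq_zero_off {c : M} {y : E4} (hy : y ∈ (extChartAt (𝓡 4) c).target)
    (h : (extChartAt (𝓡 4) c).symm y ∉ K) (u : E4 → ℝ) (α : Fin 4) :
    scalarFlux (fun ε => comp (γ ε) c) u α y = 0 := by
  simp [scalarFlux, palatiniFlux, dLogVol, dInv_eq_zero_off hγ hK hKγ hy h,
    dVolInv_eq_zero_off hγ hK hKγ hy h, dChristoffel_eq_zero_off hγ hK hKγ hy h]

omit hK hKγ in
lemma pairingDensity_continuous {T : M → Fin 4 → Fin 4 → E4 → ℝ}
    (hT : ∀ c μ ν, ContinuousOn (T c μ ν) (extChartAt (𝓡 4) c).target) :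
    DensityContinuous (pairingDensity g γ T) := fun c =>
  (continuousOn_finsetSum _ fun μ _ => continuousOn_finsetSum _ fun ν _ =>
    (hT c μ ν).mul ((hγ.metricFamily c).dInv_smooth μ ν).continuousOn).mul
    (hγ.metric_zero.localMetric c).vol_smooth.continuousOn

lemma pairingDensity_supported (T : M → Fin 4 → Fin 4 → E4 → ℝ) :
    DensitySupported (pairingDensity g γ T) K := fun c y hy h => by
  have : ∀ μ ν, deltaInv γ c μ ν y = 0 := dInv_eq_zero_off hγ hK hKγ hy h
  simp [pairingDensity, this]

omit hγ hK hKγ in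
lemma scalarDensity_continuous (hg : IsLorentzMetric g) {u : M → ℝ} (hu : Continuous u) :
    DensityContinuous (scalarDensity g u) := fun c =>
  (hu.comp_continuousOn (continuousOn_extChartAt_symm c)).mul
    (hg.localMetric c).vol_smooth.continuousOn

omit hγ hK hKγ in
lemma scalarDensity_supported {u : M → ℝ} (hu : ∀ x ∉ K, u x = 0) :
    DensitySupported (scalarDensity g u) K := fun c y _ h => by
  rw [scalarDensity, hu _ h, zero_mul]

omit [TopologicalSpace M] [ChartedSpace E4 M] hγ hK hKγ in
lemma deriv_eq_zero_of_fixed {v : ℝ → M → ℝ} (hr : 0 < r) {x : M}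
    (hv : ∀ ε ∈ Ioo (-r) r, v ε x = v 0 x) : deriv (fun ε => v ε x) 0 = 0 := by
  have : (fun ε => v ε x) =ᶠ[𝓝 0] fun _ => v 0 x := by
    filter_upwards [isOpen_Ioo.mem_nhds (show (0 : ℝ) ∈ Ioo (-r) r from ⟨by linarith, hr⟩)]
      with ε hε using hv ε hε
  rw [this.deriv_eq, deriv_const]

lemma scalarCurv_fixed {ε : ℝ} (hε : ε ∈ Ioo (-r) r) {x : M} (hx : x ∉ K) :
    scalarCurv (γ ε) x = scalarCurv (γ 0) x := by
  have h : ∀ ε ∈ Ioo (-r) r, scalarCurv (γ ε) x = scalarCurv g x := fun ε hε =>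
    localScalar_congr (comp_eventuallyEq_off hK hKγ (mem_extChartAt_target x)
      (by rwa [extChartAt_to_inv]) hε)
  rw [h ε hε, h 0 hγ.zero_mem]

lemma box_fixed {v : ℝ → M → ℝ} (hv : ∀ ε ∈ Ioo (-r) r, ∀ x ∉ K, v ε x = v 0 x) :
    ∀ ε ∈ Ioo (-r) r, ∀ x ∉ K, box (γ ε) (v ε) x = box (γ 0) (v 0) x := by
  have h : ∀ ε ∈ Ioo (-r) r, ∀ x ∉ K, box (γ ε) (v ε) x = box g (v 0) x := fun ε hε x hx => by
    have hx' : (extChartAt (𝓡 4) x).symm (extChartAt (𝓡 4) x x) ∉ K := by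
      rwa [extChartAt_to_inv]
    have h1 := comp_eventuallyEq_off hK hKγ (mem_extChartAt_target x) hx' hε
    rw [box, box, localBox_congr_metric h1]
    refine localBox_congr _ ?_
    filter_upwards [eventually_symm_mem (mem_extChartAt_target x)
      (hK.isOpen_compl.mem_nhds hx')] with z hz
    exact hv ε hε _ hz
  intro ε hε x hx
  rw [h ε hε x hx, h 0 hγ.zero_mem x hx]

end Variation

section Invariance

variable {M : Type*} [TopologicalSpace M] [ChartedSpace E4 M] [IsManifold (𝓡 4) ∞ M]
variable {g : BilinField M} {γ : ℝ → BilinField M} {r : ℝ} (hγ : IsVariation g γ r)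

include hγ

lemma scalarCurv_smoothFamily : SmoothFamily r (fun ε => scalarCurv (γ ε)) := fun c =>
  (hγ.metricFamily c).localScalar_smooth.congr fun p hp =>
    scalarCurv_symm (hγ.metric p.1 hp.1) hp.2

lemma box_smoothFamily {v : ℝ → M → ℝ} (hv : SmoothFamily r v) :
    SmoothFamily r (fun ε => box (γ ε) (v ε)) := fun c =>
  ((hγ.metricFamily c).localBox_smooth (v := fun ε y => v ε ((extChartAt (𝓡 4) c).symm y))
    (hv c)).congr fun p hp =>
      box_symm (hγ.metric p.1 hp.1) ((SmoothFamily.slice hv hp.1).of_le two_le_infty) hp.2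

lemma deltaR_smooth : ChartContDiff ∞ (deltaR γ) := (scalarCurv_smoothFamily hγ).variation hγ

omit hγ in
lemma box_chartContDiff (hg : IsLorentzMetric g) {u : M → ℝ} {m n : WithTop ℕ∞} (hm : m ≤ ∞)
    (hmn : m + 1 + 1 ≤ n) (hu : ChartContDiff n u) : ChartContDiff m (box g u) := fun c =>
  ((hg.localMetric c).localBox_contDiffOn (hu c) hm hmn).congr fun y hy =>
    box_symm hg (hu.of_le (le_trans (by
      rw [add_assoc, one_add_one_eq_two]; exact le_add_self) hmn)) hy

omit hγ in
lemma iterate_box_smooth (hg : IsLorentzMetric g) {u : M → ℝ} (hu : ChartContDiff ∞ u) (n : ℕ) :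
    ChartContDiff ∞ ((box g)^[n] u) := by
  induction n with
  | zero => exact hu
  | succ n ih =>
    rw [Function.iterate_succ_apply']
    exact box_chartContDiff hg le_rfl le_rfl ih

lemma iterate_box_smoothFamily {v : ℝ → M → ℝ} (hv : SmoothFamily r v) (n : ℕ) :
    SmoothFamily r (fun ε => (box (γ ε))^[n] (v ε)) := by
  induction n with
  | zero => exact hv
  | succ n ih =>
    simp only [Function.iterate_succ_apply']
    exact box_smoothFamily hγ ih

omit [IsManifold (𝓡 4) ∞ M] in
lemma iterate_box_fixed {K : Set M} (hK : IsClosed K)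
    (hKγ : ∀ ε ∈ Ioo (-r) r, ∀ x ∉ K, γ ε x = g x) {v : ℝ → M → ℝ}
    (hv : ∀ ε ∈ Ioo (-r) r, ∀ x ∉ K, v ε x = v 0 x) (n : ℕ) :
    ∀ ε ∈ Ioo (-r) r, ∀ x ∉ K, (box (γ ε))^[n] (v ε) x = (box (γ 0))^[n] (v 0) x := by
  induction n with
  | zero => exact hv
  | succ n ih =>
    simp only [Function.iterate_succ_apply']
    exact box_fixed hγ hK hKγ (v := fun ε => (box (γ ε))^[n] (v ε)) ih

omit [IsManifold (𝓡 4) ∞ M] hγ in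
lemma ricciMinusK_continuousOn (hg : IsLorentzMetric g) {u : M → ℝ} (hu : ChartContDiff 2 u)
    (c : M) (μ ν : Fin 4) :
    ContinuousOn (ricciMinusK g u c μ ν) (extChartAt (𝓡 4) c).target := by
  have hG := hg.localMetric c
  unfold ricciMinusK opK
  exact ((hG.ricci_smooth μ ν).continuousOn.mul (hu c).continuousOn).sub
    ((hG.hess_contDiffOn (m := 0) (hu c) (by simp) (by norm_num) μ ν).continuousOn.sub
    ((hG.smooth μ ν).continuousOn.mul
      (hG.localBox_contDiffOn (m := 0) (hu c) (by simp) (by norm_num)).continuousOn))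

omit [IsManifold (𝓡 4) ∞ M] hγ in
lemma fieldS_continuousOn (hg : IsLorentzMetric g) {A B : M → ℝ} (hA : ChartContDiff 2 A)
    (hB : ChartContDiff 2 B) (c : M) (μ ν : Fin 4) :
    ContinuousOn (fieldS g A B c μ ν) (extChartAt (𝓡 4) c).target := by
  have hG := hg.localMetric c
  have hpd : ∀ {u : M → ℝ}, ChartContDiff 2 u → ∀ i, ContinuousOn
      (pd i (u ∘ (extChartAt (𝓡 4) c).symm)) (extChartAt (𝓡 4) c).target := fun hu i =>
    (contDiffOn_pd (m := 1) (isOpen_target c) (hu c) (by norm_num) i).continuousOn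
  unfold fieldS tensorS
  exact (((hG.smooth μ ν).continuousOn.mul (continuousOn_finsetSum _ fun α _ =>
    continuousOn_finsetSum _ fun β _ => ((hG.inv_smooth α β).continuousOn.mul (hpd hA α)).mul
      (hpd hB β))).add ((hG.smooth μ ν).continuousOn.mul ((hA c).continuousOn.mul
      (hG.localBox_contDiffOn (m := 0) (hB c) (by simp) (by norm_num)).continuousOn))).sub
    (continuousOn_const.mul ((hpd hA μ).mul (hpd hB ν)))

end Invariance

/-! ### Integrated variations -/

lemma tensorS_add {G : E4 → Matrix (Fin 4) (Fin 4) ℝ} {u v B : E4 → ℝ} {y : E4}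
    (hu : DifferentiableAt ℝ u y) (hv : DifferentiableAt ℝ v y) (μ ν : Fin 4) :
    tensorS G (fun z => u z + v z) B μ ν y = tensorS G u B μ ν y + tensorS G v B μ ν y := by
  have : ∑ α, ∑ β, (G y)⁻¹ α β * (pd α u y + pd α v y) * pd β B y =
      (∑ α, ∑ β, (G y)⁻¹ α β * pd α u y * pd β B y) +
      ∑ α, ∑ β, (G y)⁻¹ α β * pd α v y * pd β B y := by
    simp only [← Finset.sum_add_distrib]
    exact Finset.sum_congr rfl fun α _ => Finset.sum_congr rfl fun β _ => by ring
  simp only [tensorS, pd_add hu hv, this]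
  ring

section IntegratedVariations

variable {M : Type*} [TopologicalSpace M] [ChartedSpace E4 M]

lemma CovariantDensity.sub {D D' : M → E4 → ℝ} (hD : CovariantDensity D)
    (hD' : CovariantDensity D') : CovariantDensity (fun c y => D c y - D' c y) :=
  fun c c' y hy => by
    simp only [hD c c' y hy, hD' c c' y hy]
    ring

lemma CovariantDensity.const_mul {D : M → E4 → ℝ} (hD : CovariantDensity D) (a : ℝ) :
    CovariantDensity (fun c y => a * D c y) := fun c c' y hy => by
  simp only [hD c c' y hy]
  ring

variable [IsManifold (𝓡 4) ∞ M] [T2Space M] [SigmaCompactSpace M]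

lemma densityIntegral_sub {D D' : M → E4 → ℝ} {K : Set M} (hK : IsCompact K)
    (hD : DensityContinuous D) (hDK : DensitySupported D K)
    (hD' : DensityContinuous D') (hDK' : DensitySupported D' K) :
    densityIntegral (fun c y => D c y - D' c y) = densityIntegral D - densityIntegral D' := by
  have h := densityIntegral_add hK hD hDK (hD'.const_mul (-1)) fun c y hy h => by
    simp only [hDK' c y hy h, mul_zero]
  rw [densityIntegral_const_mul] at h
  simp only [neg_one_mul, ← sub_eq_add_neg] at h
  exact h

lemma densityIntegral_sum {K : Set M} (hK : IsCompact K) {ι : Type*} (s : Finset ι)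
    {D : ι → M → E4 → ℝ} (hD : ∀ i, DensityContinuous (D i))
    (hDK : ∀ i, DensitySupported (D i) K) (a : ι → ℝ) :
    densityIntegral (fun c y => ∑ i ∈ s, a i * D i c y) =
      ∑ i ∈ s, a i * densityIntegral (D i) := by
  classical
  induction s using Finset.induction_on with
  | empty => simp [densityIntegral, densityPiece]
  | insert k s hk ih =>
    simp only [Finset.sum_insert hk]
    rw [densityIntegral_add hK ((hD k).const_mul (a k))
      (fun c y hy h => by simp only [hDK k c y hy h, mul_zero])
      (fun c => continuousOn_finsetSum s fun i _ => (hD i).const_mul (a i) c)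
      (fun c y hy h => Finset.sum_eq_zero fun i _ => by simp only [hDK i c y hy h, mul_zero]),
      densityIntegral_const_mul, ih]

variable {g : BilinField M} {γ : ℝ → BilinField M} {r : ℝ} (hγ : IsVariation g γ r)
  {K : Set M} (hK : IsCompact K) (hKγ : ∀ ε ∈ Ioo (-r) r, ∀ x ∉ K, γ ε x = g x)

include hγ hK hKγ

omit [IsManifold (𝓡 4) ∞ M] [SigmaCompactSpace M] in
lemma deltaR_eq_zero_off {x : M} (hx : x ∉ K) : deltaR γ x = 0 :=
  deriv_eq_zero_of_fixed (v := fun ε => scalarCurv (γ ε)) hγ.pos fun _ hε =>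
    scalarCurv_fixed hγ hK.isClosed hKγ hε hx

/-- `∫ u δR √(-g) = ∫ (R_{μν} u - K_{μν} u) δg^{μν} √(-g)` for every scalar `u` of class `C²`. -/
theorem integral_mul_deltaR {u : M → ℝ} (hu : ChartContDiff 2 u) :
    densityIntegral (scalarDensity g fun x => u x * deltaR γ x) =
      densityIntegral (pairingDensity g γ (ricciMinusK g u)) := by
  have hg := hγ.metric_zero
  set T : (M → ℝ) → M → E4 → ℝ := fun u c y =>
    scalarDensity g (fun x => u x * deltaR γ x) c y
      - pairingDensity g γ (ricciMinusK g u) c y with hT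
  have hsc : ∀ u, ChartContDiff 2 u →
      DensityContinuous (scalarDensity g fun x => u x * deltaR γ x) := fun u hu =>
    scalarDensity_continuous hg (hu.continuous.mul (deltaR_smooth hγ).continuous)
  have hss : ∀ u : M → ℝ, DensitySupported (scalarDensity g fun x => u x * deltaR γ x) K :=
    fun u => scalarDensity_supported fun x hx => by
      rw [deltaR_eq_zero_off hγ hK hKγ hx, mul_zero]
  have hpc : ∀ u, ChartContDiff 2 u → DensityContinuous (pairingDensity g γ (ricciMinusK g u)) :=
    fun u hu => pairingDensity_continuous hγ (ricciMinusK_continuousOn hg hu)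
  have hps : ∀ u : M → ℝ, DensitySupported (pairingDensity g γ (ricciMinusK g u)) K :=
    fun u => pairingDensity_supported hγ hK.isClosed hKγ _
  have h0 : densityIntegral (T u) = 0 := by
    refine densityIntegral_eq_zero_of_local hK (fun u hu => ?_) (fun u hu c => ?_)
      (fun u hu c y hy h => ?_) (fun u hu c y hy h => ?_) (fun u v hu hv c y hy => ?_)
      (fun u hu d C hC hCt hoff => ?_) hu
    · exact (scalarDensity_covariant hg _).sub
        (pairingDensity_covariant hγ (ricciMinusK_law hg hu))
    · exact (hsc u hu c).sub (hpc u hu c)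
    · simp only [hT, hss u c y hy h, hps u c y hy h, sub_zero]
    · have h1 : u ∘ (extChartAt (𝓡 4) c).symm =ᶠ[𝓝 y] fun _ => 0 := eventually_symm_mem hy h
      have h2 : ∀ μ ν, ricciMinusK g u c μ ν y = 0 := fun μ ν => by
        rw [ricciMinusK, opK_congr _ h1, h.self_of_nhds, opK, hess_zero, localBox_zero]
        ring
      simp only [hT, scalarDensity, pairingDensity, h.self_of_nhds, h2]
      simp
    · have h2 : ∀ μ ν, ricciMinusK g (fun x => u x + v x) c μ ν y =
          ricciMinusK g u c μ ν y + ricciMinusK g v c μ ν y := fun μ ν => by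
        have e : (fun x => u x + v x) ∘ (extChartAt (𝓡 4) c).symm = fun z =>
          (u ∘ (extChartAt (𝓡 4) c).symm) z + (v ∘ (extChartAt (𝓡 4) c).symm) z := rfl
        rw [ricciMinusK, ricciMinusK, ricciMinusK, opK, opK, opK, e,
          hess_add (hu.contDiffAt hy) (hv.contDiffAt hy),
          localBox_add (hu.contDiffAt hy) (hv.contDiffAt hy)]
        ring
      simp only [hT, scalarDensity, pairingDensity, h2, add_mul, Finset.sum_add_distrib]
      ring
    · have hfam := hγ.metricFamily d
      have hdiv : ∀ y ∈ (extChartAt (𝓡 4) d).target, T u d y =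
          ∑ α, pd α (scalarFlux (fun ε => comp (γ ε) d) (u ∘ (extChartAt (𝓡 4) d).symm) α) y := by
        intro y hy
        rw [← hfam.div_scalarFlux hy (hu d)]
        have e : deriv (fun ε => localScalar (comp (γ ε) d) y) 0 =
            deltaR γ ((extChartAt (𝓡 4) d).symm y) := by
          refine Filter.EventuallyEq.deriv_eq ?_
          filter_upwards [hγ.eventually_mem] with ε hε
          exact (scalarCurv_symm (hγ.metric ε hε) hy).symm
        simp only [e, hγ.comp_zero]
        rfl
      rw [setIntegral_congr_fun (isOpen_target d).measurableSet hdiv]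
      refine integral_div_eq_zero (isOpen_target d) hC hCt
        (fun α => hfam.scalarFlux_contDiffOn (hu d) α) fun α y hy hyC => ?_
      rcases hoff y hy hyC with h | h
      · exact scalarFlux_eq_zero_off hγ hK.isClosed hKγ hy h _ α
      · have h1 : u ∘ (extChartAt (𝓡 4) d).symm =ᶠ[𝓝 y] fun _ => 0 := eventually_symm_mem hy h
        simp only [scalarFlux, h1.self_of_nhds, pd_congr h1, pd_const]
        simp
  have h1 := densityIntegral_sub hK (hsc u hu) (hss u) (hpc u hu) (hps u)
  exact sub_eq_zero.1 (h1.symm.trans h0)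

/-- The variation of the d'Alembertian of a family of scalars `v`, tested against `A`:
`∫ A δ(□v) = ½ ∫ S_{μν}(A, v) δg^{μν} + ∫ □A δv`. -/
theorem integral_mul_delta_box {v : ℝ → M → ℝ} (hv : SmoothFamily r v)
    (hvK : ∀ ε ∈ Ioo (-r) r, ∀ x ∉ K, v ε x = v 0 x) {A : M → ℝ} (hA : ChartContDiff 2 A) :
    densityIntegral (scalarDensity g fun x => A x * deriv (fun ε => box (γ ε) (v ε) x) 0) =
      (1 / 2) * densityIntegral (pairingDensity g γ (fieldS g A (v 0))) +
      densityIntegral (scalarDensity g fun x => box g A x * deriv (fun ε => v ε x) 0) := by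
  have hg := hγ.metric_zero
  set w : M → ℝ := fun x => deriv (fun ε => v ε x) 0 with hw
  set w' : M → ℝ := fun x => deriv (fun ε => box (γ ε) (v ε) x) 0 with hw'
  have hwc : Continuous w := (hv.variation hγ).continuous
  have hwc' : Continuous w' := ((box_smoothFamily hγ hv).variation hγ).continuous
  have hw0 : ∀ x ∉ K, w x = 0 := fun x hx =>
    deriv_eq_zero_of_fixed hγ.pos fun ε hε => hvK ε hε x hx
  have hw0' : ∀ x ∉ K, w' x = 0 := fun x hx =>
    deriv_eq_zero_of_fixed (v := fun ε => box (γ ε) (v ε)) hγ.pos fun ε hε =>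
      box_fixed hγ hK.isClosed hKγ hvK ε hε x hx
  have hv0 : ChartContDiff 2 (v 0) := (hv.slice hγ.zero_mem).of_le two_le_infty
  set D₁ : (M → ℝ) → M → E4 → ℝ := fun A => scalarDensity g fun x => A x * w' x with hD₁
  set D₂ : (M → ℝ) → M → E4 → ℝ := fun A c y =>
    (1 / 2) * pairingDensity g γ (fieldS g A (v 0)) c y with hD₂
  set D₃ : (M → ℝ) → M → E4 → ℝ := fun A => scalarDensity g fun x => box g A x * w x with hD₃
  set T : (M → ℝ) → M → E4 → ℝ := fun A c y => D₁ A c y - D₂ A c y - D₃ A c y with hT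
  have hc₁ : ∀ A, ChartContDiff 2 A → DensityContinuous (D₁ A) := fun A hA =>
    scalarDensity_continuous hg (hA.continuous.mul hwc')
  have hs₁ : ∀ A, DensitySupported (D₁ A) K := fun A => scalarDensity_supported fun x hx => by
    rw [hw0' x hx, mul_zero]
  have hc₂ : ∀ A, ChartContDiff 2 A → DensityContinuous (D₂ A) := fun A hA =>
    (pairingDensity_continuous hγ (fieldS_continuousOn hg hA hv0)).const_mul _
  have hs₂ : ∀ A, DensitySupported (D₂ A) K := fun A c y hy h => by
    simp only [hD₂, pairingDensity_supported hγ hK.isClosed hKγ _ c y hy h, mul_zero]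
  have hc₃ : ∀ A, ChartContDiff 2 A → DensityContinuous (D₃ A) := fun A hA =>
    scalarDensity_continuous hg ((box_chartContDiff (m := 0) hg (by simp) (by norm_num)
      hA).continuous.mul hwc)
  have hs₃ : ∀ A, DensitySupported (D₃ A) K := fun A => scalarDensity_supported fun x hx => by
    rw [hw0 x hx, mul_zero]
  have h0 : densityIntegral (T A) = 0 := by
    refine densityIntegral_eq_zero_of_local hK (fun A hA => ?_) (fun A hA c => ?_)
      (fun A hA c y hy h => ?_) (fun A hA c y hy h => ?_) (fun A B hA hB c y hy => ?_)
      (fun A hA d C hC hCt hoff => ?_) hA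
    · exact ((scalarDensity_covariant hg _).sub
        ((pairingDensity_covariant hγ (fieldS_law hg hA hv0)).const_mul _)).sub
        (scalarDensity_covariant hg _)
    · exact ((hc₁ A hA c).sub (hc₂ A hA c)).sub (hc₃ A hA c)
    · simp only [hT, hs₁ A c y hy h, hs₂ A c y hy h, hs₃ A c y hy h, sub_zero]
    · have h1 : A ∘ (extChartAt (𝓡 4) c).symm =ᶠ[𝓝 y] fun _ => 0 := eventually_symm_mem hy h
      have h2 : ∀ μ ν, fieldS g A (v 0) c μ ν y = 0 := fun μ ν => by
        simp only [fieldS, tensorS, pd_congr h1, pd_const, h1.self_of_nhds]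
        simp
      have h3 : box g A ((extChartAt (𝓡 4) c).symm y) = 0 := by
        rw [box_symm hg hA hy, localBox_congr _ h1, localBox_zero]
      simp only [hT, hD₁, hD₂, hD₃, scalarDensity, pairingDensity, h.self_of_nhds, h2, h3]
      simp
    · have e : (fun x => A x + B x) ∘ (extChartAt (𝓡 4) c).symm = fun z =>
          (A ∘ (extChartAt (𝓡 4) c).symm) z + (B ∘ (extChartAt (𝓡 4) c).symm) z := rfl
      have h2 : ∀ μ ν, fieldS g (fun x => A x + B x) (v 0) c μ ν y =
          fieldS g A (v 0) c μ ν y + fieldS g B (v 0) c μ ν y := fun μ ν => by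
        rw [fieldS, e, tensorS_add ((hA.contDiffAt hy).differentiableAt (by norm_num))
          ((hB.contDiffAt hy).differentiableAt (by norm_num))]
        rfl
      have h3 : box g (fun x => A x + B x) ((extChartAt (𝓡 4) c).symm y) =
          box g A ((extChartAt (𝓡 4) c).symm y) + box g B ((extChartAt (𝓡 4) c).symm y) := by
        have hAB : ChartContDiff 2 (fun x => A x + B x) := fun c => (hA c).add (hB c)
        rw [box_symm hg hA hy, box_symm hg hB hy, box_symm hg hAB hy, e,
          localBox_add (hA.contDiffAt hy) (hB.contDiffAt hy)]
      simp only [hT, hD₁, hD₂, hD₃, scalarDensity, pairingDensity, h2, h3, add_mul,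
        Finset.sum_add_distrib]
      ring
    · have hfam := hγ.metricFamily d
      set V : ℝ → E4 → ℝ := fun ε y => v ε ((extChartAt (𝓡 4) d).symm y) with hV
      have hdiv : ∀ y ∈ (extChartAt (𝓡 4) d).target, T A d y =
          ∑ μ, pd μ (boxFlux (fun ε => comp (γ ε) d) V (A ∘ (extChartAt (𝓡 4) d).symm) μ) y := by
        intro y hy
        rw [← hfam.div_boxFlux hy (hv d) (hA d)]
        have e : deriv (fun ε => localBox (comp (γ ε) d) (V ε) y) 0 =
            w' ((extChartAt (𝓡 4) d).symm y) := by
          refine Filter.EventuallyEq.deriv_eq ?_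
          filter_upwards [hγ.eventually_mem] with ε hε
          exact (box_symm (hγ.metric ε hε) ((hv.slice hε).of_le two_le_infty) hy).symm
        simp only [e, hγ.comp_zero, hT, hD₁, hD₂, hD₃, scalarDensity, box_symm hg hA hy]
        rfl
      rw [setIntegral_congr_fun (isOpen_target d).measurableSet hdiv]
      refine integral_div_eq_zero (isOpen_target d) hC hCt
        (fun μ => hfam.boxFlux_contDiffOn (hv d) (hA d) μ) fun μ y hy hyC => ?_
      rcases hoff y hy hyC with h | h
      · have h1 : w ∘ (extChartAt (𝓡 4) d).symm =ᶠ[𝓝 y] fun _ => 0 :=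
          eventually_symm_mem (p := fun x => w x = 0) hy (by
            filter_upwards [hK.isClosed.isOpen_compl.mem_nhds h] with z hz using hw0 z hz)
        have h2 : (fun z => deriv (fun ε => V ε z) 0) =ᶠ[𝓝 y] fun _ => 0 := h1
        simp only [boxFlux, dVolInv_eq_zero_off hγ hK.isClosed hKγ hy h, pd_congr h2, pd_const,
          h2.self_of_nhds]
        simp
      · have h1 : A ∘ (extChartAt (𝓡 4) d).symm =ᶠ[𝓝 y] fun _ => 0 := eventually_symm_mem hy h
        simp only [boxFlux, h1.self_of_nhds, pd_congr h1, pd_const]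
        simp
  have h1 := densityIntegral_sub hK (D := fun c y => D₁ A c y - D₂ A c y) (D' := D₃ A)
    (fun c => (hc₁ A hA c).sub (hc₂ A hA c))
    (fun c y hy h => by simp only [hs₁ A c y hy h, hs₂ A c y hy h, sub_zero])
    (hc₃ A hA) (hs₃ A)
  rw [densityIntegral_sub hK (hc₁ A hA) (hs₁ A) (hc₂ A hA) (hs₂ A), hD₂,
    densityIntegral_const_mul] at h1
  have h2 := h1.symm.trans h0
  linarith

/-- The variation of `□ⁿ v`, tested against `A`: each step of the induction moves one d'Alembertian
from `v` to `A`, at the cost of one term with `S`. -/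
theorem integral_mul_delta_iterate_box {v : ℝ → M → ℝ} (hv : SmoothFamily r v)
    (hvK : ∀ ε ∈ Ioo (-r) r, ∀ x ∉ K, v ε x = v 0 x) (n : ℕ) {A : M → ℝ}
    (hA : ChartContDiff ∞ A) :
    densityIntegral (scalarDensity g fun x =>
        A x * deriv (fun ε => (box (γ ε))^[n] (v ε) x) 0) =
      densityIntegral (scalarDensity g fun x => (box g)^[n] A x * deriv (fun ε => v ε x) 0) +
      (1 / 2) * ∑ l ∈ Finset.range n, densityIntegral (pairingDensity g γ
        (fieldS g ((box g)^[l] A) ((box g)^[n - 1 - l] (v 0)))) := by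
  have hg := hγ.metric_zero
  induction n generalizing A with
  | zero => simp
  | succ n ih =>
    have h1 := integral_mul_delta_box hγ hK hKγ (iterate_box_smoothFamily hγ hv n)
      (iterate_box_fixed hγ hK.isClosed hKγ hvK n) (hA.of_le two_le_infty)
    have h2 := ih (box_chartContDiff hg le_rfl le_rfl hA)
    rw [h2, hγ.zero] at h1
    simp only [Function.iterate_succ_apply' (box (γ _))]
    rw [h1, Finset.sum_range_succ']
    have h3 : ∀ l ∈ Finset.range n, densityIntegral (pairingDensity g γ
        (fieldS g ((box g)^[l] (box g A)) ((box g)^[n - 1 - l] (v 0)))) =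
        densityIntegral (pairingDensity g γ
        (fieldS g ((box g)^[l + 1] A) ((box g)^[n + 1 - 1 - (l + 1)] (v 0)))) := by
      intro l hl
      rw [show n + 1 - 1 - (l + 1) = n - 1 - l by omega, ← Function.iterate_succ_apply]
    rw [Finset.sum_congr rfl h3, ← Function.iterate_succ_apply]
    simp only [Nat.add_sub_cancel, Nat.sub_zero, Function.iterate_zero, id_eq]
    ring

end IntegratedVariations

/-! ### Series in the d'Alembertian -/

section Families

variable {M : Type*} [TopologicalSpace M] [ChartedSpace E4 M]

lemma ChartContDiff.comp_contDiffOn {u : M → ℝ} (hu : ChartContDiff ∞ u) {U : Set ℝ}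
    (huU : ∀ x, u x ∈ U) {F : ℝ → ℝ} (hF : ContDiffOn ℝ ∞ F U) :
    ChartContDiff ∞ (fun x => F (u x)) := fun c =>
  hF.comp (hu c) fun _ _ => huU _

lemma SmoothFamily.comp_contDiffOn {r : ℝ} {v : ℝ → M → ℝ} (hv : SmoothFamily r v) {U : Set ℝ}
    (hvU : ∀ ε ∈ Ioo (-r) r, ∀ x, v ε x ∈ U) {F : ℝ → ℝ} (hF : ContDiffOn ℝ ∞ F U) :
    SmoothFamily r (fun ε x => F (v ε x)) := fun c =>
  hF.comp (hv c) fun p hp => hvU p.1 hp.1 _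

lemma SmoothFamily.continuousAt {r : ℝ} {v : ℝ → M → ℝ} (hv : SmoothFamily r v) {ε : ℝ}
    (hε : ε ∈ Ioo (-r) r) (x : M) : ContinuousAt (fun p : ℝ × M => v p.1 p.2) (ε, x) := by
  have h1 : ContinuousAt (fun p : ℝ × E4 => v p.1 ((extChartAt (𝓡 4) x).symm p.2))
      (ε, extChartAt (𝓡 4) x x) :=
    (hv x).continuousOn.continuousAt ((isOpen_Ioo.prod (isOpen_target x)).mem_nhds
      ⟨hε, mem_extChartAt_target x⟩)
  have h2 : ContinuousAt (fun p : ℝ × M => (p.1, extChartAt (𝓡 4) x p.2)) (ε, x) :=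
    continuousAt_fst.prodMk
      ((continuousAt_extChartAt (I := 𝓡 4) x).comp_of_eq continuousAt_snd rfl)
  refine (h1.comp_of_eq h2 rfl).congr ?_
  filter_upwards [continuousAt_snd.preimage_mem_nhds
    (extChartAt_source_mem_nhds (I := 𝓡 4) x)] with p hp
  simp only [Function.comp_apply, (extChartAt (𝓡 4) x).left_inv hp]

end Families

section Series

variable {M : Type*} [TopologicalSpace M] [ChartedSpace E4 M] [IsManifold (𝓡 4) ∞ M]
variable {g : BilinField M} {γ : ℝ → BilinField M} {r : ℝ} (hγ : IsVariation g γ r)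

include hγ

/-- The values of the scalar curvature stay in a given open set for small parameters: on the
support of the variation by compactness, and elsewhere because they do not change. -/
lemma exists_radius_scalarCurv_mem [T2Space M] {U : Set ℝ} (hU : IsOpen U)
    (hRU : ∀ x, scalarCurv g x ∈ U) :
    ∃ r', 0 < r' ∧ r' ≤ r ∧ ∀ ε ∈ Ioo (-r') r', ∀ x, scalarCurv (γ ε) x ∈ U := by
  obtain ⟨K, hK, hKγ⟩ := hγ.compact_support
  have h0 : ∀ x, scalarCurv (γ 0) x ∈ U := by rwa [hγ.zero]
  have h1 : ∀ᶠ ε in 𝓝 (0 : ℝ), ∀ x ∈ K, scalarCurv (γ ε) x ∈ U :=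
    hK.eventually_forall_of_forall_eventually fun x _ =>
      ((scalarCurv_smoothFamily hγ).continuousAt hγ.zero_mem x).preimage_mem_nhds
        (hU.mem_nhds (h0 x))
  obtain ⟨s, hs, h2⟩ := Metric.eventually_nhds_iff.1 h1
  refine ⟨min s r, lt_min hs hγ.pos, min_le_right _ _, fun ε hε x => ?_⟩
  by_cases hx : x ∈ K
  · refine h2 ?_ x hx
    rw [Real.dist_eq, sub_zero, abs_lt]
    exact ⟨by linarith [hε.1, min_le_left s r], hε.2.trans_le (min_le_left _ _)⟩
  · rw [scalarCurv_fixed hγ hK.isClosed hKγ (Ioo_subset_Ioo (neg_le_neg (min_le_right _ _))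
      (min_le_right _ _) hε) hx]
    exact h0 x

lemma hasDerivAt_partialF {v : ℝ → M → ℝ} (hv : SmoothFamily r v) (f : ℕ → ℝ) (N : ℕ) {ε : ℝ}
    (hε : ε ∈ Ioo (-r) r) (x : M) :
    HasDerivAt (fun ε => partialF (γ ε) f (v ε) N x)
      (∑ n ∈ Finset.range N, f n * deriv (fun ε => (box (γ ε))^[n] (v ε) x) ε) ε :=
  HasDerivAt.fun_sum fun n _ =>
    (((iterate_box_smoothFamily hγ hv n).differentiableAt hε x).hasDerivAt).const_mul (f n)

/-- Termwise differentiation of `𝓕(□_ε) v_ε` in the parameter. -/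
lemma hasDerivAt_opF {v : ℝ → M → ℝ} (hv : SmoothFamily r v) {f : ℕ → ℝ}
    (hlim : ∀ ε ∈ Ioo (-r) r, ∀ x : M, ∃ l : ℝ,
      Tendsto (fun N => partialF (γ ε) f (v ε) N x) atTop (𝓝 l)) {D : ℝ × M → ℝ}
    (hD : TendstoLocallyUniformlyOn (fun (N : ℕ) (p : ℝ × M) =>
      deriv (fun ε => partialF (γ ε) f (v ε) N p.2) p.1) D atTop (Ioo (-r) r ×ˢ univ)) (x : M) :
    HasDerivAt (fun ε => opF (γ ε) f (v ε) x) (D (0, x)) 0 := by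
  refine hasDerivAt_of_tendstoLocallyUniformlyOn (l := atTop) (s := Ioo (-r) r)
    (f := fun N ε => partialF (γ ε) f (v ε) N x)
    (f' := fun N ε => deriv (fun ε => partialF (γ ε) f (v ε) N x) ε) (g' := fun ε => D (ε, x))
    isOpen_Ioo ?_ (Eventually.of_forall fun N ε hε =>
      (hasDerivAt_partialF hγ hv f N hε x).differentiableAt.hasDerivAt) (fun ε hε => ?_)
    hγ.zero_mem
  · exact hD.comp (fun ε : ℝ => (ε, x)) (fun ε hε => ⟨hε, mem_univ x⟩) (by fun_prop)
  · obtain ⟨l, hl⟩ := hlim ε hε x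
    have : opF (γ ε) f (v ε) x = l := hl.limUnder_eq
    rw [this]
    exact hl

variable [T2Space M] [SigmaCompactSpace M]
  {K : Set M} (hK : IsCompact K) (hKγ : ∀ ε ∈ Ioo (-r) r, ∀ x ∉ K, γ ε x = g x)

include hK hKγ

/-- The variation of a partial sum of `𝓕(□) v`, tested against `A`: the sum over `n` of
`integral_mul_delta_iterate_box`. -/
lemma integral_mul_delta_partialF {v : ℝ → M → ℝ} (hv : SmoothFamily r v)
    (hvK : ∀ ε ∈ Ioo (-r) r, ∀ x ∉ K, v ε x = v 0 x) {A : M → ℝ} (hA : ChartContDiff ∞ A)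
    (f : ℕ → ℝ) (N : ℕ) :
    densityIntegral (scalarDensity g fun x =>
        A x * deriv (fun ε => partialF (γ ε) f (v ε) N x) 0) =
      densityIntegral (scalarDensity g fun x =>
        partialF g f A N x * deriv (fun ε => v ε x) 0) +
      (1 / 2) * ∑ n ∈ Finset.range N, f n * ∑ l ∈ Finset.range n,
        densityIntegral (pairingDensity g γ
          (fieldS g ((box g)^[l] A) ((box g)^[n - 1 - l] (v 0)))) := by
  have hg := hγ.metric_zero
  have e1 : densityIntegral (scalarDensity g fun x =>
        A x * deriv (fun ε => partialF (γ ε) f (v ε) N x) 0) =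
      ∑ n ∈ Finset.range N, f n * densityIntegral (scalarDensity g fun x =>
        A x * deriv (fun ε => (box (γ ε))^[n] (v ε) x) 0) := by
    rw [← densityIntegral_sum hK (Finset.range N) (D := fun n => scalarDensity g fun x =>
        A x * deriv (fun ε => (box (γ ε))^[n] (v ε) x) 0) (fun n => scalarDensity_continuous hg
      (hA.continuous.mul ((iterate_box_smoothFamily hγ hv n).variation hγ).continuous))
      (fun n => scalarDensity_supported fun x hx => ?_) f]
    · refine densityIntegral_congr fun c y hy => ?_
      simp only [scalarDensity, (hasDerivAt_partialF hγ hv f N hγ.zero_mem _).deriv,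
        Finset.mul_sum, Finset.sum_mul]
      exact Finset.sum_congr rfl fun n _ => by ring
    · rw [deriv_eq_zero_of_fixed (v := fun ε => (box (γ ε))^[n] (v ε)) hγ.pos fun ε hε =>
        iterate_box_fixed hγ hK.isClosed hKγ hvK n ε hε x hx, mul_zero]
  have e2 : densityIntegral (scalarDensity g fun x =>
        partialF g f A N x * deriv (fun ε => v ε x) 0) =
      ∑ n ∈ Finset.range N, f n * densityIntegral (scalarDensity g fun x =>
        (box g)^[n] A x * deriv (fun ε => v ε x) 0) := by
    rw [← densityIntegral_sum hK (Finset.range N) (D := fun n => scalarDensity g fun x =>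
        (box g)^[n] A x * deriv (fun ε => v ε x) 0) (fun n => scalarDensity_continuous hg
      ((iterate_box_smooth hg hA n).continuous.mul (hv.variation hγ).continuous))
      (fun n => scalarDensity_supported fun x hx => ?_) f]
    · refine densityIntegral_congr fun c y hy => ?_
      simp only [scalarDensity, partialF, Finset.sum_mul]
      exact Finset.sum_congr rfl fun n _ => by ring
    · rw [deriv_eq_zero_of_fixed hγ.pos fun ε hε => hvK ε hε x hx, mul_zero]
  rw [e1, e2, Finset.mul_sum, ← Finset.sum_add_distrib]
  refine Finset.sum_congr rfl fun n _ => ?_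
  rw [integral_mul_delta_iterate_box hγ hK hKγ hv hvK n hA]
  ring

/-- The variation of `𝓕(□) v`, tested against `A`, for a family `v` of scalars whose variation is
`q δR`. Both the integral of `A δ(𝓕(□) v)` and that of
`𝓕(□)A · q δR` are limits of the integrals of the partial sums; hence so is their difference. -/
theorem integral_mul_delta_opF {v : ℝ → M → ℝ} (hv : SmoothFamily r v)
    (hvK : ∀ ε ∈ Ioo (-r) r, ∀ x ∉ K, v ε x = v 0 x) {q : M → ℝ} (hq : ChartContDiff 2 q)
    (hqv : ∀ x, deriv (fun ε => v ε x) 0 = q x * deltaR γ x) {A : M → ℝ}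
    (hA : ChartContDiff ∞ A) {f : ℕ → ℝ}
    (hunif : TendstoLocallyUniformly (partialF g f A) (opF g f A) atTop)
    (hF : ChartContDiff 2 (opF g f A)) {D : ℝ × M → ℝ}
    (hD : TendstoLocallyUniformlyOn (fun (N : ℕ) (p : ℝ × M) =>
      deriv (fun ε => partialF (γ ε) f (v ε) N p.2) p.1) D atTop (Ioo (-r) r ×ˢ univ)) :
    DensityIntegrable (scalarDensity g fun x => A x * D (0, x)) ∧
    Tendsto (fun N : ℕ => ∑ n ∈ Finset.Icc 1 N, f n * ∑ l ∈ Finset.range n,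
      densityIntegral (pairingDensity g γ
        (fieldS g ((box g)^[l] A) ((box g)^[n - 1 - l] (v 0))))) atTop
      (𝓝 (2 * (densityIntegral (scalarDensity g fun x => A x * D (0, x)) -
        densityIntegral (pairingDensity g γ (ricciMinusK g fun x => q x * opF g f A x))))) := by
  have hg := hγ.metric_zero
  have hD0 : TendstoLocallyUniformly
      (fun (N : ℕ) x => deriv (fun ε => partialF (γ ε) f (v ε) N x) 0)
      (fun x => D (0, x)) atTop :=
    tendstoLocallyUniformlyOn_univ.1 (hD.comp (fun x : M => ((0 : ℝ), x))
      (fun x _ => ⟨hγ.zero_mem, mem_univ x⟩) (by fun_prop))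
  have hw0 : ∀ n, ∀ x ∉ K, deriv (fun ε => (box (γ ε))^[n] (v ε) x) 0 = 0 := fun n x hx =>
    deriv_eq_zero_of_fixed (v := fun ε => (box (γ ε))^[n] (v ε)) hγ.pos fun ε hε =>
      iterate_box_fixed hγ hK.isClosed hKγ hvK n ε hε x hx
  have hsum : ∀ N, (fun x => deriv (fun ε => partialF (γ ε) f (v ε) N x) 0) = fun x =>
      ∑ n ∈ Finset.range N, f n * deriv (fun ε => (box (γ ε))^[n] (v ε) x) 0 := fun N =>
    funext fun x => (hasDerivAt_partialF hγ hv f N hγ.zero_mem x).deriv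
  -- the variations of the partial sums, integrated against `A √(-g)`
  obtain ⟨hint, hlim₁⟩ := tendsto_densityIntegral hK
    (scalarDensity_continuous hg hA.continuous) (fun N => by
      rw [hsum N]
      exact continuous_finsetSum _ fun n _ => continuous_const.mul
        ((iterate_box_smoothFamily hγ hv n).variation hγ).continuous) hD0
    (fun N c y hy h => by
      simp only [(hasDerivAt_partialF hγ hv f N hγ.zero_mem _).deriv, hw0 _ _ h, mul_zero,
        Finset.sum_const_zero, zero_mul])
  -- the partial sums of `𝓕(□) A`, integrated against `q δR √(-g)`
  obtain ⟨-, hlim₂⟩ := tendsto_densityIntegral hK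
    (scalarDensity_continuous (u := fun x => q x * deltaR γ x) hg
      (hq.continuous.mul (deltaR_smooth hγ).continuous)) (v := partialF g f A)
    (fun N => continuous_finsetSum _ fun n _ => continuous_const.mul
      (iterate_box_smooth hg hA n).continuous) hunif
    (fun N c y hy h => by
      simp only [scalarDensity, deltaR_eq_zero_off hγ hK hKγ h, mul_zero, zero_mul])
  have r1 : ∀ w : M → ℝ,
      (fun (c : M) y => w ((extChartAt (𝓡 4) c).symm y) * scalarDensity g A c y) =
      scalarDensity g fun x => A x * w x := fun w => by
    funext c y
    simp only [scalarDensity]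
    ring
  have r2 : ∀ w : M → ℝ, (fun (c : M) y => w ((extChartAt (𝓡 4) c).symm y) *
      scalarDensity g (fun x => q x * deltaR γ x) c y) =
      scalarDensity g fun x => w x * deriv (fun ε => v ε x) 0 := fun w => by
    funext c y
    simp only [scalarDensity, hqv]
    ring
  have r3 : densityIntegral (scalarDensity g fun x =>
      opF g f A x * deriv (fun ε => v ε x) 0) =
      densityIntegral (pairingDensity g γ (ricciMinusK g fun x => q x * opF g f A x)) := by
    rw [← integral_mul_deltaR hγ hK hKγ (hq.mul hF)]
    refine densityIntegral_congr fun c y hy => ?_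
    simp only [scalarDensity, hqv]
    ring
  rw [r1 fun x => D (0, x)] at hint hlim₁
  rw [r2, r3] at hlim₂
  simp only [fun N => r1 fun x => deriv (fun ε => partialF (γ ε) f (v ε) N x) 0] at hlim₁
  simp only [r2] at hlim₂
  refine ⟨hint, ?_⟩
  have h1 := ((hlim₁.sub hlim₂).const_mul 2).comp (tendsto_add_atTop_nat 1)
  refine h1.congr fun N => ?_
  simp only [Function.comp_apply]
  -- the term with `n = 0` is an empty sum over `l`
  rw [integral_mul_delta_partialF hγ hK hKγ hv hvK hA f (N + 1), Finset.range_eq_Ico,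
    Finset.sum_eq_sum_Ico_succ_bot (Nat.succ_pos N)]
  simp only [Finset.range_zero, Finset.sum_empty, mul_zero, zero_add]
  rw [add_sub_cancel_left, ← mul_assoc]
  norm_num
  rfl

end Series

end NonlocalGravity

end

theorem theorem1 {M : Type*} [TopologicalSpace M] [ChartedSpace E4 M]
    [IsManifold (𝓡 4) ∞ M] [T2Space M] [SigmaCompactSpace M]
    (g : BilinField M) (γ : ℝ → BilinField M) (r : ℝ) (hγ : IsVariation g γ r)
    (U : Set ℝ) (hU : IsOpen U) (hRU : ∀ x, scalarCurv g x ∈ U)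
    (P Q : ℝ → ℝ) (hP : ContDiffOn ℝ ∞ P U) (hQ : ContDiffOn ℝ ∞ Q U) :
    -- the variation of the inverse metric exists
    (∀ c : M, ∀ y ∈ (extChartAt (𝓡 4) c).target, ∀ μ ν : Fin 4,
      DifferentiableAt ℝ (fun ε => (comp (γ ε) c y)⁻¹ μ ν) 0) ∧
    -- the first identity
    ((∀ c : M, ∀ y ∈ (extChartAt (𝓡 4) c).target,
        DifferentiableAt ℝ (fun ε => sqrtNegDet (γ ε) c y) 0) ∧
      DensityIntegrable (fun c y =>
        P (scalarCurv g ((extChartAt (𝓡 4) c).symm y)) * deltaSqrt γ c y) ∧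
      DensityIntegrable (pairingDensity g γ fun c μ ν y =>
        comp g c y μ ν * P (scalarCurv g ((extChartAt (𝓡 4) c).symm y))) ∧
      densityIntegral (fun c y =>
          P (scalarCurv g ((extChartAt (𝓡 4) c).symm y)) * deltaSqrt γ c y) =
        -(1 / 2) * densityIntegral (pairingDensity g γ fun c μ ν y =>
          comp g c y μ ν * P (scalarCurv g ((extChartAt (𝓡 4) c).symm y)))) ∧
    -- the second identity
    ((∀ x, DifferentiableAt ℝ (fun ε => scalarCurv (γ ε) x) 0) ∧
      DensityIntegrable (scalarDensity g fun x => P (scalarCurv g x) * deltaR γ x) ∧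
      DensityIntegrable (pairingDensity g γ
        (ricciMinusK g fun x => P (scalarCurv g x))) ∧
      densityIntegral (scalarDensity g fun x => P (scalarCurv g x) * deltaR γ x) =
        densityIntegral (pairingDensity g γ
          (ricciMinusK g fun x => P (scalarCurv g x)))) ∧
    -- the third identity
    (∀ f : ℕ → ℝ,
      -- `𝓕(□) P` is defined, and twice continuously differentiable
      TendstoLocallyUniformly (partialF g f fun x => P (scalarCurv g x))
        (opF g f fun x => P (scalarCurv g x)) atTop →
      ContMDiff (𝓡 4) 𝓘(ℝ, ℝ) 2 (opF g f fun x => P (scalarCurv g x)) →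
      -- `𝓕(□) Q` is defined along the variation, as is the series of the derivatives in `ε`
      (∀ ε ∈ Ioo (-r) r, ∀ x : M, ∃ l : ℝ,
        Tendsto (fun N => partialF (γ ε) f (fun z => Q (scalarCurv (γ ε) z)) N x)
          atTop (𝓝 l)) →
      (∃ D : ℝ × M → ℝ, TendstoLocallyUniformlyOn
        (fun (N : ℕ) (p : ℝ × M) =>
          deriv (fun ε => partialF (γ ε) f (fun z => Q (scalarCurv (γ ε) z)) N p.2) p.1)
        D atTop (Ioo (-r) r ×ˢ univ)) →
      (∀ x, DifferentiableAt ℝ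
        (fun ε => opF (γ ε) f (fun z => Q (scalarCurv (γ ε) z)) x) 0) ∧
      DensityIntegrable (scalarDensity g fun x => P (scalarCurv g x) * deltaF γ f Q x) ∧
      DensityIntegrable (pairingDensity g γ (ricciMinusK g fun x =>
        deriv Q (scalarCurv g x) * opF g f (fun z => P (scalarCurv g z)) x)) ∧
      (∀ l m : ℕ, DensityIntegrable (pairingDensity g γ
        (fieldS g ((box g)^[l] fun x => P (scalarCurv g x))
          ((box g)^[m] fun x => Q (scalarCurv g x))))) ∧
      ∃ s : ℝ,
        Tendsto (fun N : ℕ => ∑ n ∈ Finset.Icc 1 N, f n * ∑ l ∈ Finset.range n,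
          densityIntegral (pairingDensity g γ
            (fieldS g ((box g)^[l] fun x => P (scalarCurv g x))
              ((box g)^[n - 1 - l] fun x => Q (scalarCurv g x))))) atTop (𝓝 s) ∧
        densityIntegral (scalarDensity g fun x => P (scalarCurv g x) * deltaF γ f Q x) =
          densityIntegral (pairingDensity g γ (ricciMinusK g fun x =>
            deriv Q (scalarCurv g x) * opF g f (fun z => P (scalarCurv g z)) x)) +
          (1 / 2) * s) := by
  have hg := hγ.metric_zero
  obtain ⟨K, hK, hKγ⟩ := hγ.compact_support
  have hR : ChartContDiff ∞ (scalarCurv g) := by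
    have := (scalarCurv_smoothFamily hγ).slice hγ.zero_mem
    rwa [hγ.zero] at this
  have hPR : ChartContDiff ∞ (fun x => P (scalarCurv g x)) := hR.comp_contDiffOn hRU hP
  refine ⟨fun c y hy μ ν => ((hγ.metricFamily c).hasDerivAt_inv hy μ ν).differentiableAt,
    ⟨fun c y hy => ((hγ.metricFamily c).hasDerivAt_vol hy).differentiableAt, ?_, ?_, ?_⟩,
    ⟨fun x => (scalarCurv_smoothFamily hγ).differentiableAt hγ.zero_mem x, ?_, ?_,
      integral_mul_deltaR hγ hK hKγ (hPR.of_le two_le_infty)⟩, ?_⟩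
  · refine densityIntegrable_of_compact hK (fun c => (hPR c).continuousOn.mul
      (hγ.metricFamily c).dVol_smooth.continuousOn) fun c y hy h => ?_
    exact mul_eq_zero_of_right _ (dVol_eq_zero_off hγ hK.isClosed hKγ hy h)
  · exact densityIntegrable_of_compact hK (pairingDensity_continuous hγ fun c μ ν =>
      (hg.smooth c μ ν).continuousOn.mul (hPR c).continuousOn)
      (pairingDensity_supported hγ hK.isClosed hKγ _)
  · rw [← densityIntegral_const_mul]
    refine densityIntegral_congr fun c y hy => ?_
    have h : deltaSqrt γ c y = -(1 / 2) * (∑ μ, ∑ ν, comp g c y μ ν * deltaInv γ c μ ν y) *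
        sqrtNegDet g c y := by
      have h := (hγ.metricFamily c).dVol_eq hy
      rw [dLogVol, hγ.comp_zero] at h
      exact h
    simp only [h, pairingDensity, mul_right_comm _ (P _), ← Finset.sum_mul]
    ring
  · exact densityIntegrable_of_compact hK
      (scalarDensity_continuous hg (hPR.continuous.mul (deltaR_smooth hγ).continuous))
      (scalarDensity_supported fun x hx => by rw [deltaR_eq_zero_off hγ hK hKγ hx, mul_zero])
  · exact densityIntegrable_of_compact hK (pairingDensity_continuous hγ
      (ricciMinusK_continuousOn hg (hPR.of_le two_le_infty)))
      (pairingDensity_supported hγ hK.isClosed hKγ _)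
  · intro f hunif hC2 hlim hD
    obtain ⟨D, hD⟩ := hD
    -- `Q(R_ε)` is a smooth family only as long as `R_ε` takes its values in `U`
    obtain ⟨r', hr0, hrr, hRU'⟩ := exists_radius_scalarCurv_mem hγ hU hRU
    have hsub : Ioo (-r') r' ⊆ Ioo (-r) r := Ioo_subset_Ioo (by linarith) hrr
    have hγ' := hγ.mono hr0 hrr
    have hKγ' : ∀ ε ∈ Ioo (-r') r', ∀ x ∉ K, γ ε x = g x := fun ε hε => hKγ ε (hsub hε)
    have hlim' := fun ε hε => hlim ε (hsub hε)
    have hD' := hD.mono (prod_mono hsub (le_refl (univ : Set M)))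
    have hv : SmoothFamily r' (fun ε z => Q (scalarCurv (γ ε) z)) :=
      (scalarCurv_smoothFamily hγ').comp_contDiffOn hRU' hQ
    have hvK : ∀ ε ∈ Ioo (-r') r', ∀ x ∉ K, Q (scalarCurv (γ ε) x) = Q (scalarCurv (γ 0) x) :=
      fun ε hε x hx => by rw [scalarCurv_fixed hγ' hK.isClosed hKγ' hε hx]
    have hq : ChartContDiff ∞ (fun x => deriv Q (scalarCurv g x)) :=
      hR.comp_contDiffOn hRU (((contDiffOn_infty_iff_deriv_of_isOpen hU).1 hQ).2)
    have hqv : ∀ x, deriv (fun ε => Q (scalarCurv (γ ε) x)) 0 =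
        deriv Q (scalarCurv g x) * deltaR γ x := fun x => by
      have h1 : DifferentiableAt ℝ Q (scalarCurv (γ 0) x) := by
        rw [hγ.zero]
        exact ((hQ.contDiffAt (hU.mem_nhds (hRU x))).differentiableAt (by simp))
      have h2 := (scalarCurv_smoothFamily hγ).differentiableAt hγ.zero_mem x
      have h3 := (h1.hasDerivAt.comp (0 : ℝ) h2.hasDerivAt).deriv
      rw [hγ.zero] at h3
      exact h3
    have hF : ChartContDiff 2 (opF g f fun x => P (scalarCurv g x)) :=
      chartContDiff_of_contMDiff two_le_infty hC2
    have hderiv := hasDerivAt_opF hγ' hv hlim' hD'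
    have hdF : deltaF γ f Q = fun x => D (0, x) := funext fun x => (hderiv x).deriv
    obtain ⟨hint, hs⟩ := integral_mul_delta_opF hγ' hK hKγ' hv hvK (hq.of_le two_le_infty) hqv hPR
      hunif hF hD'
    have hQR : ChartContDiff ∞ (fun x => Q (scalarCurv g x)) := hR.comp_contDiffOn hRU hQ
    refine ⟨fun x => (hderiv x).differentiableAt, hdF ▸ hint, ?_, fun l m => ?_, _,
      by simpa only [hγ.zero] using hs, ?_⟩
    · exact densityIntegrable_of_compact hK (pairingDensity_continuous hγ
        (ricciMinusK_continuousOn hg ((hq.of_le two_le_infty).mul hF)))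
        (pairingDensity_supported hγ hK.isClosed hKγ _)
    · exact densityIntegrable_of_compact hK (pairingDensity_continuous hγ
        (fieldS_continuousOn hg ((iterate_box_smooth hg hPR l).of_le two_le_infty)
          ((iterate_box_smooth hg hQR m).of_le two_le_infty)))
        (pairingDensity_supported hγ hK.isClosed hKγ _)
    · rw [hdF]
      ring
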